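/- **Setting.** Let $\phi=\mathbf 1_{[0,1]}$ and let $\psi,\tilde\phi,\tilde\psi:\mathbb R\to\mathbb R$ be compactly supported functions with $\psi$ piecewise constant. Put $\phi_k(x)=\phi(x-k)$, $\psi_{j,k}(x)=2^{j/2}\psi(2^jx-k)$, and likewise $\tilde\phi_k,\tilde\psi_{j,k}$, for $j\ge 0$, $k\in\mathbb Z$. Let $\Lambda=\{(j,k):j\ge-1,\,k\in\mathbb Z\}$, with $\varphi_{(-1,k)}=\phi_k$, $\varphi_{(j,k)}=\psi_{j,k}$ for $j\ge0$, and $\tilde\varphi_\lambda$ defined in the same way from $\tilde\phi_k,\tilde\psi_{j,k}$. Assume that $\Phi=\{\phi,\psi,\tilde\phi,\tilde\psi\}$ generates a biorthogonal wavelet basis of $\mathbb L_2(\mathbb R)$ with parameter $r\ge 0$, that is: $\int\varphi_\lambda\tilde\varphi_{\lambda'}=\mathbf 1_{\lambda=\lambda'}$ for all $\lambda,\lambda'\in\Lambda$; the finite linear combinations of $(\tilde\varphi_\lambda)_{\lambda\in\Lambda}$ are dense in $\mathbb L_2(\mathbb R)$; $\psi$ is orthogonal to the polynomials of degree at most $r$;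 and either $r>0$ and $\tilde\phi,\tilde\psi$ belong to the Hölder space $C^{r+1}$, or $r=0$ and the basis is the Haar basis ($\tilde\phi=\phi$, $\tilde\psi=\psi=\mathbf 1_{[0,1/2]}-\mathbf 1_{[1/2,1]}$). For $f\in\mathbb L_2(\mathbb R)$ put $\beta_\lambda=\int\varphi_\lambda f$, $\alpha_k=\beta_{(-1,k)}$, $\beta_{j,k}=\beta_{(j,k)}$, and let $$\|f\|_{\alpha,p,q}=\|(\alpha_k)_k\|_{\ell_p}+\Big\|\big(2^{j(\alpha+\frac12-\frac1p)}\|(\beta_{j,k})_k\|_{\ell_p}\big)_{j\ge0}\Big\|_{\ell_q}.$$ $\mathcal B^\alpha_{p,q}(R)$ denotes the ball $\{\|f\|_{\alpha,p,q}\le R\}$, and $\mathbb L_i(R')=\{\|f\|_i\le R'\}$ for $i=1,2$. For an integer $n\ge2$ and a nonnegative $f\in \mathbb L_1\cap\mathbb L_2$, one observes a Poisson process $N$ on $\mathbb R$ with mean measure $n f(x)\,dx$. Given $c\ge1$ and $\gamma>c$, let $j_0$ be the integer with $2^{j_0}\le n^c(\log n)^{-c}<2^{j_0+1}$, and set $$\hat\beta_\lambda=\frac1n\int\varphi_\lambda\,dN,\qquad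 \hat V_\lambda=\frac1{n^2}\int\varphi_\lambda^2\,dN,$$ $$\tilde V_\lambda=\hat V_\lambda+\sqrt{2\gamma\log n\,\hat V_\lambda\frac{\|\varphi_\lambda\|_\infty^2}{n^2}}+3\gamma\log n\,\frac{\|\varphi_\lambda\|_\infty^2}{n^2},\qquad \eta_\lambda=\sqrt{2\gamma\tilde V_\lambda\log n}+\frac{\gamma\log n}{3n}\|\varphi_\lambda\|_\infty,$$ $$\tilde f_{n,\gamma}=\sum_{\lambda=(j,k)\in\Lambda,\ j\le j_0}\hat\beta_\lambda\,\mathbf 1_{\{|\hat\beta_\lambda|\ge\eta_\lambda\}}\,\tilde\varphi_\lambda .$$ **Theorem.** Let $R,R'>0$, $2<p\le\infty$, $1\le q\le\infty$, $0<\alpha<r+1$, $c\ge1$ and $\gamma>c$. There is a constant $C$, depending only on $\gamma,c,R,R',\alpha,p$ and $\Phi$, such that for every integer $n\ge2$, $$\sup_{f\in\mathcal B^\alpha_{p,q}(R)\cap\mathbb L_1(R')\cap\mathbb L_2(R'),\ f\ge 0}\mathbb E\big(\|\tilde f_{n,\gamma}-f\|_2^2\big)\le C\left(\frac{\log n}{n}\right)^{\frac{\alpha}{\alpha+1-\frac1p}}$$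 (with $1/p=0$ if $p=\infty$). -/

import Mathlib

open MeasureTheory ProbabilityTheory
open scoped ENNReal NNReal

noncomputable section

namespace PoissonWavelet

/-! ## Poisson processes -/

/-- The Poisson law with parameter `m ∈ [0, ∞]`, as a law on `ℕ∞`; for `m = ∞` it is the point mass
at `∞`. -/
def poissonLaw (m : ℝ≥0∞) : Measure ℕ∞ :=
  if m = ∞ then Measure.dirac ⊤
  else (poissonMeasure m.toNNReal).map (fun k : ℕ => (k : ℕ∞))

/-- The number `N_A` of points of the random set `N` lying in `A`. -/
def countIn {Ω X : Type*} (N : Ω → Set X) (A : Set X) (ω : Ω) : ℕ∞ := (N ω ∩ A).encard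

/-- `N` is a Poisson process on `X` with mean measure `μ`: a random countable subset of `X`
whose counts over measurable sets are Poisson random variables with parameter `μ A`, and whose
counts over finitely many disjoint measurable sets are independent. -/
structure IsPoissonProcess {Ω X : Type*} [MeasurableSpace Ω] [MeasurableSpace X]
    (N : Ω → Set X) (μ : Measure X) (P : Measure Ω) : Prop where
  countable : ∀ ω, (N ω).Countable
  measurable_count : ∀ A : Set X, MeasurableSet A → Measurable (countIn N A)
  law_count : ∀ A : Set X, MeasurableSet A → P.map (countIn N A) = poissonLaw (μ A)
  indep_count : ∀ (m : ℕ) (A : Fin m → Set X), (∀ i, MeasurableSet (A i)) →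
    Pairwise (fun i j => Disjoint (A i) (A j)) → iIndepFun (fun i => countIn N (A i)) P

/-- The integral `∫ g dN = ∑_{T ∈ N} g(T)` of `g` against the point measure of a set `S` of
points. -/
def pointIntegral (S : Set ℝ) (g : ℝ → ℝ) : ℝ := ∑' x : S, g x

/-! ## Biorthogonal wavelet bases -/

/-- The index set `Λ = {(j, k) : j ≥ -1, k ∈ ℤ}`: `Sum.inl k` is the index `(-1, k)` and
`Sum.inr (j, k)` is the index `(j, k)` with `j ≥ 0`. -/
abbrev Index : Type := ℤ ⊕ (ℕ × ℤ)

/-- The resolution level `j ≥ -1` of an index. -/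
def Index.level : Index → ℤ
  | Sum.inl _ => -1
  | Sum.inr jk => (jk.1 : ℤ)

/-- The analysis father wavelet `φ = 1_{[0,1]}`. -/
def father : ℝ → ℝ := Set.indicator (Set.Icc 0 1) 1

/-- The Haar mother wavelet `1_{[0,1/2]} - 1_{[1/2,1]}`. -/
def haarMother : ℝ → ℝ :=
  Set.indicator (Set.Icc 0 (1 / 2)) 1 - Set.indicator (Set.Icc (1 / 2) 1) 1

/-- The translate `x ↦ g(x - k)`. -/
def translate (g : ℝ → ℝ) (k : ℤ) (x : ℝ) : ℝ := g (x - k)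

/-- The dilated translate `x ↦ 2^{j/2} g(2^j x - k)`. -/
def dilate (g : ℝ → ℝ) (j : ℕ) (k : ℤ) (x : ℝ) : ℝ :=
  (2 : ℝ) ^ ((j : ℝ) / 2) * g (2 ^ j * x - k)

/-- `g` is piecewise constant: off a finite set of breakpoints it is constant on every interval
containing no breakpoint. -/
def IsPiecewiseConstant (g : ℝ → ℝ) : Prop :=
  ∃ S : Finset ℝ, ∀ x y : ℝ, x ≤ y → (∀ z ∈ Set.Icc x y, z ∉ S) → g x = g y

/-- The Hölder space of order `s ≥ 0`: with `m = ⌊s⌋`, the derivatives up to order `m` exist, are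
continuous and bounded, and the derivative of order `m` is Hölder continuous with exponent
`s - m`. -/
def IsHolderOfOrder (s : ℝ) (g : ℝ → ℝ) : Prop :=
  ContDiff ℝ (⌊s⌋₊ : ℕ) g ∧
  (∀ i ≤ ⌊s⌋₊, ∃ B : ℝ, ∀ x, |iteratedDeriv i g x| ≤ B) ∧
  ∃ K : ℝ≥0, HolderWith K (s - ⌊s⌋₊).toNNReal (iteratedDeriv ⌊s⌋₊ g)

/-- The functions which, together with `φ = 1_{[0,1]}`, generate a biorthogonal wavelet basis:
the analysis mother wavelet `ψ`, and the reconstruction father and mother wavelets `φ̃`, `ψ̃`. -/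
structure Generators where
  mother : ℝ → ℝ
  dualFather : ℝ → ℝ
  dualMother : ℝ → ℝ

namespace Generators

variable (Φ : Generators)

/-- The analysis wavelet `φ_λ`: it is `φ_k` if `λ = (-1, k)`, and `ψ_{j,k}` if `λ = (j, k)` with
`j ≥ 0`. -/
def analysis : Index → ℝ → ℝ
  | Sum.inl k => translate father k
  | Sum.inr jk => dilate Φ.mother jk.1 jk.2

/-- The reconstruction wavelet `φ̃_λ`: it is `φ̃_k` if `λ = (-1, k)`, and `ψ̃_{j,k}` if
`λ = (j, k)` with `j ≥ 0`. -/
def reconstruction : Index → ℝ → ℝ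
  | Sum.inl k => translate Φ.dualFather k
  | Sum.inr jk => dilate Φ.dualMother jk.1 jk.2

/-- `Φ` generates a biorthogonal wavelet basis of `L₂(ℝ)` with piecewise constant analysis
wavelets and with regularity parameter `r`. Either `r > 0` and the reconstruction wavelets are in
the Hölder space of order `r + 1`, or `r = 0` and the basis is the Haar basis. -/
structure IsBiorthogonalBasis (r : ℝ) : Prop where
  compact_mother : HasCompactSupport Φ.mother
  compact_dualFather : HasCompactSupport Φ.dualFather
  compact_dualMother : HasCompactSupport Φ.dualMother
  regular :
    (0 < r ∧ IsHolderOfOrder (r + 1) Φ.dualFather ∧ IsHolderOfOrder (r + 1) Φ.dualMother) ∨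
    (r = 0 ∧ Φ.mother = haarMother ∧ Φ.dualFather = father ∧ Φ.dualMother = haarMother)
  piecewiseConstant : IsPiecewiseConstant Φ.mother
  vanishing_moments : ∀ i : ℕ, (i : ℝ) ≤ r → ∫ x, x ^ i * Φ.mother x = 0
  biorthogonal : ∀ l l' : Index,
    ∫ x, Φ.analysis l x * Φ.reconstruction l' x = if l = l' then 1 else 0
  /-- Completeness: finite linear combinations of the reconstruction wavelets are dense in
  `L₂(ℝ)`. -/
  complete : ∀ g : ℝ → ℝ, MemLp g 2 volume → ∀ ε : ℝ, 0 < ε → ∃ a : Index →₀ ℝ,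
    eLpNorm (fun x => g x - a.sum (fun l t => t * Φ.reconstruction l x)) 2 volume
      ≤ ENNReal.ofReal ε

/-! ## Coefficients and Besov balls -/

/-- The wavelet coefficient `β_λ = ∫ φ_λ f`. -/
def coeff (f : ℝ → ℝ) (l : Index) : ℝ := ∫ x, Φ.analysis l x * f x

/-- `‖(α_k)_k‖_{ℓ_p}`. -/
def coarseNorm (p : ℝ≥0∞) (f : ℝ → ℝ) : ℝ≥0∞ :=
  eLpNorm (fun k : ℤ => Φ.coeff f (Sum.inl k)) p Measure.count

/-- `2^{j(α + 1/2 - 1/p)} ‖(β_{j,k})_k‖_{ℓ_p}`. -/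
def detailNorm (α : ℝ) (p : ℝ≥0∞) (f : ℝ → ℝ) (j : ℕ) : ℝ≥0∞ :=
  ENNReal.ofReal ((2 : ℝ) ^ ((j : ℝ) * (α + 1 / 2 - (p⁻¹).toReal))) *
    eLpNorm (fun k : ℤ => Φ.coeff f (Sum.inr (j, k))) p Measure.count

/-- The (possibly infinite) Besov sequence norm `‖f‖_{α,p,q}`. -/
def besovNorm (α : ℝ) (p q : ℝ≥0∞) (f : ℝ → ℝ) : ℝ≥0∞ :=
  Φ.coarseNorm p f +
    if q = ∞ then ⨆ j : ℕ, Φ.detailNorm α p f j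
    else (∑' j : ℕ, Φ.detailNorm α p f j ^ q.toReal) ^ (q.toReal)⁻¹

/-- `f` is a nonnegative element of `B^α_{p,q}(R) ∩ L₁(R') ∩ L₂(R')`, the balls being those of
radius `R`, `R'` and `R'`. -/
structure IsIntensityInBall (α : ℝ) (p q : ℝ≥0∞) (R R' : ℝ) (f : ℝ → ℝ) : Prop where
  nonneg : 0 ≤ᵐ[volume] f
  memL1 : MemLp f 1 volume
  memL2 : MemLp f 2 volume
  besov_le : Φ.besovNorm α p q f ≤ ENNReal.ofReal R
  norm1_le : eLpNorm f 1 volume ≤ ENNReal.ofReal R'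
  norm2_le : eLpNorm f 2 volume ≤ ENNReal.ofReal R'

/-! ## The thresholding estimator

Here `S` is the observed set of points, `n` the known scaling parameter, `γ` the threshold
constant and `j₀` the maximal resolution level. -/

/-- `‖φ_λ‖_∞`. -/
def supNorm (l : Index) : ℝ := (eLpNorm (Φ.analysis l) ∞ volume).toReal

/-- The empirical coefficient `β̂_λ = (1/n) ∫ φ_λ dN`. -/
def empCoeff (n : ℕ) (S : Set ℝ) (l : Index) : ℝ :=
  1 / (n : ℝ) * pointIntegral S (Φ.analysis l)

/-- The empirical variance `V̂_{λ,n} = (1/n²) ∫ φ_λ² dN`. -/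
def empVar (n : ℕ) (S : Set ℝ) (l : Index) : ℝ :=
  1 / (n : ℝ) ^ 2 * pointIntegral S (fun x => Φ.analysis l x ^ 2)

/-- The overestimated variance `Ṽ_{λ,n}`. -/
def overVar (γ : ℝ) (n : ℕ) (S : Set ℝ) (l : Index) : ℝ :=
  Φ.empVar n S l
    + √(2 * γ * Real.log n * Φ.empVar n S l * (Φ.supNorm l ^ 2 / (n : ℝ) ^ 2))
    + 3 * γ * Real.log n * (Φ.supNorm l ^ 2 / (n : ℝ) ^ 2)

/-- The random threshold `η_{λ,γ}`. -/
def threshold (γ : ℝ) (n : ℕ) (S : Set ℝ) (l : Index) : ℝ :=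
  √(2 * γ * Φ.overVar γ n S l * Real.log n) + γ * Real.log n / (3 * n) * Φ.supNorm l

open Classical in
/-- The thresholded coefficient `β̃_λ = β̂_λ 1_{|β̂_λ| ≥ η_{λ,γ}} 1_{λ ∈ Γ_n}`, where
`Γ_n = {λ = (j, k) : j ≤ j₀}`. -/
def thrCoeff (γ : ℝ) (n : ℕ) (j₀ : ℤ) (S : Set ℝ) (l : Index) : ℝ :=
  if Φ.threshold γ n S l ≤ |Φ.empCoeff n S l| ∧ l.level ≤ j₀ then Φ.empCoeff n S l else 0

/-- The estimator `f̃_{n,γ} = ∑_λ β̃_λ φ̃_λ`. For compactly supported reconstruction wavelets only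
finitely many terms are nonzero at each point. -/
def estimator (γ : ℝ) (n : ℕ) (j₀ : ℤ) (S : Set ℝ) (x : ℝ) : ℝ :=
  ∑' l : Index, Φ.thrCoeff γ n j₀ S l * Φ.reconstruction l x

/-- The quadratic risk `E ‖f̃_{n,γ} - f‖₂²`, with values in `[0, ∞]`. -/
def risk {Ω : Type*} [MeasurableSpace Ω] (γ : ℝ) (n : ℕ) (j₀ : ℤ) (f : ℝ → ℝ) (N : Ω → Set ℝ)
    (P : Measure Ω) : ℝ≥0∞ :=
  ∫⁻ ω, (∫⁻ x, ENNReal.ofReal ((Φ.estimator γ n j₀ (N ω) x - f x) ^ 2)) ∂P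

end Generators

end PoissonWavelet

end

noncomputable section

namespace PoissonWavelet

/-! ## Exponential moments of Poisson integrals -/

/-! The squared `L₂` error is replaced by the `ℓ₂` error of the coefficients
(`exists_distance_bound`). Completeness approximates `f` by a finite combination of reconstruction
wavelets; the upper Riesz bound for the reconstruction system and Bessel's inequality for the
analysis system carry the comparison over to coefficients. Both come from Schur's test: a mean-zero
dilated wavelet of relative level `d`, paired with a function of bounded variation, gives at most
`2^(-d/2)` times a constant times the variation on its cell, so Gram rows decay geometrically in the
level difference.

Each coefficient obeys an oracle inequality (`risk_coefficient`). Since `φ_λ` is piecewise constant,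
`∫ φ_λ dN` is a finite combination of independent Poisson counts, and Bernstein's inequality holds
with an estimated variance (`deviation`). The threshold `η` is this random bound with exponent `γ
log n`. With exponent `c log n` the bound is at most `κ η`, where `κ = √(c/γ) < 1`; so outside an
event of probability `3 n^(-c)` the estimate errs by at most `κ η`, and hard thresholding costs a
constant times `min(β², η²)`. The exceptional event is handled by exponential moments when the cell
has large expected mass (`risk_large`); when it has small mass, survival of the coefficient itself
requires exceptionally many points (`risk_small`). With `ε = log n / n` and `F` the `f`-mass of the
cell, the outcome is a constant times `min(β², 2^j F ε) + n^(-c) (β² + 2^j F ε)`. Every term is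
proportional to `β²` or `F`, hence summable over translates.

At level `j` the cells overlap boundedly, so the variance terms sum to order `2^j ε`. Interpolating
`ℓ₂` between `ℓ₁` (controlled by the `L₁` norm) and `ℓ_p` (the Besov norm) gives `∑ β² ≲ 2^(-ja)`
with `a = α / (1 - 1/p)`. Then `∑_j min(2^j ε, 2^(-ja))` is of order `ε^(a/(1+a))`, and `a/(1+a) =
α/(α+1-1/p)`. Beyond `j₀` one has `2^j ε ≥ 1` because `c ≥ 1`, so the bias is already the minimum
there, while `n^(-c) 2^(j₀)` stays bounded and the remainders are absorbed. -/

lemma hasSum_poisson_exp (m : ℝ≥0) (s : ℝ) :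
    HasSum (fun k : ℕ => Real.exp (-m) * (m : ℝ) ^ k / (k.factorial : ℝ) * Real.exp (s * k))
      (Real.exp (m * (Real.exp s - 1))) := by
  have h := (NormedSpace.expSeries_div_hasSum_exp ((m : ℝ) * Real.exp s)).mul_left (Real.exp (-m))
  rw [← Real.exp_eq_exp_ℝ, ← Real.exp_add] at h
  convert! h using 1
  · ext k
    rw [mul_pow, ← Real.exp_nat_mul, mul_comm s]
    ring
  · ring_nf

lemma integrable_poisson_exp (m : ℝ≥0) (s : ℝ) :
    Integrable (fun k : ℕ => Real.exp (s * k)) (poissonMeasure m) := by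
  rw [integrable_poissonMeasure_iff]
  simpa only [Real.norm_eq_abs, Real.abs_exp] using (hasSum_poisson_exp m s).summable

lemma integral_poisson_exp (m : ℝ≥0) (s : ℝ) :
    ∫ k : ℕ, Real.exp (s * k) ∂(poissonMeasure m) = Real.exp (m * (Real.exp s - 1)) := by
  rw [integral_poissonMeasure]
  simpa only [smul_eq_mul] using (hasSum_poisson_exp m s).tsum_eq

lemma hasSum_poisson_mean (m : ℝ≥0) :
    HasSum (fun k : ℕ => Real.exp (-m) * (m : ℝ) ^ k / (k.factorial : ℝ) * k) m := by
  rw [← hasSum_nat_add_iff' 1]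
  have h := (hasSum_one_poissonMeasure m).mul_left (m : ℝ)
  convert! h using 1
  · ext k
    rw [Nat.factorial_succ]
    push_cast
    field_simp
    ring
  · simp

lemma integrable_poisson_id (m : ℝ≥0) :
    Integrable (fun k : ℕ => (k : ℝ)) (poissonMeasure m) := by
  rw [integrable_poissonMeasure_iff]
  simpa only [Real.norm_natCast] using (hasSum_poisson_mean m).summable

lemma integral_poisson_id (m : ℝ≥0) : ∫ k : ℕ, (k : ℝ) ∂(poissonMeasure m) = m := by
  rw [integral_poissonMeasure]
  simpa only [smul_eq_mul] using (hasSum_poisson_mean m).tsum_eq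

/-- The number of points in `A`, as a real number. -/
def count {Ω X : Type*} (N : Ω → Set X) (A : Set X) (ω : Ω) : ℝ := ((countIn N A ω).toNat : ℝ)

lemma count_nonneg {Ω X : Type*} (N : Ω → Set X) (A : Set X) (ω : Ω) : 0 ≤ count N A ω :=
  Nat.cast_nonneg _

/-! ### Counts of a Poisson process -/

namespace IsPoissonProcess

variable {Ω X : Type*} [MeasurableSpace Ω] [MeasurableSpace X] {N : Ω → Set X} {μ : Measure X}
  {P : Measure Ω}

lemma measurable_realCount (h : IsPoissonProcess N μ P) {A : Set X} (hA : MeasurableSet A) :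
    Measurable (count N A) :=
  (Measurable.of_discrete (f := fun k : ℕ∞ => ((k.toNat : ℕ) : ℝ))).comp (h.measurable_count A hA)

lemma map_countIn (h : IsPoissonProcess N μ P) {A : Set X} (hA : MeasurableSet A)
    (hfin : μ A ≠ ∞) :
    P.map (countIn N A) = (poissonMeasure (μ A).toNNReal).map (fun k : ℕ => (k : ℕ∞)) := by
  rw [h.law_count A hA, poissonLaw, if_neg hfin]

lemma map_count (h : IsPoissonProcess N μ P) {A : Set X} (hA : MeasurableSet A)
    (hfin : μ A ≠ ∞) :
    P.map (count N A) = (poissonMeasure (μ A).toNNReal).map (fun k : ℕ => (k : ℝ)) := by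
  have : count N A = (fun k : ℕ∞ => ((k.toNat : ℕ) : ℝ)) ∘ countIn N A := rfl
  rw [this, ← Measure.map_map .of_discrete (h.measurable_count A hA), h.map_countIn hA hfin,
    Measure.map_map .of_discrete .of_discrete]
  rfl

lemma integrable_exp_count (h : IsPoissonProcess N μ P) {A : Set X} (hA : MeasurableSet A)
    (hfin : μ A ≠ ∞) (s : ℝ) : Integrable (fun ω => Real.exp (s * count N A ω)) P := by
  have h1 : Integrable (fun y : ℝ => Real.exp (s * y)) (P.map (count N A)) := by
    rw [h.map_count hA hfin, integrable_map_measure (by fun_prop) .of_discrete]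
    exact integrable_poisson_exp _ _
  exact (integrable_map_measure (by fun_prop) (h.measurable_realCount hA).aemeasurable).1 h1

lemma integral_exp_count (h : IsPoissonProcess N μ P) {A : Set X} (hA : MeasurableSet A)
    (hfin : μ A ≠ ∞) (s : ℝ) :
    ∫ ω, Real.exp (s * count N A ω) ∂P = Real.exp (μ.real A * (Real.exp s - 1)) := by
  rw [← integral_map (f := fun y : ℝ => Real.exp (s * y)) (h.measurable_realCount hA).aemeasurable
    (by fun_prop), h.map_count hA hfin, integral_map .of_discrete (by fun_prop),
    integral_poisson_exp]
  rfl

lemma integrable_count (h : IsPoissonProcess N μ P) {A : Set X} (hA : MeasurableSet A)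
    (hfin : μ A ≠ ∞) : Integrable (count N A) P := by
  have h1 : Integrable (fun y : ℝ => y) (P.map (count N A)) := by
    rw [h.map_count hA hfin, integrable_map_measure (by fun_prop) .of_discrete]
    exact integrable_poisson_id _
  exact (integrable_map_measure (by fun_prop) (h.measurable_realCount hA).aemeasurable).1 h1

lemma integral_count (h : IsPoissonProcess N μ P) {A : Set X} (hA : MeasurableSet A)
    (hfin : μ A ≠ ∞) : ∫ ω, count N A ω ∂P = μ.real A := by
  rw [← integral_map (f := fun y : ℝ => y) (h.measurable_realCount hA).aemeasurable
    (by fun_prop), h.map_count hA hfin, integral_map .of_discrete (by fun_prop),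
    integral_poisson_id]
  rfl

lemma ae_countIn_ne_top (h : IsPoissonProcess N μ P) {A : Set X} (hA : MeasurableSet A)
    (hfin : μ A ≠ ∞) : ∀ᵐ ω ∂P, countIn N A ω ≠ ⊤ := by
  have h1 : ∀ᵐ k ∂(P.map (countIn N A)), k ≠ ⊤ := by
    rw [h.map_countIn hA hfin, ae_map_iff .of_discrete (by measurability)]
    exact ae_of_all _ fun k => ENat.natCast_ne_top k
  exact ae_of_ae_map (h.measurable_count A hA).aemeasurable h1

lemma ae_finite [IsFiniteMeasure μ] (h : IsPoissonProcess N μ P) : ∀ᵐ ω ∂P, (N ω).Finite := by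
  filter_upwards [h.ae_countIn_ne_top MeasurableSet.univ (measure_ne_top _ _)] with ω hω
  simpa [countIn] using hω

/-- Turns almost-everywhere bounds on an integrand into bounds at every observed point, almost
surely. -/
lemma ae_inter_eq_empty (h : IsPoissonProcess N μ P) {A : Set X} (hA : MeasurableSet A)
    (h0 : μ A = 0) : ∀ᵐ ω ∂P, ∀ x ∈ N ω, x ∉ A := by
  have h1 : ∀ᵐ k ∂(P.map (countIn N A)), k = 0 := by
    rw [h.map_countIn hA (by simp [h0]), ae_map_iff .of_discrete (by measurability), ae_iff]
    simp only [h0, ENNReal.toNNReal_zero, Nat.cast_eq_zero]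
    rw [← Measure.restrict_apply_univ, Measure.restrict_apply_univ, poissonMeasure,
      Measure.sum_apply _ .of_discrete, ENNReal.tsum_eq_zero]
    intro i
    rcases Nat.eq_zero_or_pos i with rfl | hi
    · simp
    · simp [hi.ne']
  filter_upwards [ae_of_ae_map (h.measurable_count A hA).aemeasurable h1] with ω hω x hx hxA
  rw [countIn, Set.encard_eq_zero] at hω
  exact (Set.eq_empty_iff_forall_notMem.1 hω x) ⟨hx, hxA⟩

lemma indepFun_count (h : IsPoissonProcess N μ P) {ι : Type*} [Finite ι] (A : ι → Set X)
    (hA : ∀ i, MeasurableSet (A i)) (hd : Pairwise (fun i j => Disjoint (A i) (A j))) :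
    iIndepFun (fun i => count N (A i)) P := by
  obtain ⟨m, ⟨e⟩⟩ := Finite.exists_equiv_fin ι
  have h1 := h.indep_count m (fun i => A (e.symm i)) (fun i => hA _)
    (fun i j hij => hd (fun hh => hij (e.symm.injective hh)))
  have h2 := h1.comp (fun _ => fun k : ℕ∞ => ((k.toNat : ℕ) : ℝ)) (fun _ => .of_discrete)
  have h3 := h2.precomp e.injective
  convert! h3 using 1
  ext i ω
  simp [count]

end IsPoissonProcess

/-! ### Integrals of simple functions against the process -/

lemma pointIntegral_eq_sum {S : Set ℝ} (hS : S.Finite) (g : SimpleFunc ℝ ℝ) :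
    pointIntegral S g = ∑ y ∈ g.range, y * ((S ∩ g ⁻¹' {y}).encard.toNat : ℝ) := by
  classical
  have h1 : pointIntegral S g = ∑ x ∈ hS.toFinset, g x := by
    rw [← Finset.tsum_subtype hS.toFinset]
    have : S = {x | x ∈ hS.toFinset} := by ext; simp
    conv_lhs => rw [this]
    rfl
  rw [h1, ← Finset.sum_fiberwise_of_maps_to (t := g.range) (g := g) (fun x _ => g.mem_range_self x)]
  refine Finset.sum_congr rfl fun y _ => ?_
  rw [Finset.sum_congr rfl (g := fun _ => y) (fun x hx => (Finset.mem_filter.1 hx).2),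
    Finset.sum_const, nsmul_eq_mul, mul_comm]
  congr 2
  have : S ∩ g ⁻¹' {y} = ((hS.toFinset.filter (fun x => g x = y) : Finset ℝ) : Set ℝ) := by
    ext x; simp
  rw [this, Set.encard_coe_eq_coe_finsetCard, ENat.toNat_natCast]

/-- A measurable version of the integral of a simple function against the process. -/
def simpleIntegral {Ω : Type*} (N : Ω → Set ℝ) (g : SimpleFunc ℝ ℝ) (ω : Ω) : ℝ :=
  ∑ y ∈ g.range, y * count N (g ⁻¹' {y}) ω

lemma simpleIntegral_eq {Ω : Type*} {N : Ω → Set ℝ} {ω : Ω} (hω : (N ω).Finite) (g : SimpleFunc ℝ ℝ) :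
    simpleIntegral N g ω = pointIntegral (N ω) g := (pointIntegral_eq_sum hω g).symm

section Integrals

variable {Ω : Type*} [MeasurableSpace Ω] {N : Ω → Set ℝ} {μ : Measure ℝ} {P : Measure Ω}

lemma measurable_simpleIntegral (h : IsPoissonProcess N μ P) (g : SimpleFunc ℝ ℝ) :
    Measurable (simpleIntegral N g) :=
  Finset.measurable_sum _ fun y _ =>
    (h.measurable_realCount (g.measurableSet_fiber y)).const_mul _

variable [IsFiniteMeasure μ] [IsProbabilityMeasure P]

/-- Campbell's formula. The level sets of `g` are disjoint, so their counts are independent Poisson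
variables, the Laplace transform factorises, and the exponents add up to an integral. -/
lemma exp_simpleIntegral (h : IsPoissonProcess N μ P) (g : SimpleFunc ℝ ℝ) (t : ℝ) :
    Integrable (fun ω => Real.exp (t * simpleIntegral N g ω)) P ∧
    mgf (simpleIntegral N g) P t = Real.exp (∫ x, (Real.exp (t * g x) - 1) ∂μ) := by
  classical
  let A : g.range → Set ℝ := fun y => g ⁻¹' {(y : ℝ)}
  have hA : ∀ y, MeasurableSet (A y) := fun y => g.measurableSet_fiber y
  have hd : Pairwise (fun i j => Disjoint (A i) (A j)) := by
    intro i j hij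
    rw [Set.disjoint_left]
    intro x hx hx'
    exact hij (Subtype.ext (hx.symm.trans hx'))
  have hind := (h.indepFun_count A hA hd).comp (fun y => fun z : ℝ => (y : ℝ) * z)
    (fun y => by fun_prop)
  have hmeas : ∀ y : g.range, Measurable ((fun z : ℝ => (y : ℝ) * z) ∘ count N (A y)) :=
    fun y => (h.measurable_realCount (hA y)).const_mul _
  have hint : ∀ y ∈ (Finset.univ : Finset g.range),
      Integrable (fun ω => Real.exp (t * ((fun z : ℝ => (y : ℝ) * z) ∘ count N (A y)) ω)) P := by
    intro y _
    have := h.integrable_exp_count (hA y) (measure_ne_top _ _) (t * y)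
    simpa only [Function.comp, mul_assoc] using this
  have hX : simpleIntegral N g
      = ∑ y ∈ (Finset.univ : Finset g.range), (fun z : ℝ => (y : ℝ) * z) ∘ count N (A y) := by
    ext ω
    simp only [simpleIntegral, Finset.sum_apply, Function.comp]
    exact (Finset.sum_coe_sort g.range (fun y => y * count N (g ⁻¹' {y}) ω)).symm
  refine ⟨?_, ?_⟩
  · rw [hX]; exact hind.integrable_exp_mul_sum hmeas hint
  · rw [hX, hind.mgf_sum hmeas]
    have h2 : ∀ y : g.range, mgf ((fun z : ℝ => (y : ℝ) * z) ∘ count N (A y)) P t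
        = Real.exp (μ.real (A y) * (Real.exp (t * y) - 1)) := by
      intro y
      rw [mgf, ← h.integral_exp_count (hA y) (measure_ne_top _ _) (t * y)]
      simp only [Function.comp, mul_assoc]
    simp_rw [h2]
    rw [← Real.exp_sum]
    congr 1
    have h3 : ∫ x, (Real.exp (t * g x) - 1) ∂μ
        = (SimpleFunc.map (fun y => Real.exp (t * y) - 1) g).integral μ := by
      rw [SimpleFunc.integral_eq_integral _ (SimpleFunc.integrable_of_isFiniteMeasure _)]
      rfl
    rw [h3, SimpleFunc.map_integral _ _ (SimpleFunc.integrable_of_isFiniteMeasure _) (by simp)]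
    simp only [smul_eq_mul]
    exact Finset.sum_coe_sort g.range (fun y => μ.real (g ⁻¹' {y}) * (Real.exp (t * y) - 1))

lemma integral_exp_centered (h : IsPoissonProcess N μ P) (g : SimpleFunc ℝ ℝ) (t : ℝ) :
    ∫ ω, Real.exp (t * (simpleIntegral N g ω - ∫ x, g x ∂μ)) ∂P
      = Real.exp (∫ x, (Real.exp (t * g x) - 1 - t * g x) ∂μ) := by
  have h1 : ∀ ω, Real.exp (t * (simpleIntegral N g ω - ∫ x, g x ∂μ))
      = Real.exp (t * simpleIntegral N g ω) * Real.exp (-(t * ∫ x, g x ∂μ)) := by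
    intro ω; rw [← Real.exp_add]; ring_nf
  simp_rw [h1]
  rw [integral_mul_const, integral_sub, integral_const_mul, sub_eq_add_neg, Real.exp_add]
  · congr 1
    exact (exp_simpleIntegral h g t).2
  · exact SimpleFunc.integrable_of_isFiniteMeasure
      (SimpleFunc.map (fun y => Real.exp (t * y) - 1) g)
  · exact (SimpleFunc.integrable_of_isFiniteMeasure g).const_mul t

lemma integrable_exp_centered (h : IsPoissonProcess N μ P) (g : SimpleFunc ℝ ℝ) (t : ℝ) :
    Integrable (fun ω => Real.exp (t * (simpleIntegral N g ω - ∫ x, g x ∂μ))) P := by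
  have h1 : ∀ ω, Real.exp (t * (simpleIntegral N g ω - ∫ x, g x ∂μ))
      = Real.exp (t * simpleIntegral N g ω) * Real.exp (-(t * ∫ x, g x ∂μ)) := by
    intro ω; rw [← Real.exp_add]; ring_nf
  simp_rw [h1]
  exact (exp_simpleIntegral h g t).1.mul_const _

end Integrals

/-! ## Bernstein's inequality for Poisson integrals -/

lemma two_mul_three_pow_le_factorial (k : ℕ) : 2 * 3 ^ k ≤ (k + 2).factorial := by
  induction k with
  | zero => simp
  | succ k ih =>
    rw [show k + 1 + 2 = (k + 2) + 1 from rfl, Nat.factorial_succ, pow_succ]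
    nlinarith [Nat.factorial_pos (k + 2)]

/-- The exponential series is compared termwise with a geometric series of ratio `b / 3`, by `2 * 3
^ k ≤ (k + 2)!`. This is the source of the `1 / 3` in Bernstein's inequality. -/
lemma exp_sub_one_sub_le {x b : ℝ} (hx : |x| ≤ b) (hb : b < 3) :
    Real.exp x - 1 - x ≤ x ^ 2 / (2 * (1 - b / 3)) := by
  have h1 : HasSum (fun k : ℕ => x ^ (k + 2) / ((k + 2).factorial : ℝ)) (Real.exp x - 1 - x) := by
    have h := NormedSpace.expSeries_div_hasSum_exp x
    rw [← Real.exp_eq_exp_ℝ, ← hasSum_nat_add_iff' 2] at h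
    convert! h using 1
    simp [Finset.sum_range_succ]
    ring
  have hb0 : 0 ≤ b := (abs_nonneg x).trans hx
  have h2 : HasSum (fun k : ℕ => x ^ 2 / 2 * (b / 3) ^ k) (x ^ 2 / 2 * (1 - b / 3)⁻¹) :=
    (hasSum_geometric_of_lt_one (by positivity) (by linarith)).mul_left _
  have h3 := hasSum_le (fun k => ?_) h1 h2
  · refine h3.trans (le_of_eq ?_)
    have : 1 - b / 3 ≠ 0 := by linarith
    field_simp
  · have hk : (2 * 3 ^ k : ℝ) ≤ ((k + 2).factorial : ℝ) := by
      exact_mod_cast two_mul_three_pow_le_factorial k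
    calc x ^ (k + 2) / ((k + 2).factorial : ℝ)
        ≤ |x| ^ (k + 2) / ((k + 2).factorial : ℝ) := by
          rw [← abs_pow]
          exact div_le_div_of_nonneg_right (le_abs_self _) (by positivity)
      _ ≤ |x| ^ (k + 2) / (2 * 3 ^ k) := by gcongr
      _ = x ^ 2 / 2 * (|x| / 3) ^ k := by
          rw [pow_add, sq_abs, div_pow]
          field_simp
      _ ≤ x ^ 2 / 2 * (b / 3) ^ k := by gcongr

section Bernstein

variable {Ω : Type*} [MeasurableSpace Ω] {N : Ω → Set ℝ} {μ : Measure ℝ} {P : Measure Ω}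
  [IsFiniteMeasure μ]

lemma integrable_simple_comp (g : SimpleFunc ℝ ℝ) (φ : ℝ → ℝ) :
    Integrable (fun x => φ (g x)) μ :=
  SimpleFunc.integrable_of_isFiniteMeasure (g.map φ)

lemma cumulant_le (g : SimpleFunc ℝ ℝ) {M s : ℝ} (hg : ∀ᵐ x ∂μ, |g x| ≤ M)
    (hs : |s| * M < 3) :
    ∫ x, (Real.exp (s * g x) - 1 - s * g x) ∂μ
      ≤ s ^ 2 * (∫ x, g x ^ 2 ∂μ) / (2 * (1 - |s| * M / 3)) := by
  have h1 : Integrable (fun x => Real.exp (s * g x) - 1 - s * g x) μ :=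
    integrable_simple_comp g (fun y => Real.exp (s * y) - 1 - s * y)
  have h2 : Integrable (fun x => (s * g x) ^ 2 / (2 * (1 - |s| * M / 3))) μ :=
    integrable_simple_comp g (fun y => (s * y) ^ 2 / (2 * (1 - |s| * M / 3)))
  refine (integral_mono_ae h1 h2 ?_).trans (le_of_eq ?_)
  · filter_upwards [hg] with x hx
    refine exp_sub_one_sub_le ?_ hs
    rw [abs_mul]
    gcongr
  · rw [integral_div]
    simp_rw [mul_pow]
    rw [integral_const_mul]

variable [IsProbabilityMeasure P]

/-- Chernoff's method with `cumulant_le`. The sign `σ` covers both tails, and `v` need only dominate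
the variance, so it can be kept positive. -/
lemma bernstein (h : IsPoissonProcess N μ P) (g : SimpleFunc ℝ ℝ) {M v u σ : ℝ} (hM : 0 < M)
    (hg : ∀ᵐ x ∂μ, |g x| ≤ M) (hv : ∫ x, g x ^ 2 ∂μ ≤ v) (hv0 : 0 < v) (hu : 0 < u)
    (hσ : |σ| = 1) :
    P.real {ω | √(2 * u * v) + M * u / 3 ≤ σ * (simpleIntegral N g ω - ∫ x, g x ∂μ)}
      ≤ Real.exp (-u) := by
  set w : ℝ := √(2 * u * v) / v with hw
  have hw0 : 0 < w := by positivity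
  have hvw : √(2 * u * v) = v * w := by rw [hw]; field_simp
  have hw2 : v * w ^ 2 = 2 * u := by
    have : (v * w) ^ 2 = 2 * u * v := by rw [← hvw, Real.sq_sqrt (by positivity)]
    have h3 : v * (v * w ^ 2) = v * (2 * u) := by linarith [this, mul_pow v w 2]
    exact mul_left_cancel₀ hv0.ne' h3
  have hd : 0 < 1 + w * M / 3 := by positivity
  -- With this `t` the factor `1 - t * M / 3` inverts `1 + w * M / 3`. The cumulant bound becomes `t
  -- * v * w / 2`, and since `v * w ^ 2 = 2 * u` the final exponent is exactly `-u`.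
  set t : ℝ := w / (1 + w * M / 3) with ht
  have ht0 : 0 < t := by positivity
  have htw : t * (1 + w * M / 3) = w := by rw [ht]; field_simp
  have ht1 : 1 - t * M / 3 = (1 + w * M / 3)⁻¹ := by
    rw [ht]; field_simp; ring
  have ht3 : 0 < 1 - t * M / 3 := by rw [ht1]; positivity
  have habs : |t * σ| = t := by rw [abs_mul, hσ, mul_one, abs_of_pos ht0]
  have hint : Integrable
      (fun ω => Real.exp (t * (σ * (simpleIntegral N g ω - ∫ x, g x ∂μ)))) P := by
    simpa only [mul_assoc] using integrable_exp_centered h g (t * σ)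
  refine (measure_ge_le_exp_mul_mgf _ ht0.le hint).trans ?_
  have hmgf : mgf (fun ω => σ * (simpleIntegral N g ω - ∫ x, g x ∂μ)) P t
      ≤ Real.exp (t * v * w / 2) := by
    have := integral_exp_centered h g (t * σ)
    simp only [mul_assoc] at this
    rw [mgf, this]
    refine Real.exp_le_exp.2 ?_
    have h5 := cumulant_le g (s := t * σ) hg (by rw [habs]; linarith)
    simp only [mul_assoc] at h5
    refine h5.trans ?_
    have hσ2 : (t * σ) ^ 2 = t ^ 2 := by rw [← sq_abs, habs]
    rw [habs, hσ2, ht1, div_le_iff₀ (by positivity)]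
    calc t ^ 2 * ∫ x, g x ^ 2 ∂μ ≤ t ^ 2 * v := by gcongr
      _ = t * v * (t * (1 + w * M / 3)) / 2 * (2 * (1 + w * M / 3)⁻¹) := by field_simp
      _ = _ := by rw [htw]
  refine (mul_le_mul_of_nonneg_left hmgf (Real.exp_pos _).le).trans ?_
  rw [← Real.exp_add]
  refine Real.exp_le_exp.2 ?_
  rw [hvw]
  nlinarith [hw2, htw]

/-- The deviation bound with estimated variance, for exponent `u`, sup norm `M` and empirical
quadratic integral `W`. -/
def devBound (u M W : ℝ) : ℝ :=
  √(2 * u * (W + √(2 * u * M ^ 2 * W) + 3 * u * M ^ 2)) + u * M / 3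

lemma le_overestimate {v W a : ℝ} (hv : 3 * a < v) (ha : 0 < a) (hW : 0 ≤ W)
    (h : v - W < √(2 * a * v) + a / 3) : v ≤ W + √(2 * a * W) + 3 * a := by
  rw [Real.sqrt_mul (by positivity)] at h ⊢
  set r := √(2 * a)
  set s := √v
  set q := √W
  have hr : r ^ 2 = 2 * a := Real.sq_sqrt (by positivity)
  have hs : s ^ 2 = v := Real.sq_sqrt (by linarith)
  have hq : q ^ 2 = W := Real.sq_sqrt hW
  have hr0 : 0 ≤ r := Real.sqrt_nonneg _
  have hq0 : 0 ≤ q := Real.sqrt_nonneg _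
  -- Completing the square leaves `1/4 + 1/6 = 5/12`, and `13/20` is a rational just above
  -- `√(5/12)`. The coefficient of `a` obtained below stays under `3`.
  have he : s - r / 2 ≤ q + 13 / 20 * r := by
    refine abs_le_of_sq_le_sq' ?_ (by positivity) |>.2
    nlinarith [mul_nonneg hr0 hq0]
  nlinarith [mul_le_mul_of_nonneg_left he hr0]

/-- The square of a simple function. -/
def sqFunc (g : SimpleFunc ℝ ℝ) : SimpleFunc ℝ ℝ := g.map (fun y => y ^ 2)

lemma simpleIntegral_sqFunc_nonneg {Ω : Type*} (N : Ω → Set ℝ) (g : SimpleFunc ℝ ℝ) (ω : Ω) :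
    0 ≤ simpleIntegral N (sqFunc g) ω := by
  refine Finset.sum_nonneg fun y hy => mul_nonneg ?_ (count_nonneg _ _ _)
  obtain ⟨x, rfl⟩ := SimpleFunc.mem_range.1 hy
  exact sq_nonneg (g x)

/-- Three applications of Bernstein: both tails of the integral of `g`, and the lower tail of that
of `g²`, which is bounded by `M ^ 2` with quadratic integral at most `M ^ 2 * v`. Off these events
the overestimate inside `devBound` dominates the true variance. -/
lemma deviation (h : IsPoissonProcess N μ P) (g : SimpleFunc ℝ ℝ) {M u : ℝ} (hM : 0 < M)
    (hg : ∀ᵐ x ∂μ, |g x| ≤ M) (hu : 0 < u) :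
    P.real {ω | devBound u M (simpleIntegral N (sqFunc g) ω)
      < |simpleIntegral N g ω - ∫ x, g x ∂μ|} ≤ 3 * Real.exp (-u) := by
  set v := ∫ x, g x ^ 2 ∂μ with hv
  -- The floor keeps the variance proxy positive. It is also the last summand of the overestimate,
  -- so a smaller `v` needs no third event.
  set v' := max v (3 * u * M ^ 2) with hv'
  have hv'0 : 0 < v' := lt_max_of_lt_right (by positivity)
  have h1 := bernstein h g (σ := 1) hM hg (le_max_left _ _ : v ≤ v') hv'0 hu (by simp)
  have h2 := bernstein h g (σ := -1) hM hg (le_max_left _ _ : v ≤ v') hv'0 hu (by simp)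
  have h3 : P.real {ω | 3 * u * M ^ 2 < v ∧
      √(2 * (u * M ^ 2) * v) + u * M ^ 2 / 3 ≤ v - simpleIntegral N (sqFunc g) ω}
      ≤ Real.exp (-u) := by
    by_cases hc : 3 * u * M ^ 2 < v
    · have hg4 : ∫ x, sqFunc g x ^ 2 ∂μ ≤ M ^ 2 * v := by
        rw [hv, ← integral_const_mul]
        refine integral_mono_ae
          (integrable_simple_comp (sqFunc g) (fun y => y ^ 2))
          ((integrable_simple_comp g (fun y => y ^ 2)).const_mul _) ?_
        filter_upwards [hg] with x hx
        have : g x ^ 2 ≤ M ^ 2 := by rw [← sq_abs]; gcongr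
        have h0 := sq_nonneg (g x)
        change (g x ^ 2) ^ 2 ≤ M ^ 2 * g x ^ 2
        nlinarith
      have hgM : ∀ᵐ x ∂μ, |sqFunc g x| ≤ M ^ 2 := by
        filter_upwards [hg] with x hx
        change |g x ^ 2| ≤ M ^ 2
        rw [abs_pow]; gcongr
      have h4 := bernstein h (sqFunc g) (σ := -1) (by positivity) hgM hg4
        (mul_pos (by positivity) (lt_of_le_of_lt (by positivity) hc)) hu (by simp)
      refine (measureReal_mono ?_ (measure_ne_top _ _)).trans h4
      rintro ω ⟨-, hω⟩
      have e1 : ∫ x, sqFunc g x ∂μ = v := rfl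
      simp only [Set.mem_ofPred_eq, e1]
      rw [show 2 * u * (M ^ 2 * v) = 2 * (u * M ^ 2) * v by ring]
      linarith
    · simp [hc, Real.exp_nonneg]
  refine (measureReal_mono (s₂ := _ ∪ (_ ∪ _)) ?_ (measure_ne_top _ _)).trans
    ((measureReal_union_le _ _).trans ((add_le_add h1 ((measureReal_union_le _ _).trans
      (add_le_add h2 h3))).trans (le_of_eq (by ring))))
  intro ω hω
  by_contra hcon
  simp only [Set.mem_union, Set.mem_ofPred_eq, not_or, not_le, not_and, one_mul] at hcon hω
  obtain ⟨c1, c2, c3⟩ := hcon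
  set W := simpleIntegral N (sqFunc g) ω with hW
  have hW0 : 0 ≤ W := simpleIntegral_sqFunc_nonneg N g ω
  have hvW : v' ≤ W + √(2 * u * M ^ 2 * W) + 3 * u * M ^ 2 := by
    refine max_le ?_ (by nlinarith [Real.sqrt_nonneg (2 * u * M ^ 2 * W)])
    by_cases hc : 3 * u * M ^ 2 < v
    · have := le_overestimate (a := u * M ^ 2) (by linarith) (by positivity) hW0 (c3 hc)
      rwa [← mul_assoc, ← mul_assoc] at this
    · nlinarith [Real.sqrt_nonneg (2 * u * M ^ 2 * W)]
  have : √(2 * u * v') ≤ √(2 * u * (W + √(2 * u * M ^ 2 * W) + 3 * u * M ^ 2)) := by gcongr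
  have h6 : |simpleIntegral N g ω - ∫ x, g x ∂μ| < √(2 * u * v') + M * u / 3 :=
    abs_lt.2 ⟨by linarith, c1⟩
  rw [devBound] at hω
  linarith

end Bernstein

/-- The square-root term shrinks at least like `√u` and the linear term like `u`. With `κ ^ 2 = c /
γ` this is the margin gained by taking `γ > c`. -/
lemma devBound_mono_scale {u U M W κ : ℝ} (hκ0 : 0 ≤ κ) (hκ1 : κ ≤ 1) (hu : u = κ ^ 2 * U)
    (hU : 0 ≤ U) (hM : 0 ≤ M) (hW : 0 ≤ W) : devBound u M W ≤ κ * devBound U M W := by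
  have hκ2 : κ ^ 2 ≤ κ := by nlinarith
  have huU : u ≤ U := by rw [hu]; nlinarith
  have hu0 : 0 ≤ u := by rw [hu]; positivity
  unfold devBound
  have h1 : √(2 * u * (W + √(2 * u * M ^ 2 * W) + 3 * u * M ^ 2))
      ≤ κ * √(2 * U * (W + √(2 * U * M ^ 2 * W) + 3 * U * M ^ 2)) := by
    calc _ ≤ √(2 * u * (W + √(2 * U * M ^ 2 * W) + 3 * U * M ^ 2)) := by gcongr
      _ = _ := by
        rw [hu, show 2 * (κ ^ 2 * U) * (W + √(2 * U * M ^ 2 * W) + 3 * U * M ^ 2)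
          = κ ^ 2 * (2 * U * (W + √(2 * U * M ^ 2 * W) + 3 * U * M ^ 2)) by ring,
          Real.sqrt_mul (by positivity), Real.sqrt_sq hκ0]
  have h2 : u * M ≤ κ * (U * M) := by
    rw [hu, ← mul_assoc]
    gcongr
  linarith

/-! ## The risk of a single thresholded coefficient -/

open Classical in
/-- Hard thresholding of `X` at level `T`. -/
def hardThreshold (T X : ℝ) : ℝ := if T ≤ |X| then X else 0

lemma hardThreshold_error_le (T X x : ℝ) :
    (hardThreshold T X - x) ^ 2 ≤ x ^ 2 + (X - x) ^ 2 := by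
  unfold hardThreshold
  split_ifs
  · nlinarith [sq_nonneg x]
  · nlinarith [sq_nonneg (X - x)]

/-- If `X` is kept, then `(1 - κ) * T ≤ |x|` and the error is at most `T`; if it is killed, the
error is `|x| ≤ 2 * T`. Either way it is controlled by both `|x|` and `T`. -/
lemma hardThreshold_error_le_of_close {T X x κ : ℝ} (hT : 0 ≤ T) (hκ0 : 0 ≤ κ) (hκ1 : κ < 1)
    (h : |X - x| ≤ κ * T) :
    (hardThreshold T X - x) ^ 2 ≤ 4 / (1 - κ) ^ 2 * x ^ 2 ∧
    (hardThreshold T X - x) ^ 2 ≤ 4 / (1 - κ) ^ 2 * T ^ 2 := by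
  have hk : 0 < 1 - κ := by linarith
  have h4 : 4 ≤ 4 / (1 - κ) ^ 2 := by
    rw [le_div_iff₀ (by positivity)]
    nlinarith
  have hX := abs_sub_abs_le_abs_sub X x
  have hX' := abs_sub_abs_le_abs_sub x X
  rw [abs_sub_comm x X] at hX'
  unfold hardThreshold
  split_ifs with hc
  · have h1 : (1 - κ) * T ≤ |x| := by linarith
    have h2 : (X - x) ^ 2 ≤ T ^ 2 := by
      rw [← sq_abs]
      exact pow_le_pow_left₀ (abs_nonneg _) (h.trans (by nlinarith)) 2
    have h3 : ((1 - κ) * T) ^ 2 ≤ x ^ 2 := by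
      rw [← sq_abs x]
      exact pow_le_pow_left₀ (by positivity) h1 2
    refine ⟨?_, by nlinarith [sq_nonneg T]⟩
    rw [div_mul_eq_mul_div, le_div_iff₀ (by positivity)]
    nlinarith [sq_nonneg x, mul_le_mul_of_nonneg_right h2 (sq_nonneg (1 - κ))]
  · have h1 : |x| ≤ 2 * T := by nlinarith
    have h3 : x ^ 2 ≤ 4 * T ^ 2 := by
      rw [← sq_abs x]
      nlinarith [abs_nonneg x]
    rw [zero_sub, neg_sq]
    exact ⟨by nlinarith [sq_nonneg x], by nlinarith [sq_nonneg T]⟩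

lemma devBound_nonneg {U M W : ℝ} (hU : 0 ≤ U) (hM : 0 ≤ M) : 0 ≤ devBound U M W := by
  unfold devBound; positivity

lemma devBound_sq_le {U M W : ℝ} (hU : 0 ≤ U) (hW : 0 ≤ W) :
    devBound U M W ^ 2 ≤ 6 * U * W + 17 * U ^ 2 * M ^ 2 := by
  have h1 : √(2 * U * M ^ 2 * W) ≤ U * M ^ 2 + W / 2 := by
    refine Real.sqrt_le_iff.2 ⟨by positivity, ?_⟩
    nlinarith [sq_nonneg (U * M ^ 2 - W / 2)]
  have h2 := Real.sq_sqrt (show 0 ≤ 2 * U * (W + √(2 * U * M ^ 2 * W) + 3 * U * M ^ 2) by positivity)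
  unfold devBound
  set s := √(2 * U * (W + √(2 * U * M ^ 2 * W) + 3 * U * M ^ 2))
  have h3 : s ^ 2 ≤ 2 * U * (W + (U * M ^ 2 + W / 2) + 3 * U * M ^ 2) := by
    rw [h2]; gcongr
  have h4 : 0 ≤ (U * M) ^ 2 := by positivity
  nlinarith [sq_nonneg (s - U * M / 3)]

/-- The deterministic term `3 * U * M ^ 2` alone gives `√6 * U * M`. Hence fewer than `2 * U`
points, each contributing at most `M`, cannot pass the threshold. -/
lemma two_mul_le_devBound {U M W : ℝ} (hU : 0 ≤ U) (hM : 0 ≤ M) (hW : 0 ≤ W) :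
    2 * U * M ≤ devBound U M W := by
  have h1 : 2 * U * M ≤ √(2 * U * (W + √(2 * U * M ^ 2 * W) + 3 * U * M ^ 2)) := by
    refine Real.le_sqrt_of_sq_le ?_
    have h2 : 0 ≤ 2 * U * (W + √(2 * U * M ^ 2 * W)) := by positivity
    nlinarith [sq_nonneg (U * M)]
  unfold devBound
  have : 0 ≤ U * M / 3 := by positivity
  linarith

/-- Integrated over an event, this splits a second moment into `T ^ 2` times a probability and an
exponential moment damped by `exp (-k)`. -/
lemma sq_le_sq_add_mul_exp {Y T k : ℝ} (hY : 0 ≤ Y) (hT : 0 < T) (hk : 2 ≤ k) :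
    Y ^ 2 ≤ T ^ 2 + T ^ 2 * Real.exp (k / T * Y - k) := by
  rcases le_total Y T with h | h
  · have : Y ^ 2 ≤ T ^ 2 := by gcongr
    have h2 : 0 ≤ T ^ 2 * Real.exp (k / T * Y - k) := by positivity
    linarith
  · have h1 : 1 ≤ Y / T := by rwa [le_div_iff₀ hT, one_mul]
    have h2 : Y / T ≤ Real.exp (Y / T - 1) := by
      have := Real.add_one_le_exp (Y / T - 1); linarith
    have h3 : (Y / T) ^ 2 ≤ Real.exp (k / T * Y - k) := by
      calc (Y / T) ^ 2 ≤ Real.exp (Y / T - 1) ^ 2 := by gcongr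
        _ = Real.exp (2 * (Y / T - 1)) := by rw [← Real.exp_nat_mul]; norm_num
        _ ≤ Real.exp (k / T * Y - k) := by
          refine Real.exp_le_exp.2 ?_
          have : k / T * Y - k = k * (Y / T - 1) := by ring
          rw [this]
          exact mul_le_mul_of_nonneg_right hk (by linarith)
    have h4 : Y ^ 2 = T ^ 2 * (Y / T) ^ 2 := by field_simp
    rw [h4]
    nlinarith [sq_nonneg T]

lemma lintegral_ofReal_le_of_le {Ω : Type*} [MeasurableSpace Ω] {P : Measure Ω} {D B : Ω → ℝ}
    {b : ℝ} (hB : Integrable B P) (h0 : ∀ᵐ ω ∂P, 0 ≤ D ω) (hD : ∀ᵐ ω ∂P, D ω ≤ B ω)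
    (hb : ∫ ω, B ω ∂P ≤ b) :
    ∫⁻ ω, ENNReal.ofReal (D ω) ∂P ≤ ENNReal.ofReal b := by
  calc _ ≤ ∫⁻ ω, ENNReal.ofReal (B ω) ∂P :=
        lintegral_mono_ae (hD.mono fun ω h => ENNReal.ofReal_le_ofReal h)
    _ = ENNReal.ofReal (∫ ω, B ω ∂P) := by
        rw [ofReal_integral_eq_lintegral_ofReal hB]
        filter_upwards [h0, hD] with ω h1 h2 using h1.trans h2
    _ ≤ _ := ENNReal.ofReal_le_ofReal hb

lemma abs_pointIntegral_le {S : Set ℝ} (hS : S.Finite) (g : SimpleFunc ℝ ℝ) {M : ℝ} {I : Set ℝ}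
    (hI : ∀ x ∉ I, g x = 0) (hM : ∀ x ∈ S, |g x| ≤ M) :
    |pointIntegral S g| ≤ M * ((S ∩ I).encard.toNat : ℝ) := by
  classical
  have h1 : pointIntegral S g = ∑ x ∈ hS.toFinset, g x := by
    rw [← Finset.tsum_subtype hS.toFinset]
    have : S = {x | x ∈ hS.toFinset} := by ext; simp
    conv_lhs => rw [this]
    rfl
  have h2 : ∑ x ∈ hS.toFinset, g x = ∑ x ∈ hS.toFinset.filter (· ∈ I), g x := by
    refine (Finset.sum_filter_of_ne fun x _ hx => ?_).symm
    by_contra hxI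
    exact hx (hI x hxI)
  have h3 : (S ∩ I).encard.toNat = (hS.toFinset.filter (· ∈ I)).card := by
    have : S ∩ I = ((hS.toFinset.filter (· ∈ I) : Finset ℝ) : Set ℝ) := by ext x; simp
    rw [this, Set.encard_coe_eq_coe_finsetCard, ENat.toNat_natCast]
  rw [h1, h2, h3, mul_comm, ← nsmul_eq_mul]
  refine (Finset.abs_sum_le_sum_abs _ _).trans (Finset.sum_le_card_nsmul _ _ _ fun x hx => ?_)
  exact hM x (by simpa using (Finset.mem_filter.1 hx).1)

section Risk

variable {Ω : Type*} [MeasurableSpace Ω] {N : Ω → Set ℝ} {μ : Measure ℝ} {P : Measure Ω}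

/-- Needed because the sup norm of a wavelet is an essential supremum, whereas the process is
evaluated at points. -/
lemma ae_abs_le (h : IsPoissonProcess N μ P) (g : SimpleFunc ℝ ℝ) {M : ℝ}
    (hg : ∀ᵐ x ∂μ, |g x| ≤ M) : ∀ᵐ ω ∂P, ∀ x ∈ N ω, |g x| ≤ M := by
  have hA : MeasurableSet {x | ¬ |g x| ≤ M} := 
    (measurableSet_le (continuous_abs.measurable.comp g.measurable) measurable_const).compl
  filter_upwards [h.ae_inter_eq_empty hA (ae_iff.1 hg)] with ω hω x hx
  simpa using hω x hx

variable [IsFiniteMeasure μ]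

lemma ae_integral_bounds (h : IsPoissonProcess N μ P) (g : SimpleFunc ℝ ℝ) {M : ℝ} {I : Set ℝ}
    (hI : ∀ x ∉ I, g x = 0) (hg : ∀ᵐ x ∂μ, |g x| ≤ M) :
    ∀ᵐ ω ∂P, |simpleIntegral N g ω| ≤ M * count N I ω ∧
      simpleIntegral N (sqFunc g) ω ≤ M ^ 2 * count N I ω := by
  filter_upwards [h.ae_finite, ae_abs_le h g hg] with ω hfin hω
  rw [simpleIntegral_eq hfin, simpleIntegral_eq hfin]
  refine ⟨abs_pointIntegral_le hfin g hI hω, (le_abs_self _).trans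
    (abs_pointIntegral_le hfin (sqFunc g) (fun x hx => ?_) fun x hx => ?_)⟩
  · change g x ^ 2 = 0
    rw [hI x hx]; norm_num
  · change |g x ^ 2| ≤ M ^ 2
    rw [abs_pow]
    exact pow_le_pow_left₀ (abs_nonneg _) (hω x hx) 2

lemma integral_comp_le {g : SimpleFunc ℝ ℝ} {φ : ℝ → ℝ} {B : ℝ} {I : Set ℝ} (hIm : MeasurableSet I)
    (hI : ∀ x ∉ I, g x = 0) (hφ : φ 0 = 0) (hg : ∀ᵐ x ∂μ, φ (g x) ≤ B) :
    ∫ x, φ (g x) ∂μ ≤ B * μ.real I := by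
  have : B * μ.real I = ∫ x, I.indicator (fun _ => B) x ∂μ := by
    rw [integral_indicator_const _ hIm, smul_eq_mul, mul_comm]
  rw [this]
  refine integral_mono_ae (integrable_simple_comp g φ) ((integrable_const B).indicator hIm) ?_
  filter_upwards [hg] with x hx
  by_cases hxI : x ∈ I
  · simpa [hxI] using hx
  · simp [hxI, hI x hxI, hφ]

lemma abs_integral_le {g : SimpleFunc ℝ ℝ} {M : ℝ} {I : Set ℝ} (hIm : MeasurableSet I)
    (hI : ∀ x ∉ I, g x = 0) (hg : ∀ᵐ x ∂μ, |g x| ≤ M) :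
    |∫ x, g x ∂μ| ≤ M * μ.real I :=
  (abs_integral_le_integral_abs).trans (integral_comp_le (φ := fun y => |y|) hIm hI (by simp) hg)

variable [IsProbabilityMeasure P]

/-- For `|s| * M ≤ 1` the denominator `2 * (1 - |s| * M / 3)` of the cumulant bound is at least `4 /
3`, so it can be dropped. -/
lemma integral_exp_centered_le (h : IsPoissonProcess N μ P) (g : SimpleFunc ℝ ℝ) {M s : ℝ}
    {I : Set ℝ} (hIm : MeasurableSet I) (hI : ∀ x ∉ I, g x = 0) (hg : ∀ᵐ x ∂μ, |g x| ≤ M)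
    (hs : |s| * M ≤ 1) :
    ∫ ω, Real.exp (s * (simpleIntegral N g ω - ∫ x, g x ∂μ)) ∂P
      ≤ Real.exp (s ^ 2 * M ^ 2 * μ.real I) := by
  rw [integral_exp_centered h g s]
  refine Real.exp_le_exp.2 ((cumulant_le g hg (by linarith)).trans ?_)
  have h1 : ∫ x, g x ^ 2 ∂μ ≤ M ^ 2 * μ.real I := by
    refine integral_comp_le (φ := fun y => y ^ 2) hIm hI (by simp) ?_
    filter_upwards [hg] with x hx
    rw [← sq_abs]
    exact pow_le_pow_left₀ (abs_nonneg _) hx 2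
  have h2 : 0 ≤ ∫ x, g x ^ 2 ∂μ := integral_nonneg fun x => sq_nonneg _
  rw [div_le_iff₀ (by linarith)]
  have h3 : s ^ 2 * ∫ x, g x ^ 2 ∂μ ≤ s ^ 2 * M ^ 2 * μ.real I := by
    rw [mul_assoc]; gcongr
  have h4 : 0 ≤ s ^ 2 * ∫ x, g x ^ 2 ∂μ := by positivity
  nlinarith

/-- An integrable remainder dominating the error of hard thresholding on the event of a large
deviation. -/
lemma exists_remainder (h : IsPoissonProcess N μ P) (g : SimpleFunc ℝ ℝ) {M L c γ κ : ℝ}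
    {I : Set ℝ} (hIm : MeasurableSet I) (hI : ∀ x ∉ I, g x = 0) (hM : 0 < M)
    (hg : ∀ᵐ x ∂μ, |g x| ≤ M) (hL : 2 / 3 ≤ L) (hc : 1 ≤ c) (hγ : c < γ)
    (hκ0 : 0 ≤ κ) (hκ1 : κ < 1) (hκ : c = κ ^ 2 * γ)
    (hm : γ * L / 7 ≤ μ.real I) :
    ∃ R : Ω → ℝ, Integrable R P ∧
      ∫ ω, R ω ∂P ≤ 3 * (Real.exp (-(c * L)) * (∫ x, g x ∂μ) ^ 2)
          + 405 * γ ^ 2 * (Real.exp (-(c * L)) * (M ^ 2 * μ.real I * L)) ∧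
      ∀ ω, ∀ A Q : ℝ, 0 ≤ A →
        (|simpleIntegral N g ω - ∫ x, g x ∂μ|
            ≤ κ * devBound (γ * L) M (simpleIntegral N (sqFunc g) ω) →
          (hardThreshold (devBound (γ * L) M (simpleIntegral N (sqFunc g) ω))
            (simpleIntegral N g ω) - ∫ x, g x ∂μ) ^ 2 ≤ A * Q) → 0 ≤ Q →
        (hardThreshold (devBound (γ * L) M (simpleIntegral N (sqFunc g) ω))
          (simpleIntegral N g ω) - ∫ x, g x ∂μ) ^ 2 ≤ A * Q + R ω := by
  set x := ∫ x, g x ∂μ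
  set m := μ.real I with hmdef
  set X := simpleIntegral N g
  set W := simpleIntegral N (sqFunc g)
  have hγ1 : 1 < γ := by linarith
  have hm0 : 0 < m := lt_of_lt_of_le (by positivity) hm
  have hL0 : 0 < L := by linarith
  have hk1 : 0 < 1 - κ := by linarith
  have hX : Measurable X := measurable_simpleIntegral h g
  have hW : Measurable W := measurable_simpleIntegral h (sqFunc g)
  set B : Set Ω := {ω | devBound (c * L) M (W ω) < |X ω - x|} with hB
  have hBm : MeasurableSet B := by
    refine measurableSet_lt ?_ (by fun_prop)
    unfold devBound
    fun_prop
  have hPB : P.real B ≤ 3 * Real.exp (-(c * L)) := deviation h g hM hg (by positivity)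
  -- Truncation is at a multiple of the deviation scale `M * √(m * L)`. The slope `t` then satisfies
  -- `t ^ 2 * M ^ 2 * m = L / 9`, so the exponential moment costs only `exp (L / 9)` against the
  -- gain `exp (-(3 * γ * L))`.
  set T' := 9 * γ * M * √(m * L) with hT'
  have hT'0 : 0 < T' := by positivity
  have hT'2 : T' ^ 2 = 81 * γ ^ 2 * (M ^ 2 * m * L) := by
    rw [hT', mul_pow, Real.sq_sqrt (by positivity)]; ring
  set t := 3 * γ * L / T' with ht
  have ht0 : 0 < t := by positivity
  have ht2 : t ^ 2 * M ^ 2 * m = L / 9 := by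
    rw [ht, div_pow, hT'2]; field_simp; ring
  -- The large-mass assumption enters here, as `L ≤ 7 * m`.
  have htM : |t| * M ≤ 1 := by
    rw [abs_of_pos ht0]
    refine abs_le_of_sq_le_sq' ?_ zero_le_one |>.2
    have h1 : (t * M) ^ 2 * m = L / 9 := by rw [mul_pow, ht2]
    have h2 : L ≤ 7 * m := by nlinarith
    nlinarith
  have htM' : |-t| * M ≤ 1 := by rwa [abs_neg]
  have he1 := integral_exp_centered_le h g hIm hI hg htM
  have he2 := integral_exp_centered_le h g hIm hI hg htM'
  rw [← hmdef, neg_sq, ht2] at he2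
  rw [← hmdef, ht2] at he1
  have hi1 := integrable_exp_centered h g t
  have hi2 := integrable_exp_centered h g (-t)
  have hi12 : Integrable (fun ω => Real.exp (t * (X ω - x)) + Real.exp (-t * (X ω - x))) P :=
    hi1.add hi2
  have hiB : Integrable (B.indicator (fun _ => (1 : ℝ))) P := (integrable_const 1).indicator hBm
  set e1 : Ω → ℝ := fun ω => Real.exp (t * (X ω - x)) with he1d
  set e2 : Ω → ℝ := fun ω => Real.exp (-t * (X ω - x)) with he2d
  set E := Real.exp (-(3 * γ * L)) with hE
  have hE0 : 0 < E := Real.exp_pos _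
  -- The good-event bound is left as an arbitrary `A * Q`: it serves both with `Q = x ^ 2` and with
  -- a `Q` depending on the random count.
  have hpt : ∀ ω, ∀ A Q : ℝ, 0 ≤ A → (|X ω - x| ≤ κ * devBound (γ * L) M (W ω) →
      (hardThreshold (devBound (γ * L) M (W ω)) (X ω) - x) ^ 2 ≤ A * Q) → 0 ≤ Q →
      (hardThreshold (devBound (γ * L) M (W ω)) (X ω) - x) ^ 2 ≤ A * Q
        + ((x ^ 2 + T' ^ 2) * B.indicator (fun _ => (1 : ℝ)) ω + T' ^ 2 * E * (e1 ω + e2 ω)) := by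
    intro ω A Q hA hQ hQ0
    have hW0 : 0 ≤ W ω := simpleIntegral_sqFunc_nonneg N g ω
    have hee : 0 ≤ T' ^ 2 * E * (e1 ω + e2 ω) := by positivity
    by_cases hω : ω ∈ B
    · rw [Set.indicator_of_mem hω]
      have h1 := hardThreshold_error_le (devBound (γ * L) M (W ω)) (X ω) x
      -- The requirement `2 ≤ 3 * γ * L` is where `L ≥ 2 / 3` is used.
      have h2 := sq_le_sq_add_mul_exp (abs_nonneg (X ω - x)) hT'0 (k := 3 * γ * L) (by nlinarith)
      rw [sq_abs, ← ht, Real.exp_sub, div_eq_mul_inv, ← Real.exp_neg, ← hE] at h2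
      have h3 : Real.exp (t * |X ω - x|) ≤ e1 ω + e2 ω := by
        rcases abs_cases (X ω - x) with ⟨hh, -⟩ | ⟨hh, -⟩
        · rw [hh]; exact le_add_of_nonneg_right (Real.exp_pos _).le
        · rw [hh, mul_neg, ← neg_mul]; exact le_add_of_nonneg_left (Real.exp_pos _).le
      have h4 : T' ^ 2 * (Real.exp (t * |X ω - x|) * E) ≤ T' ^ 2 * E * (e1 ω + e2 ω) := by
        rw [mul_comm _ E, ← mul_assoc]; gcongr
      have h5 : 0 ≤ A * Q := by positivity
      linarith
    · rw [Set.indicator_of_notMem hω, mul_zero, zero_add]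
      have h1 : |X ω - x| ≤ devBound (c * L) M (W ω) := not_lt.1 hω
      have h2 := hQ (h1.trans (devBound_mono_scale hκ0 hκ1.le (by rw [hκ]; ring) (by positivity)
        hM.le hW0))
      linarith
  have hIR : Integrable (fun ω => (x ^ 2 + T' ^ 2) * B.indicator (fun _ => (1 : ℝ)) ω
      + T' ^ 2 * E * (e1 ω + e2 ω)) P :=
    (hiB.const_mul _).add (hi12.const_mul _)
  have hEexp : E * Real.exp (L / 9) ≤ Real.exp (-(c * L)) := by
    rw [hE, ← Real.exp_add]
    refine Real.exp_le_exp.2 ?_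
    nlinarith
  have hR : ∫ ω, ((x ^ 2 + T' ^ 2) * B.indicator (fun _ => (1 : ℝ)) ω
      + T' ^ 2 * E * (e1 ω + e2 ω)) ∂P
      ≤ 3 * (Real.exp (-(c * L)) * x ^ 2)
          + 405 * γ ^ 2 * (Real.exp (-(c * L)) * (M ^ 2 * m * L)) := by
    rw [integral_add (hiB.const_mul _) (hi12.const_mul _), integral_const_mul,
      integral_const_mul, integral_add hi1 hi2, integral_indicator_const _ hBm, smul_eq_mul, mul_one]
    have h1 : (x ^ 2 + T' ^ 2) * P.real B ≤ (x ^ 2 + T' ^ 2) * (3 * Real.exp (-(c * L))) := by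
      gcongr
    have h2 : T' ^ 2 * E * (∫ ω, e1 ω ∂P + ∫ ω, e2 ω ∂P)
        ≤ T' ^ 2 * (2 * Real.exp (-(c * L))) := by
      rw [mul_assoc]
      have h3 : E * (∫ ω, e1 ω ∂P + ∫ ω, e2 ω ∂P)
          ≤ E * (Real.exp (L / 9) + Real.exp (L / 9)) :=
        mul_le_mul_of_nonneg_left (add_le_add he1 he2) hE0.le
      exact mul_le_mul_of_nonneg_left (by linarith) (sq_nonneg _)
    have h3 : T' ^ 2 * Real.exp (-(c * L)) * 5
        = 405 * γ ^ 2 * (Real.exp (-(c * L)) * (M ^ 2 * m * L)) := by rw [hT'2]; ring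
    linarith
  exact ⟨_, hIR, hR, hpt⟩

/-- On the good event the error is bounded by `x ^ 2` or by the squared threshold, according to
which term of the minimum is smaller. The mean of the squared threshold is computed from the count
in `I`. -/
lemma risk_large (h : IsPoissonProcess N μ P) (g : SimpleFunc ℝ ℝ) {M L c γ κ : ℝ}
    {I : Set ℝ} (hIm : MeasurableSet I) (hI : ∀ x ∉ I, g x = 0) (hM : 0 < M)
    (hg : ∀ᵐ x ∂μ, |g x| ≤ M) (hL : 2 / 3 ≤ L) (hc : 1 ≤ c) (hγ : c < γ)
    (hκ0 : 0 ≤ κ) (hκ1 : κ < 1) (hκ : c = κ ^ 2 * γ)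
    (hm : γ * L / 7 ≤ μ.real I) :
    ∫⁻ ω, ENNReal.ofReal ((hardThreshold (devBound (γ * L) M (simpleIntegral N (sqFunc g) ω))
        (simpleIntegral N g ω) - ∫ x, g x ∂μ) ^ 2) ∂P
      ≤ ENNReal.ofReal (4 / (1 - κ) ^ 2 * (125 * γ)
            * min ((∫ x, g x ∂μ) ^ 2) (M ^ 2 * μ.real I * L)
          + 3 * (Real.exp (-(c * L)) * (∫ x, g x ∂μ) ^ 2)
          + 405 * γ ^ 2 * (Real.exp (-(c * L)) * (M ^ 2 * μ.real I * L))) := by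
  obtain ⟨R, hIR, hR, hpt⟩ := exists_remainder h g hIm hI hM hg hL hc hγ hκ0 hκ1 hκ hm
  set x := ∫ x, g x ∂μ
  set m := μ.real I with hmdef
  have hiK := h.integrable_count hIm (measure_ne_top _ _)
  have hEK := h.integral_count hIm (measure_ne_top _ _)
  have hm0 : 0 < m := lt_of_lt_of_le (by nlinarith) hm
  have hL0 : 0 < L := by linarith
  have hγ1 : 1 < γ := by linarith
  have hk1 : 0 < 1 - κ := by linarith
  set A1 := 4 / (1 - κ) ^ 2 with hA1
  have hA10 : 0 < A1 := by positivity
  rcases le_total (x ^ 2) (M ^ 2 * m * L) with hcase | hcase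
  · rw [min_eq_left hcase]
    refine lintegral_ofReal_le_of_le ((integrable_const (A1 * x ^ 2)).add hIR)
      (ae_of_all _ fun ω => sq_nonneg _) (ae_of_all _ fun ω => hpt ω _ _ hA10.le (fun hcl =>
        (hardThreshold_error_le_of_close (devBound_nonneg (by positivity) hM.le) hκ0 hκ1 hcl).1)
        (sq_nonneg _)) ?_
    rw [Pi.add_def, integral_add (integrable_const _) hIR, integral_const]
    simp only [probReal_univ, one_smul]
    have : A1 * x ^ 2 ≤ A1 * (125 * γ) * x ^ 2 := by
      rw [mul_assoc]
      have : x ^ 2 ≤ 125 * γ * x ^ 2 := by nlinarith [sq_nonneg x]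
      gcongr
    linarith
  · rw [min_eq_right hcase]
    have hiQ : Integrable (fun ω => A1 * (M ^ 2 * (6 * (γ * L) * count N I ω
        + 17 * (γ * L) ^ 2))) P :=
      (((hiK.const_mul _).add (integrable_const _)).const_mul _).const_mul _
    refine lintegral_ofReal_le_of_le (hiQ.add hIR)
      (ae_of_all _ fun ω => sq_nonneg _) ?_ ?_
    · filter_upwards [ae_integral_bounds h g hI hg] with ω hω
      refine hpt ω _ _ hA10.le (fun hcl => ?_) ?_
      · refine (hardThreshold_error_le_of_close (devBound_nonneg (by positivity) hM.le)
          hκ0 hκ1 hcl).2.trans ?_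
        gcongr
        refine (devBound_sq_le (by positivity) (simpleIntegral_sqFunc_nonneg N g ω)).trans ?_
        have : 6 * (γ * L) * simpleIntegral N (sqFunc g) ω ≤ 6 * (γ * L) * (M ^ 2 * count N I ω) := by
          gcongr; exact hω.2
        linarith
      · have := count_nonneg N I ω
        positivity
    · rw [Pi.add_def, integral_add hiQ hIR, integral_const_mul, integral_const_mul,
        integral_add (hiK.const_mul _) (integrable_const _), integral_const_mul, hEK,
        integral_const]
      simp only [probReal_univ, one_smul]
      -- `125 = 6 + 17 * 7`, using `γ * L ≤ 7 * m`.
      have h1 : A1 * (M ^ 2 * (6 * (γ * L) * m + 17 * (γ * L) ^ 2))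
          ≤ A1 * (125 * γ) * (M ^ 2 * m * L) := by
        rw [mul_assoc A1]
        refine mul_le_mul_of_nonneg_left ?_ hA10.le
        have h2 : γ * L ≤ 7 * m := by linarith
        have h3 : 17 * (γ * L) ^ 2 ≤ 119 * (γ * L) * m := by
          have : 0 ≤ γ * L := by positivity
          nlinarith
        have h4 : M ^ 2 * (6 * (γ * L) * m + 17 * (γ * L) ^ 2)
          ≤ M ^ 2 * (6 * (γ * L) * m + 119 * (γ * L) * m) := by gcongr
        linarith
      rw [← hmdef]
      linarith

/-- Since `|X| ≤ M * K` and the threshold is at least `2 * U * M`, a surviving coefficient forces `K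
≥ 2 * U`, a rare event when the mass is at most `U / 7`. The bias is harmless because `|x| ≤ M * m`.
-/
lemma risk_small (h : IsPoissonProcess N μ P) (g : SimpleFunc ℝ ℝ) {M L c γ : ℝ}
    {I : Set ℝ} (hIm : MeasurableSet I) (hI : ∀ x ∉ I, g x = 0) (hM : 0 < M)
    (hg : ∀ᵐ x ∂μ, |g x| ≤ M) (hL : 2 / 3 ≤ L) (hc : 1 ≤ c) (hγ : c < γ)
    (hm : μ.real I ≤ γ * L / 7) :
    ∫⁻ ω, ENNReal.ofReal ((hardThreshold (devBound (γ * L) M (simpleIntegral N (sqFunc g) ω))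
        (simpleIntegral N g ω) - ∫ x, g x ∂μ) ^ 2) ∂P
      ≤ ENNReal.ofReal (2 * γ * min ((∫ x, g x ∂μ) ^ 2) (M ^ 2 * μ.real I * L)
          + 84 * (Real.exp (-(c * L)) * (M ^ 2 * μ.real I * L))) := by
  have hx := abs_integral_le hIm hI hg
  set x := ∫ x, g x ∂μ
  set m := μ.real I with hmdef
  set X := simpleIntegral N g
  set W := simpleIntegral N (sqFunc g)
  set K := count N I with hK
  have hγ1 : 1 < γ := by linarith
  have hm0 : 0 ≤ m := measureReal_nonneg
  have hL0 : 0 < L := by linarith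
  set U := γ * L with hU
  have hU0 : 0 < U := by positivity
  have hi := h.integrable_exp_count hIm (measure_ne_top _ _) 2
  have hi' : Integrable (fun ω => Real.exp (2 * K ω) - 1) P := hi.sub (integrable_const 1)
  have hE := h.integral_exp_count hIm (measure_ne_top _ _) 2
  -- The `- 1` makes the expectation vanish linearly in `m`, so that these remainders can be summed
  -- over infinitely many translates.
  have hiB : Integrable (fun ω => 2 * x ^ 2
      + 2 * M ^ 2 * (4 * Real.exp (-2 * U) * (Real.exp (2 * K ω) - 1))) P :=
    (integrable_const _).add ((hi'.const_mul _).const_mul _)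
  refine lintegral_ofReal_le_of_le hiB (ae_of_all _ fun ω => sq_nonneg _) ?_ ?_
  · filter_upwards [ae_integral_bounds h g hI hg] with ω hω
    have hK0 : 0 ≤ K ω := count_nonneg N I ω
    have hexp1 : 1 ≤ Real.exp (2 * K ω) := Real.one_le_exp (by positivity)
    have hR0 : 0 ≤ 2 * M ^ 2 * (4 * Real.exp (-2 * U) * (Real.exp (2 * K ω) - 1)) := by
      have : 0 ≤ Real.exp (2 * K ω) - 1 := by linarith
      positivity
    unfold hardThreshold
    split_ifs with hs
    · have h1 : 2 * U * M ≤ M * K ω :=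
        (two_mul_le_devBound hU0.le hM.le (simpleIntegral_sqFunc_nonneg N g ω)).trans
          (hs.trans hω.1)
      have h2 : 2 * U ≤ K ω := by nlinarith
      have h3 : X ω ^ 2 ≤ M ^ 2 * K ω ^ 2 := by
        rw [← sq_abs, ← mul_pow]
        exact pow_le_pow_left₀ (abs_nonneg _) hω.1 2
      have h4 : K ω ^ 2 ≤ 2 * Real.exp (K ω) := by
        have := Real.quadratic_le_exp_of_nonneg hK0; nlinarith
      have h5 : 1 ≤ Real.exp (-2 * U) * Real.exp (K ω) := by
        rw [← Real.exp_add]; exact Real.one_le_exp (by linarith)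
      have h6 : Real.exp (2 * K ω) = Real.exp (K ω) * Real.exp (K ω) := by
        rw [← Real.exp_add]; ring_nf
      have h7 : 2 ≤ Real.exp (2 * K ω) := by
        have := Real.add_one_le_exp (2 * K ω); nlinarith
      have h8 : K ω ^ 2 ≤ 4 * Real.exp (-2 * U) * (Real.exp (2 * K ω) - 1) := by
        have hp := Real.exp_pos (-2 * U)
        calc K ω ^ 2 ≤ 2 * Real.exp (K ω) := h4
          _ ≤ 2 * Real.exp (K ω) * (Real.exp (-2 * U) * Real.exp (K ω)) :=
            le_mul_of_one_le_right (by positivity) h5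
          _ = 2 * Real.exp (-2 * U) * Real.exp (2 * K ω) := by rw [h6]; ring
          _ ≤ _ := by nlinarith
      have h9 : 2 * M ^ 2 * K ω ^ 2
          ≤ 2 * M ^ 2 * (4 * Real.exp (-2 * U) * (Real.exp (2 * K ω) - 1)) := by gcongr
      nlinarith [sq_nonneg (X ω + x)]
    · nlinarith [sq_nonneg x]
  · have hee : Real.exp 2 - 1 ≤ 7 := by
      have h1 := Real.exp_one_lt_d9
      have h2 : Real.exp 2 = Real.exp 1 * Real.exp 1 := by rw [← Real.exp_add]; norm_num
      have h3 := Real.exp_pos 1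
      nlinarith
    have h1 : Real.exp (m * (Real.exp 2 - 1)) - 1 ≤ 7 * m * Real.exp U := by
      have h2 : m * (Real.exp 2 - 1) ≤ 7 * m := by nlinarith
      have h3 : Real.exp (m * (Real.exp 2 - 1)) ≤ Real.exp (7 * m) := Real.exp_le_exp.2 h2
      have h4 : Real.exp (7 * m) - 1 ≤ 7 * m * Real.exp (7 * m) := by
        have h5 := Real.add_one_le_exp (-(7 * m))
        have h6 : Real.exp (-(7 * m)) * Real.exp (7 * m) = 1 := by rw [← Real.exp_add]; simp
        nlinarith [Real.exp_pos (7 * m)]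
      have h5 : Real.exp (7 * m) ≤ Real.exp U := Real.exp_le_exp.2 (by linarith)
      have h6 : 7 * m * Real.exp (7 * m) ≤ 7 * m * Real.exp U := by gcongr
      linarith
    rw [integral_add (integrable_const _)
      ((hi'.const_mul _).const_mul _), integral_const,
      integral_const_mul, integral_const_mul, integral_sub hi (integrable_const 1), hE,
      integral_const]
    simp only [probReal_univ, one_smul]
    have h2 : Real.exp (-2 * U) * Real.exp U ≤ Real.exp (-(c * L)) := by
      rw [← Real.exp_add]
      refine Real.exp_le_exp.2 ?_
      rw [hU]; nlinarith
    have h3 : 2 * M ^ 2 * (4 * Real.exp (-2 * U) * (Real.exp (m * (Real.exp 2 - 1)) - 1))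
        ≤ 84 * (Real.exp (-(c * L)) * (M ^ 2 * m * L)) := by
      calc _ ≤ 2 * M ^ 2 * (4 * Real.exp (-2 * U) * (7 * m * Real.exp U)) := by gcongr
        _ = 56 * M ^ 2 * m * (Real.exp (-2 * U) * Real.exp U) := by ring
        _ ≤ 56 * M ^ 2 * m * Real.exp (-(c * L)) := by gcongr
        _ ≤ (84 * L) * M ^ 2 * m * Real.exp (-(c * L)) := by gcongr; linarith
        _ = _ := by ring
    have h4 : x ^ 2 ≤ γ * min (x ^ 2) (M ^ 2 * m * L) := by
      have h5 : x ^ 2 ≤ M ^ 2 * m * (γ * L) := by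
        rw [← sq_abs]
        calc |x| ^ 2 ≤ (M * m) ^ 2 := pow_le_pow_left₀ (abs_nonneg _) hx 2
          _ = M ^ 2 * m * m := by ring
          _ ≤ _ := by gcongr; linarith
      rcases min_cases (x ^ 2) (M ^ 2 * m * L) with ⟨hh, -⟩ | ⟨hh, -⟩ <;> rw [hh]
      · nlinarith [sq_nonneg x]
      · linarith
    linarith

/-- The constant in the risk bound of a single thresholded coefficient. -/
def coeffConst (c γ : ℝ) : ℝ :=
  4 / (1 - √(c / γ)) ^ 2 * (125 * γ) + 2 * γ + 405 * γ ^ 2 + 87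

lemma risk_coefficient (h : IsPoissonProcess N μ P) (g : SimpleFunc ℝ ℝ) {M L c γ : ℝ}
    {I : Set ℝ} (hIm : MeasurableSet I) (hI : ∀ x ∉ I, g x = 0) (hM : 0 < M)
    (hg : ∀ᵐ x ∂μ, |g x| ≤ M) (hL : 2 / 3 ≤ L) (hc : 1 ≤ c) (hγ : c < γ) :
    ∫⁻ ω, ENNReal.ofReal ((hardThreshold (devBound (γ * L) M (simpleIntegral N (sqFunc g) ω))
        (simpleIntegral N g ω) - ∫ x, g x ∂μ) ^ 2) ∂P
      ≤ ENNReal.ofReal (coeffConst c γ * (min ((∫ x, g x ∂μ) ^ 2) (M ^ 2 * μ.real I * L)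
          + Real.exp (-(c * L)) * (∫ x, g x ∂μ) ^ 2
          + Real.exp (-(c * L)) * (M ^ 2 * μ.real I * L))) := by
  have hγ0 : 0 < γ := by linarith
  have hκ1 : √(c / γ) < 1 := by
    rw [Real.sqrt_lt' one_pos, one_pow, div_lt_one hγ0]; exact hγ
  have hκ : c = √(c / γ) ^ 2 * γ := by
    rw [Real.sq_sqrt (by positivity)]; field_simp
  have hk : 0 < 1 - √(c / γ) := by linarith
  have hm0 : 0 ≤ μ.real I := measureReal_nonneg
  have q1 : 0 ≤ min ((∫ x, g x ∂μ) ^ 2) (M ^ 2 * μ.real I * L) :=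
    le_min (sq_nonneg _) (by positivity)
  have q2 : 0 ≤ Real.exp (-(c * L)) * (∫ x, g x ∂μ) ^ 2 := by positivity
  have q3 : 0 ≤ Real.exp (-(c * L)) * (M ^ 2 * μ.real I * L) := by positivity
  have a1 : 0 ≤ 4 / (1 - √(c / γ)) ^ 2 * (125 * γ) := by positivity
  have a2 : 0 ≤ γ ^ 2 := by positivity
  unfold coeffConst
  rcases le_total (γ * L / 7) (μ.real I) with hm | hm
  · refine (risk_large h g hIm hI hM hg hL hc hγ (Real.sqrt_nonneg _) hκ1 hκ hm).trans
      (ENNReal.ofReal_le_ofReal ?_)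
    rw [mul_add, mul_add]
    gcongr ?_ * _ + ?_ * _ + ?_ * _ <;> nlinarith
  · refine (risk_small h g hIm hI hM hg hL hc hγ hm).trans (ENNReal.ofReal_le_ofReal ?_)
    rw [mul_add, mul_add, add_right_comm]
    refine le_add_of_le_of_nonneg (add_le_add ?_ ?_) (mul_nonneg (by positivity) q2)
    · gcongr; nlinarith
    · gcongr; nlinarith

end Risk

/-! ## Riesz bounds for systems of dilated translates -/

/-- The points `x` with `|2^j x - k| ≤ L`. -/
def cell (L : ℝ) (j : ℕ) (k : ℤ) : Set ℝ := {x | |2 ^ j * x - k| ≤ L}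

lemma measurableSet_cell (L : ℝ) (j : ℕ) (k : ℤ) : MeasurableSet (cell L j k) :=
  measurableSet_le (by fun_prop) (by fun_prop)

/-- The cells of one level containing a given point correspond to the integers in an interval of
length `2 * L`. -/
lemma tsum_indicator_cell_le {L : ℝ} (hL : 0 ≤ L) (j : ℕ) (x : ℝ) :
    ∑' k : ℤ, (cell L j k).indicator (1 : ℝ → ℝ≥0∞) x ≤ ENNReal.ofReal (2 * L + 1) := by
  set z : ℝ := 2 ^ j * x
  have hmem : ∀ k : ℤ, x ∈ cell L j k ↔ k ∈ Finset.Icc ⌈z - L⌉ ⌊z + L⌋ := by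
    intro k
    rw [Finset.mem_Icc, Int.ceil_le, Int.le_floor]
    change |z - k| ≤ L ↔ _
    rw [abs_le]
    constructor <;> rintro ⟨h1, h2⟩ <;> constructor <;> linarith
  rw [tsum_eq_sum (s := Finset.Icc ⌈z - L⌉ ⌊z + L⌋)]
  · rw [Finset.sum_congr rfl (g := fun _ => 1)
      (fun k hk => by rw [Set.indicator_of_mem ((hmem k).2 hk)]; rfl)]
    rw [Finset.sum_const, nsmul_eq_mul, mul_one, Int.card_Icc, ← ENNReal.ofReal_natCast]
    refine ENNReal.ofReal_le_ofReal ?_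
    have h1 : (((⌊z + L⌋ + 1 - ⌈z - L⌉).toNat : ℤ) : ℝ)
        = max ((⌊z + L⌋ : ℝ) + 1 - ⌈z - L⌉) 0 := by
      rw [Int.ofNat_toNat]; push_cast; rfl
    rw [← Int.cast_natCast, h1]
    refine max_le ?_ (by linarith)
    have := Int.floor_le (z + L)
    have := Int.le_ceil (z - L)
    linarith
  · intro k hk
    rw [Set.indicator_of_notMem (fun h => hk ((hmem k).1 h))]

lemma tsum_measure_cell_le (ν : Measure ℝ) {L : ℝ} (hL : 0 ≤ L) (j : ℕ) :
    ∑' k : ℤ, ν (cell L j k) ≤ ENNReal.ofReal (2 * L + 1) * ν Set.univ := by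
  calc ∑' k : ℤ, ν (cell L j k)
      = ∑' k : ℤ, ∫⁻ x, (cell L j k).indicator (1 : ℝ → ℝ≥0∞) x ∂ν := by
        congr 1; ext k; rw [lintegral_indicator_one (measurableSet_cell L j k)]
    _ = ∫⁻ x, ∑' k : ℤ, (cell L j k).indicator (1 : ℝ → ℝ≥0∞) x ∂ν :=
        (lintegral_tsum fun k =>
          (measurable_one.indicator (measurableSet_cell L j k)).aemeasurable).symm
    _ ≤ ∫⁻ _, ENNReal.ofReal (2 * L + 1) ∂ν :=
        lintegral_mono fun x => tsum_indicator_cell_le hL j x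
    _ = _ := by rw [lintegral_const]

lemma sum_measureReal_cell_le (ν : Measure ℝ) [IsFiniteMeasure ν] {L : ℝ} (hL : 0 ≤ L) (j : ℕ)
    (K : Finset ℤ) : ∑ k ∈ K, ν.real (cell L j k) ≤ (2 * L + 1) * ν.real Set.univ := by
  have h1 := (ENNReal.sum_le_tsum K).trans (tsum_measure_cell_le ν hL j)
  have h2 := ENNReal.toReal_mono (ENNReal.mul_ne_top ENNReal.ofReal_ne_top (measure_ne_top _ _)) h1
  rwa [ENNReal.toReal_sum (fun k _ => measure_ne_top _ _), ENNReal.toReal_mul,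
    ENNReal.toReal_ofReal (by linarith)] at h2

/-- A bounded measurable function supported in `[-L, L]`. -/
structure IsTame (L B : ℝ) (g : ℝ → ℝ) : Prop where
  measurable : Measurable g
  bound : ∀ x, |g x| ≤ B
  support : ∀ x, L < |x| → g x = 0

namespace IsTame

variable {L B : ℝ} {g u w : ℝ → ℝ}

lemma nonneg (h : IsTame L B g) : 0 ≤ B := (abs_nonneg _).trans (h.bound 0)

lemma mono (h : IsTame L B g) {L' B' : ℝ} (hL : L ≤ L') (hB : B ≤ B') : IsTame L' B' g :=
  ⟨h.measurable, fun x => (h.bound x).trans hB, fun x hx => h.support x (hL.trans_lt hx)⟩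

lemma memLp (h : IsTame L B g) (p : ℝ≥0∞) : MemLp g p volume := by
  have h1 : g = (Set.Icc (-L) L).indicator g := by
    ext x
    by_cases hx : x ∈ Set.Icc (-L) L
    · rw [Set.indicator_of_mem hx]
    · rw [Set.indicator_of_notMem hx, h.support x]
      rw [Set.mem_Icc, ← abs_le] at hx
      exact not_le.1 hx
  rw [h1, memLp_indicator_iff_restrict measurableSet_Icc]
  exact MemLp.of_bound h.measurable.aestronglyMeasurable B (ae_of_all _ h.bound)

lemma integrable (h : IsTame L B g) : Integrable g := memLp_one_iff_integrable.1 (h.memLp 1)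

lemma translate (h : IsTame L B g) (k : ℤ) : IsTame (L + |(k : ℝ)|) B (translate g k) where
  measurable := h.measurable.comp (by fun_prop)
  bound x := h.bound _
  support x hx := h.support _ (by
    have := abs_sub_abs_le_abs_sub x k
    linarith)

lemma dilate (h : IsTame L B g) (j : ℕ) (k : ℤ) :
    IsTame (L + |(k : ℝ)|) ((2 : ℝ) ^ ((j : ℝ) / 2) * B) (dilate g j k) where
  measurable := (h.measurable.comp (by fun_prop)).const_mul _
  bound x := by
    rw [PoissonWavelet.dilate, abs_mul, abs_of_pos (by positivity)]
    exact mul_le_mul_of_nonneg_left (h.bound _) (by positivity)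
  support x hx := by
    have h0 := h.nonneg
    rw [PoissonWavelet.dilate, h.support, mul_zero]
    have h1 := abs_sub_abs_le_abs_sub (2 ^ j * x) k
    have h2 : |x| ≤ |2 ^ j * x| := by
      rw [abs_mul, abs_of_pos (show (0 : ℝ) < 2 ^ j by positivity)]
      exact le_mul_of_one_le_left (abs_nonneg _) (one_le_pow₀ (by norm_num))
    linarith

lemma dilate_eq_zero (h : IsTame L B g) {j : ℕ} {k : ℤ} {x : ℝ} (hx : x ∉ cell L j k) :
    PoissonWavelet.dilate g j k x = 0 := by
  rw [PoissonWavelet.dilate, h.support _ (not_le.1 hx), mul_zero]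

lemma translate_eq_zero (h : IsTame L B g) {k : ℤ} {x : ℝ} (hx : x ∉ cell L 0 k) :
    PoissonWavelet.translate g k x = 0 := by
  rw [PoissonWavelet.translate, h.support]
  simpa [cell] using hx

end IsTame

/-- The increments of `g` are controlled by the finite measure `ν`. -/
def VariationBound (ν : Measure ℝ) (g : ℝ → ℝ) : Prop :=
  ∀ x y, x ≤ y → |g x - g y| ≤ ν.real (Set.Icc x y)

lemma VariationBound.le_cell {ν : Measure ℝ} [IsFiniteMeasure ν] {g : ℝ → ℝ}
    (h : VariationBound ν g) {L : ℝ} {j : ℕ} {k : ℤ} {x y : ℝ} (hx : x ∈ cell L j k)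
    (hy : y ∈ cell L j k) : |g x - g y| ≤ ν.real (cell L j k) := by
  have key : ∀ x y, x ∈ cell L j k → y ∈ cell L j k → x ≤ y →
      |g x - g y| ≤ ν.real (cell L j k) := by
    intro x y hx hy hxy
    refine (h x y hxy).trans (measureReal_mono (fun z hz => ?_))
    have h1 := abs_le.1 (show |2 ^ j * x - k| ≤ L from hx)
    have h2 := abs_le.1 (show |2 ^ j * y - k| ≤ L from hy)
    have h3 : (2 : ℝ) ^ j * x ≤ 2 ^ j * z := by gcongr; exact hz.1
    have h4 : (2 : ℝ) ^ j * z ≤ 2 ^ j * y := by gcongr; exact hz.2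
    change |2 ^ j * z - k| ≤ L
    rw [abs_le]
    constructor <;> linarith
  rcases le_total x y with hxy | hxy
  · exact key x y hx hy hxy
  · rw [abs_sub_comm]; exact key y x hy hx hxy

lemma integral_comp_dilation (w : ℝ → ℝ) (j : ℕ) (k : ℤ) :
    ∫ x, w (2 ^ j * x - k) = ((2 : ℝ) ^ j)⁻¹ * ∫ x, w x := by
  rw [Measure.integral_comp_mul_left (fun y => w (y - k)) ((2 : ℝ) ^ j),
    integral_sub_right_eq_self w (k : ℝ), abs_of_pos (by positivity), smul_eq_mul]

/-- Since `w` has mean zero, `u` may be replaced by its increment from the centre `x₀` of the cell,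
which is at most the `ν`-mass of the cell. -/
lemma abs_integral_mul_dilate_le {L B B' : ℝ} {u w : ℝ → ℝ} {ν : Measure ℝ} [IsFiniteMeasure ν]
    (hL : 0 ≤ L) (hu : IsTame L B u) (hν : VariationBound ν u) (hw : IsTame L B' w)
    (hw0 : ∫ x, w x = 0) (j : ℕ) (k : ℤ) :
    |∫ x, u x * dilate w j k x|
      ≤ (2 : ℝ) ^ (-((j : ℝ) / 2)) * (∫ x, |w x|) * ν.real (cell L j k) := by
  have hwd := hw.dilate j k
  set x₀ : ℝ := k / 2 ^ j
  have hx₀ : x₀ ∈ cell L j k := by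
    have : (2 : ℝ) ^ j * (k / 2 ^ j) = k := by field_simp
    simp only [cell, Set.mem_ofPred_eq, x₀, this]
    simpa using hL
  have hz : ∫ x, dilate w j k x = 0 := by
    simp only [dilate]
    rw [integral_const_mul, integral_comp_dilation, hw0]; simp
  have hi1 : Integrable (fun x => u x * dilate w j k x) :=
    (hu.memLp 2).integrable_mul (hwd.memLp 2)
  have h1 : ∫ x, u x * dilate w j k x = ∫ x, (u x - u x₀) * dilate w j k x := by
    simp_rw [sub_mul]
    rw [integral_sub hi1 (hwd.integrable.const_mul _), integral_const_mul, hz, mul_zero, sub_zero]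
  have habs : ∫ x, |dilate w j k x| = (2 : ℝ) ^ (-((j : ℝ) / 2)) * ∫ x, |w x| := by
    simp only [dilate, abs_mul]
    rw [integral_const_mul, integral_comp_dilation (fun y => |w y|), ← mul_assoc,
      abs_of_pos (by positivity)]
    congr 1
    rw [← Real.rpow_natCast, ← Real.rpow_neg (by norm_num), ← Real.rpow_add (by norm_num)]
    congr 1; ring
  rw [h1, ← habs, mul_comm, ← integral_const_mul]
  refine abs_integral_le_integral_abs.trans (integral_mono_of_nonneg
    (ae_of_all _ fun x => abs_nonneg _) (hwd.integrable.abs.const_mul _)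
    (ae_of_all _ fun x => ?_))
  simp only [abs_mul]
  by_cases hx : x ∈ cell L j k
  · exact mul_le_mul_of_nonneg_right (hν.le_cell hx hx₀) (abs_nonneg _)
  · rw [hw.dilate_eq_zero hx]; simp

lemma sum_abs_integral_mul_dilate_le {L B B' : ℝ} {u w : ℝ → ℝ} {ν : Measure ℝ}
    [IsFiniteMeasure ν] (hL : 0 ≤ L) (hu : IsTame L B u) (hν : VariationBound ν u)
    (hw : IsTame L B' w) (hw0 : ∫ x, w x = 0) (j : ℕ) (K : Finset ℤ) :
    ∑ k ∈ K, |∫ x, u x * dilate w j k x|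
      ≤ (∫ x, |w x|) * ((2 * L + 1) * ν.real Set.univ) * (2 : ℝ) ^ (-((j : ℝ) / 2)) := by
  calc _ ≤ ∑ k ∈ K, (2 : ℝ) ^ (-((j : ℝ) / 2)) * (∫ x, |w x|) * ν.real (cell L j k) :=
        Finset.sum_le_sum fun k _ => abs_integral_mul_dilate_le hL hu hν hw hw0 j k
    _ = (2 : ℝ) ^ (-((j : ℝ) / 2)) * (∫ x, |w x|) * ∑ k ∈ K, ν.real (cell L j k) := by
        rw [Finset.mul_sum]
    _ ≤ (2 : ℝ) ^ (-((j : ℝ) / 2)) * (∫ x, |w x|) * ((2 * L + 1) * ν.real Set.univ) := by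
        refine mul_le_mul_of_nonneg_left (sum_measureReal_cell_le ν hL j K) ?_
        have : 0 ≤ ∫ x, |w x| := integral_nonneg fun x => abs_nonneg _
        positivity
    _ = _ := by ring

/-- Rescaling to the coarser of two levels reduces every Gram entry to an undilated function against
a dilated one. -/
lemma integral_dilate_mul_dilate (u w : ℝ → ℝ) (j d : ℕ) (k k' : ℤ) :
    ∫ x, dilate u j k x * dilate w (j + d) k' x = ∫ x, u x * dilate w d (k' - 2 ^ d * k) x := by
  have h1 : ∀ x, dilate u j k x * dilate w (j + d) k' x
      = 2 ^ j * (u (2 ^ j * x - k) * dilate w d (k' - 2 ^ d * k) (2 ^ j * x - k)) := by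
    intro x
    simp only [dilate]
    have e1 : (2 : ℝ) ^ d * (2 ^ j * x - k) - ((k' - 2 ^ d * k : ℤ) : ℝ)
        = 2 ^ (j + d) * x - k' := by
      push_cast; rw [pow_add]; ring
    have e2 : (2 : ℝ) ^ ((j : ℝ) / 2) * (2 : ℝ) ^ (((j + d : ℕ) : ℝ) / 2)
        = 2 ^ j * (2 : ℝ) ^ ((d : ℝ) / 2) := by
      rw [← Real.rpow_natCast 2 j, ← Real.rpow_add (by norm_num), ← Real.rpow_add (by norm_num)]
      congr 1; push_cast; ring
    rw [e1]
    linear_combination (u (2 ^ j * x - k) * w (2 ^ (j + d) * x - k')) * e2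
  simp_rw [h1]
  rw [integral_const_mul,
    integral_comp_dilation (fun y => u y * dilate w d (k' - 2 ^ d * k) y), ← mul_assoc,
    mul_inv_cancel₀ (by positivity), one_mul]

/-- Schur's test for the symmetric Gram matrix: `|a i * a i'|` is split by the arithmetic-geometric
mean inequality, and each half is summed along a row. -/
lemma schur_bound {ι : Type*} (u : ι → ℝ → ℝ) (hu : ∀ i, MemLp (u i) 2 volume) (F : Finset ι)
    {C : ℝ} (hC : ∀ i ∈ F, ∑ i' ∈ F, |∫ x, u i x * u i' x| ≤ C) (a : ι → ℝ) :
    ∫ x, (∑ i ∈ F, a i * u i x) ^ 2 ≤ C * ∑ i ∈ F, a i ^ 2 := by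
  have hint : ∀ i i', Integrable (fun x => u i x * u i' x) := fun i i' =>
    (hu i).integrable_mul (hu i')
  have h1 : ∫ x, (∑ i ∈ F, a i * u i x) ^ 2
      = ∑ i ∈ F, ∑ i' ∈ F, a i * a i' * ∫ x, u i x * u i' x := by
    have : ∀ x, (∑ i ∈ F, a i * u i x) ^ 2
        = ∑ i ∈ F, ∑ i' ∈ F, a i * a i' * (u i x * u i' x) := by
      intro x
      rw [sq, Finset.sum_mul_sum]
      exact Finset.sum_congr rfl fun i _ => Finset.sum_congr rfl fun i' _ => by ring
    simp_rw [this]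
    rw [integral_finsetSum _ fun i _ => integrable_finsetSum _ fun i' _ =>
      (hint i i').const_mul _]
    refine Finset.sum_congr rfl fun i _ => ?_
    rw [integral_finsetSum _ fun i' _ => (hint i i').const_mul _]
    simp_rw [integral_const_mul]
  rw [h1]
  have hsym : ∀ i i', |∫ x, u i x * u i' x| = |∫ x, u i' x * u i x| := by
    intro i i'; simp_rw [mul_comm]
  calc _ ≤ ∑ i ∈ F, ∑ i' ∈ F, (a i ^ 2 / 2 * |∫ x, u i x * u i' x|
          + a i' ^ 2 / 2 * |∫ x, u i' x * u i x|) := by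
        refine Finset.sum_le_sum fun i _ => Finset.sum_le_sum fun i' _ => ?_
        rw [hsym i' i, ← add_mul]
        refine (le_abs_self _).trans ?_
        rw [abs_mul]
        refine mul_le_mul_of_nonneg_right ?_ (abs_nonneg _)
        rw [abs_mul, ← sq_abs (a i), ← sq_abs (a i')]
        nlinarith [sq_nonneg (|a i| - |a i'|)]
    _ = ∑ i ∈ F, a i ^ 2 * ∑ i' ∈ F, |∫ x, u i x * u i' x| := by
        simp_rw [Finset.sum_add_distrib]
        conv_lhs => rw [add_comm, Finset.sum_comm]
        rw [← Finset.sum_add_distrib]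
        refine Finset.sum_congr rfl fun i _ => ?_
        rw [← Finset.sum_add_distrib, Finset.mul_sum]
        exact Finset.sum_congr rfl fun i' _ => by ring
    _ ≤ ∑ i ∈ F, a i ^ 2 * C :=
        Finset.sum_le_sum fun i hi => mul_le_mul_of_nonneg_left (hC i hi) (sq_nonneg _)
    _ = _ := by rw [← Finset.sum_mul, mul_comm]

lemma summable_geometric_natAbs {ρ : ℝ} (h0 : 0 ≤ ρ) (h1 : ρ < 1) :
    Summable (fun z : ℤ => ρ ^ z.natAbs) := by
  have := summable_geometric_of_lt_one h0 h1
  refine Summable.of_nat_of_neg ?_ ?_ <;> simpa using this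

/-- The system consisting of the translates of `φ` and the dilated translates of `ψ`. -/
def system (φ ψ : ℝ → ℝ) : Index → ℝ → ℝ
  | Sum.inl k => translate φ k
  | Sum.inr jk => dilate ψ jk.1 jk.2

/-- One level contributes a multiple of `2^(-d/2)`, where `d` is the level difference, and these
form a two-sided geometric series. -/
lemma exists_row_bound_dilate {L B : ℝ} {ψ : ℝ → ℝ} {ν : Measure ℝ} [IsFiniteMeasure ν]
    (hL : 0 ≤ L) (hψ : IsTame L B ψ) (hν : VariationBound ν ψ) (h0 : ∫ x, ψ x = 0) :
    ∃ C : ℝ, 0 ≤ C ∧ ∀ (F : Finset (ℕ × ℤ)) (l : ℕ × ℤ),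
      ∑ l' ∈ F, |∫ x, dilate ψ l.1 l.2 x * dilate ψ l'.1 l'.2 x| ≤ C := by
  classical
  set ρ : ℝ := (2 : ℝ) ^ (-(1 / 2) : ℝ) with hρ
  have hρ0 : 0 ≤ ρ := by positivity
  have hρ1 : ρ < 1 := Real.rpow_lt_one_of_one_lt_of_neg (by norm_num) (by norm_num)
  have hs := summable_geometric_natAbs hρ0 hρ1
  set D := (∫ x, |ψ x|) * ((2 * L + 1) * ν.real Set.univ) with hD
  have hD0 : 0 ≤ D := by
    have : 0 ≤ ∫ x, |ψ x| := integral_nonneg fun x => abs_nonneg _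
    positivity
  have hpow : ∀ d : ℕ, (2 : ℝ) ^ (-((d : ℝ) / 2)) = ρ ^ d := by
    intro d
    rw [hρ, ← Real.rpow_natCast, ← Real.rpow_mul (by norm_num)]
    congr 1; ring
  refine ⟨D * ∑' z : ℤ, ρ ^ z.natAbs, mul_nonneg hD0 (tsum_nonneg fun z => by positivity), ?_⟩
  rintro F ⟨j, k⟩
  have hlevel : ∀ (j' : ℕ) (K : Finset ℤ),
      ∑ k' ∈ K, |∫ x, dilate ψ j k x * dilate ψ j' k' x| ≤ D * ρ ^ ((j' : ℤ) - j).natAbs := by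
    intro j' K
    rcases le_total j j' with h | h
    · obtain ⟨d, rfl⟩ := Nat.exists_eq_add_of_le h
      simp_rw [integral_dilate_mul_dilate]
      have hinj : Set.InjOn (fun k' : ℤ => k' - 2 ^ d * k) (K : Set ℤ) := by
        intro a _ b _ hab; simpa using hab
      rw [← Finset.sum_image (f := fun m : ℤ => |∫ x, ψ x * dilate ψ d m x|) hinj]
      refine (sum_abs_integral_mul_dilate_le hL hψ hν hψ h0 d _).trans (le_of_eq ?_)
      rw [hpow]; congr 2; omega
    · obtain ⟨d, rfl⟩ := Nat.exists_eq_add_of_le h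
      simp_rw [fun (a : ℤ) (x : ℝ) => mul_comm (dilate ψ (j' + d) k x) (dilate ψ j' a x),
        integral_dilate_mul_dilate]
      -- When the second level is the coarser one, the relative shifts `k - 2 ^ d * k'` are still
      -- distinct, so the same one-scale sum applies.
      have hinj : Set.InjOn (fun k' : ℤ => k - 2 ^ d * k') (K : Set ℤ) := by
        intro a _ b _ hab
        simpa using hab
      rw [← Finset.sum_image (f := fun m : ℤ => |∫ x, ψ x * dilate ψ d m x|) hinj]
      refine (sum_abs_integral_mul_dilate_le hL hψ hν hψ h0 d _).trans (le_of_eq ?_)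
      rw [hpow]; congr 2; omega
  calc ∑ l' ∈ F, |∫ x, dilate ψ j k x * dilate ψ l'.1 l'.2 x|
      ≤ ∑ l' ∈ (F.image Prod.fst) ×ˢ (F.image Prod.snd),
          |∫ x, dilate ψ j k x * dilate ψ l'.1 l'.2 x| :=
        Finset.sum_le_sum_of_subset_of_nonneg Finset.subset_product fun _ _ _ => abs_nonneg _
    _ = ∑ j' ∈ F.image Prod.fst, ∑ k' ∈ F.image Prod.snd,
          |∫ x, dilate ψ j k x * dilate ψ j' k' x| := Finset.sum_product _ _ _
    _ ≤ ∑ j' ∈ F.image Prod.fst, D * ρ ^ ((j' : ℤ) - j).natAbs :=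
        Finset.sum_le_sum fun j' _ => hlevel j' _
    _ = D * ∑ z ∈ (F.image Prod.fst).image (fun j' : ℕ => (j' : ℤ) - j), ρ ^ z.natAbs := by
        rw [Finset.mul_sum, Finset.sum_image (g := fun j' : ℕ => (j' : ℤ) - j)]
        intro a _ b _ hab; simpa using hab
    _ ≤ _ := by
        gcongr
        exact hs.sum_le_tsum _ fun z _ => by positivity

/-- At a single scale bounded overlap suffices; no cancellation is needed, and the father has none.
-/
lemma exists_row_bound_translate {L B : ℝ} {φ : ℝ → ℝ} (hL : 0 ≤ L) (hφ : IsTame L B φ) :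
    ∃ C : ℝ, 0 ≤ C ∧ ∀ (F : Finset ℤ) (k : ℤ),
      ∑ k' ∈ F, |∫ x, translate φ k x * translate φ k' x| ≤ C := by
  set D := ∫ x, |φ x| with hD
  have hD0 : 0 ≤ D := integral_nonneg fun x => abs_nonneg _
  have hB := hφ.nonneg
  refine ⟨(B * (2 * L + 1)) * D, by positivity, fun F k => ?_⟩
  have hk := hφ.translate k
  have hDk : ∫ x, |translate φ k x| = D := integral_sub_right_eq_self (fun x => |φ x|) (k : ℝ)
  have hint : ∀ k', Integrable (fun x => |translate φ k x * translate φ k' x|) := fun k' =>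
    ((hk.memLp 2).integrable_mul ((hφ.translate k').memLp 2)).abs
  calc _ ≤ ∑ k' ∈ F, ∫ x, |translate φ k x * translate φ k' x| :=
        Finset.sum_le_sum fun k' _ => abs_integral_le_integral_abs
    _ = ∫ x, ∑ k' ∈ F, |translate φ k x * translate φ k' x| :=
        (integral_finsetSum _ fun k' _ => hint k').symm
    _ ≤ ∫ x, (B * (2 * L + 1)) * |translate φ k x| := by
        refine integral_mono (integrable_finsetSum _ fun k' _ => hint k')
          (hk.integrable.abs.const_mul _) fun x => ?_
        simp only [abs_mul]
        rw [← Finset.mul_sum, mul_comm]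
        refine mul_le_mul_of_nonneg_right ?_ (abs_nonneg _)
        -- The Dirac mass at `x` counts the cells containing `x`, so the overlap bound for measures
        -- applies.
        calc ∑ k' ∈ F, |translate φ k' x|
            ≤ ∑ k' ∈ F, B * (Measure.dirac x).real (cell L 0 k') := by
              refine Finset.sum_le_sum fun k' _ => ?_
              by_cases hx : x ∈ cell L 0 k'
              · rw [measureReal_def, Measure.dirac_apply_of_mem hx]
                simpa [PoissonWavelet.translate] using hφ.bound (x - k')
              · rw [hφ.translate_eq_zero hx, abs_zero]; positivity
          _ = B * ∑ k' ∈ F, (Measure.dirac x).real (cell L 0 k') := by rw [Finset.mul_sum]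
          _ ≤ B * (2 * L + 1) := by
              gcongr
              simpa using sum_measureReal_cell_le (Measure.dirac x) hL 0 F
    _ = _ := by rw [integral_const_mul, hDk]

/-- The upper Riesz bound for the system generated by `φ` and `ψ`. -/
lemma exists_riesz_bound {L B : ℝ} {φ ψ : ℝ → ℝ} {ν : Measure ℝ} [IsFiniteMeasure ν]
    (hL : 0 ≤ L) (hφ : IsTame L B φ) (hψ : IsTame L B ψ) (hν : VariationBound ν ψ)
    (h0 : ∫ x, ψ x = 0) :
    ∃ C : ℝ, 0 < C ∧ ∀ (F : Finset Index) (a : Index → ℝ),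
      ∫ x, (∑ l ∈ F, a l * system φ ψ l x) ^ 2 ≤ C * ∑ l ∈ F, a l ^ 2 := by
  obtain ⟨C1, hC10, hC1⟩ := exists_row_bound_translate hL hφ
  obtain ⟨C2, hC20, hC2⟩ := exists_row_bound_dilate hL hψ hν h0
  refine ⟨2 * (C1 + C2) + 1, by positivity, fun F a => ?_⟩
  have h1 := schur_bound (fun k => translate φ k) (fun k => (hφ.translate k).memLp 2) F.toLeft
    (fun k _ => hC1 _ k) (fun k => a (Sum.inl k))
  have h2 := schur_bound (fun l : ℕ × ℤ => dilate ψ l.1 l.2)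
    (fun l => (hψ.dilate l.1 l.2).memLp 2) F.toRight (fun k _ => hC2 _ k) (fun k => a (Sum.inr k))
  have hsplit : ∀ f : Index → ℝ, ∑ l ∈ F, f l
      = ∑ k ∈ F.toLeft, f (Sum.inl k) + ∑ l ∈ F.toRight, f (Sum.inr l) := by
    intro f
    rw [← Finset.sum_disjSum, Finset.toLeft_disjSum_toRight]
  have m1 : MemLp (fun x => ∑ k ∈ F.toLeft, a (Sum.inl k) * translate φ k x) 2 volume :=
    memLp_finsetSum _ fun k _ => ((hφ.translate k).memLp 2).const_mul _
  have m2 : MemLp (fun x => ∑ l ∈ F.toRight, a (Sum.inr l) * dilate ψ l.1 l.2 x) 2 volume :=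
    memLp_finsetSum _ fun k _ => ((hψ.dilate _ _).memLp 2).const_mul _
  have s1 : 0 ≤ ∑ k ∈ F.toLeft, a (Sum.inl k) ^ 2 := Finset.sum_nonneg fun _ _ => sq_nonneg _
  have s2 : 0 ≤ ∑ k ∈ F.toRight, a (Sum.inr k) ^ 2 := Finset.sum_nonneg fun _ _ => sq_nonneg _
  -- Separating the father and mother parts by `(a + b) ^ 2 ≤ 2 * a ^ 2 + 2 * b ^ 2` avoids the
  -- mixed Gram entries.
  calc ∫ x, (∑ l ∈ F, a l * system φ ψ l x) ^ 2
      ≤ ∫ x, (2 * (∑ k ∈ F.toLeft, a (Sum.inl k) * translate φ k x) ^ 2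
          + 2 * (∑ l ∈ F.toRight, a (Sum.inr l) * dilate ψ l.1 l.2 x) ^ 2) := by
        refine integral_mono_of_nonneg (ae_of_all _ fun x => sq_nonneg _)
          ((m1.integrable_sq.const_mul 2).add (m2.integrable_sq.const_mul 2))
          (ae_of_all _ fun x => ?_)
        simp only [hsplit]
        exact (add_sq_le).trans (le_of_eq (by simp only [system]; ring))
    _ = 2 * (∫ x, (∑ k ∈ F.toLeft, a (Sum.inl k) * translate φ k x) ^ 2)
          + 2 * ∫ x, (∑ l ∈ F.toRight, a (Sum.inr l) * dilate ψ l.1 l.2 x) ^ 2 := by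
        rw [integral_add (m1.integrable_sq.const_mul 2) (m2.integrable_sq.const_mul 2),
          integral_const_mul, integral_const_mul]
    _ ≤ _ := by
        rw [hsplit]
        nlinarith

/-! ## Piecewise constant functions -/

namespace IsPiecewiseConstant

variable {g : ℝ → ℝ}

/-- Off the breakpoints, the value depends only on which breakpoints lie to the left. -/
lemma finite_range (h : IsPiecewiseConstant g) : (Set.range g).Finite := by
  classical
  obtain ⟨S, hS⟩ := h
  have hle : ∀ x y, x ∉ S → y ∉ S → x ≤ y → S.filter (· < x) = S.filter (· < y) → g x = g y := by
    intro x y hx hy hxy hf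
    refine hS x y hxy fun z hz hzS => ?_
    have h1 : z ∈ S.filter (· < y) :=
      Finset.mem_filter.2 ⟨hzS, lt_of_le_of_ne hz.2 fun h => hy (h ▸ hzS)⟩
    rw [← hf] at h1
    exact absurd (Finset.mem_filter.1 h1).2 (not_lt.2 hz.1)
  have key : ∀ x y, x ∉ S → y ∉ S → S.filter (· < x) = S.filter (· < y) → g x = g y := by
    intro x y hx hy hf
    rcases le_total x y with hxy | hxy
    · exact hle x y hx hy hxy hf
    · exact (hle y x hy hx hxy hf.symm).symm
  let v : Finset ℝ → ℝ := fun T =>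
    if hT : ∃ x, x ∉ S ∧ S.filter (· < x) = T then g hT.choose else 0
  refine Set.Finite.subset ((S.finite_toSet.image g).union (S.powerset.finite_toSet.image v)) ?_
  rintro _ ⟨x, rfl⟩
  by_cases hx : x ∈ S
  · exact Or.inl ⟨x, hx, rfl⟩
  · refine Or.inr ⟨S.filter (· < x), by simp [Finset.filter_subset, -Finset.coe_filter], ?_⟩
    have hT : ∃ y, y ∉ S ∧ S.filter (· < y) = S.filter (· < x) := ⟨x, hx, rfl⟩
    simp only [v, dif_pos hT]
    exact key _ _ hT.choose_spec.1 hx hT.choose_spec.2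

lemma measurableSet_fiber (h : IsPiecewiseConstant g) (y : ℝ) : MeasurableSet (g ⁻¹' {y}) := by
  obtain ⟨S, hS⟩ := h
  have h1 : g ⁻¹' {y} = (g ⁻¹' {y} ∩ S) ∪ (g ⁻¹' {y} ∩ (S : Set ℝ)ᶜ) := by
    rw [← Set.inter_union_distrib_left, Set.union_compl_self, Set.inter_univ]
  rw [h1]
  refine MeasurableSet.union ((S.finite_toSet.subset Set.inter_subset_right).measurableSet)
    (IsOpen.measurableSet ?_)
  rw [Metric.isOpen_iff]
  rintro x ⟨hx, hxS⟩
  obtain ⟨ε, hε, hball⟩ := Metric.isOpen_iff.1 S.finite_toSet.isClosed.isOpen_compl x hxS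
  refine ⟨ε, hε, fun z hz => ⟨?_, hball hz⟩⟩
  have hord : ∀ w ∈ Set.uIcc x z, w ∉ S := fun w hw =>
    hball ((convex_ball x ε).ordConnected.uIcc_subset (Metric.mem_ball_self hε) hz hw)
  rw [Set.mem_preimage, Set.mem_singleton_iff] at hx ⊢
  rcases le_total x z with hxz | hxz
  · rw [Set.uIcc_of_le hxz] at hord
    rw [← hS x z hxz hord, hx]
  · rw [Set.uIcc_of_ge hxz] at hord
    rw [hS z x hxz hord, hx]

/-- A piecewise constant function as a simple function. -/
def toSimpleFunc (h : IsPiecewiseConstant g) : SimpleFunc ℝ ℝ where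
  toFun := g
  measurableSet_fiber' := h.measurableSet_fiber
  finite_range' := h.finite_range

lemma exists_bound (h : IsPiecewiseConstant g) : ∃ B, ∀ x, |g x| ≤ B := by
  obtain ⟨C, hC⟩ := h.toSimpleFunc.exists_forall_norm_le
  exact ⟨C, hC⟩

/-- An interval over which `g` changes contains a breakpoint, so an atom of mass `2 * B` at each one
suffices. -/
lemma exists_variationBound (h : IsPiecewiseConstant g) :
    ∃ ν : Measure ℝ, IsFiniteMeasure ν ∧ VariationBound ν g := by
  obtain ⟨B, hB⟩ := h.exists_bound
  obtain ⟨S, hS⟩ := h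
  have hB0 : 0 ≤ B := (abs_nonneg _).trans (hB 0)
  have hfin : IsFiniteMeasure (∑ z ∈ S, ENNReal.ofReal (2 * B) • Measure.dirac z) := by
    refine ⟨?_⟩
    simp only [Measure.coe_finsetSum, Finset.sum_apply, Measure.smul_apply, measure_univ,
      smul_eq_mul, mul_one]
    exact ENNReal.sum_lt_top.2 fun z _ => ENNReal.ofReal_lt_top
  refine ⟨∑ z ∈ S, ENNReal.ofReal (2 * B) • Measure.dirac z, hfin, fun x y hxy => ?_⟩
  by_cases hz : ∀ z ∈ Set.Icc x y, z ∉ S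
  · rw [hS x y hxy hz, sub_self, abs_zero]
    exact measureReal_nonneg
  · push Not at hz
    obtain ⟨z, hz, hzS⟩ := hz
    have h1 : |g x - g y| ≤ 2 * B := by
      have := abs_sub (g x) (g y)
      linarith [hB x, hB y]
    have h2 : ENNReal.ofReal (2 * B)
        ≤ (∑ z ∈ S, ENNReal.ofReal (2 * B) • Measure.dirac z) (Set.Icc x y) := by
      simp only [Measure.coe_finsetSum, Finset.sum_apply, Measure.smul_apply, smul_eq_mul]
      refine le_trans ?_ (Finset.single_le_sum (f := fun z =>
        ENNReal.ofReal (2 * B) * Measure.dirac z (Set.Icc x y)) (fun _ _ => zero_le) hzS)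
      rw [Measure.dirac_apply_of_mem hz, mul_one]
    refine h1.trans ((ENNReal.ofReal_le_iff_le_toReal (measure_ne_top _ _)).1 h2)

end IsPiecewiseConstant

lemma exists_tame {g : ℝ → ℝ} (hm : Measurable g) (hc : HasCompactSupport g) {B : ℝ}
    (hB : ∀ x, |g x| ≤ B) : ∃ L, 0 < L ∧ IsTame L B g := by
  obtain ⟨L, hL, h⟩ := hc.exists_pos_le_norm
  exact ⟨L, hL, hm, hB, fun x hx => h x hx.le⟩

lemma isPiecewiseConstant_father : IsPiecewiseConstant father := by
  classical
  refine ⟨{0, 1}, fun x y hxy h => ?_⟩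
  have h0 : ¬ (x ≤ 0 ∧ 0 ≤ y) := fun hh => h 0 hh (by simp)
  have h1 : ¬ (x ≤ 1 ∧ 1 ≤ y) := fun hh => h 1 hh (by simp)
  have hiff : x ∈ Set.Icc (0 : ℝ) 1 ↔ y ∈ Set.Icc (0 : ℝ) 1 := by
    simp only [Set.mem_Icc]
    constructor
    · rintro ⟨a, b⟩
      refine ⟨a.trans hxy, ?_⟩
      by_contra hc
      exact h1 ⟨b, (not_le.1 hc).le⟩
    · rintro ⟨a, b⟩
      refine ⟨?_, hxy.trans b⟩
      by_contra hc
      exact h0 ⟨(not_le.1 hc).le, a⟩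
  unfold father
  by_cases hx : x ∈ Set.Icc (0 : ℝ) 1
  · rw [Set.indicator_of_mem hx, Set.indicator_of_mem (hiff.1 hx)]; rfl
  · rw [Set.indicator_of_notMem hx, Set.indicator_of_notMem (fun hy => hx (hiff.2 hy))]

lemma hasCompactSupport_father : HasCompactSupport father :=
  HasCompactSupport.intro (isCompact_Icc (a := (0 : ℝ)) (b := 1)) fun _ hx =>
    Set.indicator_of_notMem hx _

lemma exists_variationBound_of_contDiff {g : ℝ → ℝ} (hg : ContDiff ℝ 1 g)
    (hc : HasCompactSupport g) : ∃ ν : Measure ℝ, IsFiniteMeasure ν ∧ VariationBound ν g := by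
  have hcont : Continuous (deriv g) := hg.continuous_deriv le_rfl
  have hint : Integrable (deriv g) := hcont.integrable_of_hasCompactSupport hc.deriv
  have hfin : IsFiniteMeasure (volume.withDensity fun x => ‖deriv g x‖ₑ) :=
    isFiniteMeasure_withDensity hint.2.ne
  refine ⟨_, hfin, fun x y hxy => ?_⟩
  have h1 : ∫ t in x..y, deriv g t = g y - g x :=
    intervalIntegral.integral_deriv_eq_sub' g rfl
      (fun t _ => (hg.differentiable one_ne_zero).differentiableAt) hcont.continuousOn
  rw [abs_sub_comm, ← h1]
  rw [measureReal_def, withDensity_apply _ measurableSet_Icc,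
    ← integral_norm_eq_lintegral_enorm hint.1.restrict]
  rw [← Real.norm_eq_abs]
  refine intervalIntegral.norm_integral_le_integral_norm_uIoc.trans ?_
  rw [Set.uIoc_of_le hxy]
  exact setIntegral_mono_set hint.norm.integrableOn (ae_of_all _ fun _ => norm_nonneg _)
    (Set.Ioc_subset_Icc_self.eventuallyLE)

/-! ## The two systems of a biorthogonal basis -/

lemma lintegral_ofReal_sq (g : ℝ → ℝ) :
    ∫⁻ x, ENNReal.ofReal (g x ^ 2) = eLpNorm g 2 volume ^ 2 := by
  have h := eLpNorm_nnreal_pow_eq_lintegral (f := g) (μ := volume) (p := 2) (by norm_num)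
  simp only [NNReal.coe_ofNat, ENNReal.rpow_ofNat, ENNReal.coe_ofNat] at h
  rw [h]
  congr 1
  ext x
  rw [Real.enorm_eq_ofReal_abs, ← ENNReal.ofReal_pow (abs_nonneg _), sq_abs]

lemma integral_sq_le {g : ℝ → ℝ} (hg : MemLp g 2 volume) {ε : ℝ} (hε : 0 ≤ ε)
    (h : eLpNorm g 2 volume ≤ ENNReal.ofReal ε) : ∫ x, g x ^ 2 ≤ ε ^ 2 := by
  rw [← ENNReal.ofReal_le_ofReal_iff (by positivity),
    ofReal_integral_eq_lintegral_ofReal hg.integrable_sq (ae_of_all _ fun x => sq_nonneg _),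
    lintegral_ofReal_sq, ENNReal.ofReal_pow hε]
  gcongr

lemma integrable_mul_of_memLp {f g : ℝ → ℝ} (hf : MemLp f 2 volume) (hg : MemLp g 2 volume) :
    Integrable (fun x => f x * g x) := hf.integrable_mul hg

/-- Bessel's inequality, from the upper Riesz bound. -/
lemma bessel_of_riesz {u : Index → ℝ → ℝ} (hu : ∀ l, MemLp (u l) 2 volume) {C : ℝ} (hC : 0 < C)
    (h : ∀ (F : Finset Index) (a : Index → ℝ),
      ∫ x, (∑ l ∈ F, a l * u l x) ^ 2 ≤ C * ∑ l ∈ F, a l ^ 2)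
    {f : ℝ → ℝ} (hf : MemLp f 2 volume) (F : Finset Index) :
    ∑ l ∈ F, (∫ x, u l x * f x) ^ 2 ≤ C * ∫ x, f x ^ 2 := by
  set a : Index → ℝ := fun l => ∫ x, u l x * f x with ha
  set A := ∑ l ∈ F, a l ^ 2 with hA
  set s : ℝ → ℝ := fun x => ∑ l ∈ F, a l * u l x with hs
  have hsm : MemLp s 2 volume := memLp_finsetSum _ fun l _ => (hu l).const_mul _
  have h1 : ∫ x, s x ^ 2 ≤ C * A := h F a
  have h2 : ∫ x, s x * f x = A := by
    simp only [hs, Finset.sum_mul, mul_assoc]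
    rw [integral_finsetSum _ fun l _ => (integrable_mul_of_memLp (hu l) hf).const_mul _]
    simp_rw [integral_const_mul]
    exact Finset.sum_congr rfl fun l _ => by rw [sq]
  have hsf : Integrable (fun x => s x * f x) := integrable_mul_of_memLp hsm hf
  -- Expanding this square with `∫ s * f = A` and `∫ s ^ 2 ≤ C * A` gives `A ≤ C * ∫ f ^ 2`.
  have h3 : 0 ≤ ∫ x, (C * f x - s x) ^ 2 := integral_nonneg fun x => sq_nonneg _
  have h4 : ∫ x, (C * f x - s x) ^ 2 = C ^ 2 * (∫ x, f x ^ 2) - 2 * C * A + ∫ x, s x ^ 2 := by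
    have : ∀ x, (C * f x - s x) ^ 2 = C ^ 2 * f x ^ 2 - 2 * C * (s x * f x) + s x ^ 2 := by
      intro x; ring
    simp_rw [this]
    rw [integral_add _ hsm.integrable_sq, integral_sub (hf.integrable_sq.const_mul _)
      (hsf.const_mul _), integral_const_mul, integral_const_mul, h2]
    exact (hf.integrable_sq.const_mul _).sub (hsf.const_mul _)
  have h5 : C * A ≤ C * (C * ∫ x, f x ^ 2) := by nlinarith
  exact le_of_mul_le_mul_left h5 hC

namespace Generators

variable {Φ : Generators} {r : ℝ}

lemma analysis_eq (Φ : Generators) : Φ.analysis = system father Φ.mother := by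
  ext l x; cases l <;> rfl

lemma reconstruction_eq (Φ : Generators) :
    Φ.reconstruction = system Φ.dualFather Φ.dualMother := by
  ext l x; cases l <;> rfl

namespace IsBiorthogonalBasis

lemma exists_tame_analysis (h : Φ.IsBiorthogonalBasis r) :
    ∃ L B : ℝ, 1 ≤ L ∧ 1 ≤ B ∧ IsTame L B father ∧ IsTame L B Φ.mother := by
  obtain ⟨B₁, hB₁⟩ := isPiecewiseConstant_father.exists_bound
  obtain ⟨B₂, hB₂⟩ := h.piecewiseConstant.exists_bound
  obtain ⟨L₁, -, h1⟩ := exists_tame isPiecewiseConstant_father.toSimpleFunc.measurable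
    hasCompactSupport_father hB₁
  obtain ⟨L₂, -, h2⟩ := exists_tame h.piecewiseConstant.toSimpleFunc.measurable
    h.compact_mother hB₂
  exact ⟨max 1 (max L₁ L₂), max 1 (max B₁ B₂), le_max_left _ _, le_max_left _ _,
    h1.mono (by simp) (by simp), h2.mono (by simp) (by simp)⟩

lemma memLp_system {L B : ℝ} {φ ψ : ℝ → ℝ} (hφ : IsTame L B φ) (hψ : IsTame L B ψ) (l : Index) :
    MemLp (system φ ψ l) 2 volume := by
  rcases l with k | ⟨j, k⟩
  · exact (hφ.translate k).memLp 2
  · exact (hψ.dilate j k).memLp 2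

lemma exists_bessel (h : Φ.IsBiorthogonalBasis r) (hr : 0 ≤ r) :
    ∃ C : ℝ, 0 < C ∧ ∀ f : ℝ → ℝ, MemLp f 2 volume → ∀ F : Finset Index,
      ∑ l ∈ F, Φ.coeff f l ^ 2 ≤ C * ∫ x, f x ^ 2 := by
  obtain ⟨L, B, hL, -, hφ, hψ⟩ := h.exists_tame_analysis
  obtain ⟨ν, hν, hvar⟩ := h.piecewiseConstant.exists_variationBound
  have h0 : ∫ x, Φ.mother x = 0 := by
    have := h.vanishing_moments 0 (by simpa using hr)
    simpa using this
  obtain ⟨C, hC, hR⟩ := exists_riesz_bound (by linarith) hφ hψ hvar h0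
  refine ⟨C, hC, fun f hf F => ?_⟩
  have := bessel_of_riesz (memLp_system hφ hψ) hC hR hf F
  simpa only [coeff, analysis_eq] using this

/-- The smooth and Haar alternatives meet here: bounded variation of the dual mother is all that the
Riesz bound takes from regularity. For `r > 0` it comes from `r + 1 ≥ 1` and a `C¹` function. -/
lemma exists_tame_dual (h : Φ.IsBiorthogonalBasis r) :
    ∃ L B : ℝ, 1 ≤ L ∧ IsTame L B Φ.dualFather ∧ IsTame L B Φ.dualMother ∧
      ∃ ν : Measure ℝ, IsFiniteMeasure ν ∧ VariationBound ν Φ.dualMother := by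
  rcases h.regular with ⟨hr, h1, h2⟩ | ⟨-, hm, hf, hdm⟩
  · have hfloor : (1 : ℕ) ≤ ⌊r + 1⌋₊ := Nat.le_floor (by push_cast; linarith)
    have c1 : ContDiff ℝ 1 Φ.dualFather := h1.1.of_le (by exact_mod_cast hfloor)
    have c2 : ContDiff ℝ 1 Φ.dualMother := h2.1.of_le (by exact_mod_cast hfloor)
    obtain ⟨B₁, hB₁⟩ := h1.2.1 0 (Nat.zero_le _)
    obtain ⟨B₂, hB₂⟩ := h2.2.1 0 (Nat.zero_le _)
    simp only [iteratedDeriv_zero] at hB₁ hB₂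
    obtain ⟨L₁, -, t1⟩ := exists_tame c1.continuous.measurable h.compact_dualFather hB₁
    obtain ⟨L₂, -, t2⟩ := exists_tame c2.continuous.measurable h.compact_dualMother hB₂
    exact ⟨max 1 (max L₁ L₂), max B₁ B₂, le_max_left _ _, t1.mono (by simp) (by simp),
      t2.mono (by simp) (by simp), exists_variationBound_of_contDiff c2 h.compact_dualMother⟩
  · obtain ⟨L, B, hL, -, hφ, hψ⟩ := h.exists_tame_analysis
    rw [hf, hdm, ← hm]
    exact ⟨L, B, hL, hφ, hψ, h.piecewiseConstant.exists_variationBound⟩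

/-- Biorthogonality to each translate of the indicator of `[0,1]` kills the integral over every unit
interval, and these tile the line. -/
lemma integral_dualMother (h : Φ.IsBiorthogonalBasis r) : ∫ x, Φ.dualMother x = 0 := by
  obtain ⟨L, B, hL, -, hψ, -⟩ := h.exists_tame_dual
  have h1 := hψ.integrable.hasSum_intervalIntegral 0
  have h2 : ∀ k : ℤ, ∫ x in (0 + (k : ℝ))..(0 + (k : ℝ) + 1), Φ.dualMother x = 0 := by
    intro k
    have h3 := h.biorthogonal (Sum.inl k) (Sum.inr (0, 0))
    simp only [reduceCtorEq, if_false] at h3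
    rw [intervalIntegral.integral_of_le (by linarith), ← integral_Icc_eq_integral_Ioc,
      ← integral_indicator measurableSet_Icc]
    refine Eq.trans ?_ h3
    congr 1
    ext x
    have e1 : dilate Φ.dualMother 0 0 x = Φ.dualMother x := by simp [dilate]
    have e2 : x ∈ Set.Icc (0 + (k : ℝ)) (0 + (k : ℝ) + 1) ↔ x - k ∈ Set.Icc (0 : ℝ) 1 := by
      simp only [Set.mem_Icc]
      constructor <;> rintro ⟨a, b⟩ <;> constructor <;> linarith
    simp only [analysis, reconstruction, e1, translate, father]
    by_cases hx : x - k ∈ Set.Icc (0 : ℝ) 1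
    · rw [Set.indicator_of_mem (e2.2 hx), Set.indicator_of_mem hx]; simp
    · rw [Set.indicator_of_notMem (fun hh => hx (e2.1 hh)), Set.indicator_of_notMem hx]; simp
  simp only [h2] at h1
  exact h1.unique hasSum_zero

lemma exists_riesz (h : Φ.IsBiorthogonalBasis r) :
    ∃ C : ℝ, 0 < C ∧ ∀ (F : Finset Index) (a : Index → ℝ),
      ∫ x, (∑ l ∈ F, a l * Φ.reconstruction l x) ^ 2 ≤ C * ∑ l ∈ F, a l ^ 2 := by
  obtain ⟨L, B, hL, hφ, hψ, ν, hν, hvar⟩ := h.exists_tame_dual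
  rw [reconstruction_eq]
  exact exists_riesz_bound (by linarith) hφ hψ hvar h.integral_dualMother

lemma memLp_analysis (h : Φ.IsBiorthogonalBasis r) (l : Index) :
    MemLp (Φ.analysis l) 2 volume := by
  obtain ⟨L, B, -, -, hφ, hψ⟩ := h.exists_tame_analysis
  rw [analysis_eq]
  exact memLp_system hφ hψ l

lemma memLp_reconstruction (h : Φ.IsBiorthogonalBasis r) (l : Index) :
    MemLp (Φ.reconstruction l) 2 volume := by
  obtain ⟨L, B, -, hφ, hψ, -⟩ := h.exists_tame_dual
  rw [reconstruction_eq]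
  exact memLp_system hφ hψ l

lemma nonneg (h : Φ.IsBiorthogonalBasis r) : 0 ≤ r := by
  rcases h.regular with ⟨hr, -⟩ | ⟨hr, -⟩
  · exact hr.le
  · exact hr.ge

lemma coeff_sum (h : Φ.IsBiorthogonalBasis r) (F : Finset Index) (a : Index → ℝ) (l : Index)
    (hl : l ∈ F) : Φ.coeff (fun x => ∑ l' ∈ F, a l' * Φ.reconstruction l' x) l = a l := by
  classical
  simp only [coeff, Finset.mul_sum]
  have : ∀ l' x, Φ.analysis l x * (a l' * Φ.reconstruction l' x)
      = a l' * (Φ.analysis l x * Φ.reconstruction l' x) := fun _ _ => by ring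
  simp_rw [this]
  rw [integral_finsetSum _ fun l' _ =>
    (integrable_mul_of_memLp (h.memLp_analysis l) (h.memLp_reconstruction l')).const_mul _]
  simp_rw [integral_const_mul, h.biorthogonal]
  simp [hl]

/-- The squared `L₂` distance from a finite combination of reconstruction wavelets to `f` is
controlled by the squared `ℓ₂` distance of the coefficients. -/
lemma exists_distance_bound (h : Φ.IsBiorthogonalBasis r) :
    ∃ C : ℝ, 0 < C ∧ ∀ f : ℝ → ℝ, MemLp f 2 volume → ∀ (F : Finset Index) (b : Index → ℝ),
      (∀ l ∉ F, b l = 0) →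
      ∫⁻ x, ENNReal.ofReal ((∑ l ∈ F, b l * Φ.reconstruction l x - f x) ^ 2)
        ≤ ENNReal.ofReal C * ∑' l, ENNReal.ofReal ((b l - Φ.coeff f l) ^ 2) := by
  classical
  obtain ⟨C₁, hC₁, hR⟩ := h.exists_riesz
  obtain ⟨C₂, hC₂, hB⟩ := h.exists_bessel h.nonneg
  refine ⟨4 * C₁, by positivity, fun f hf F b hb => ?_⟩
  set T := ∑' l, ENNReal.ofReal ((b l - Φ.coeff f l) ^ 2)
  refine ENNReal.le_of_forall_pos_le_add fun δ hδ _ => ?_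
  -- `K * ε ^ 2` collects the errors of the approximation: `4 * C₁ * C₂ * ε ^ 2` through the
  -- coefficients and `2 * ε ^ 2` directly.
  set K := 4 * C₁ * C₂ + 2 with hK
  have hK0 : 0 < K := by positivity
  set ε := √(δ / K) with hεd
  have hδ' : (0 : ℝ) < δ := hδ
  have hε : 0 < ε := by positivity
  have hε2 : K * ε ^ 2 = δ := by rw [hεd, Real.sq_sqrt (by positivity)]; field_simp
  obtain ⟨a, ha⟩ := h.complete f hf ε hε
  set G := F ∪ a.support with hG
  set s : ℝ → ℝ := fun x => ∑ l ∈ G, a l * Φ.reconstruction l x with hs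
  have hsm : MemLp s 2 volume := memLp_finsetSum _ fun l _ => (h.memLp_reconstruction l).const_mul _
  have hsa : ∀ x, a.sum (fun l t => t * Φ.reconstruction l x) = s x := by
    intro x
    refine Finsupp.sum_of_support_subset _ Finset.subset_union_right _ fun l _ => by simp
  simp only [hsa] at ha
  have hfs : MemLp (fun x => f x - s x) 2 volume := hf.sub hsm
  have h1 := integral_sq_le hfs hε.le ha
  have hest : ∀ x, ∑ l ∈ F, b l * Φ.reconstruction l x = ∑ l ∈ G, b l * Φ.reconstruction l x :=
    fun x => Finset.sum_subset Finset.subset_union_left fun l _ hl => by rw [hb l hl, zero_mul]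
  have hem : MemLp (fun x => ∑ l ∈ G, b l * Φ.reconstruction l x) 2 volume :=
    memLp_finsetSum _ fun l _ => (h.memLp_reconstruction l).const_mul _
  have hef : MemLp (fun x => ∑ l ∈ G, b l * Φ.reconstruction l x - f x) 2 volume := hem.sub hf
  -- On `G`, biorthogonality identifies `a l` with the coefficient of `s`, so this is Bessel's
  -- inequality for `f - s`.
  have h2 : ∑ l ∈ G, (Φ.coeff f l - a l) ^ 2 ≤ C₂ * ε ^ 2 := by
    refine le_trans (le_of_eq ?_) ((hB _ hfs G).trans (by gcongr))
    refine Finset.sum_congr rfl fun l hl => ?_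
    have h3 : Φ.coeff s l = a l := h.coeff_sum G a l hl
    rw [← h3]
    simp only [coeff, mul_sub]
    rw [integral_sub (integrable_mul_of_memLp (h.memLp_analysis l) hf)
      (integrable_mul_of_memLp (h.memLp_analysis l) hsm)]
  have h3 := hR G (fun l => b l - a l)
  have h4 : ∑ l ∈ G, (b l - a l) ^ 2
      ≤ 2 * ∑ l ∈ G, (b l - Φ.coeff f l) ^ 2 + 2 * ∑ l ∈ G, (Φ.coeff f l - a l) ^ 2 := by
    rw [Finset.mul_sum, Finset.mul_sum, ← Finset.sum_add_distrib]
    refine Finset.sum_le_sum fun l _ => ?_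
    nlinarith [sq_nonneg ((b l - Φ.coeff f l) - (Φ.coeff f l - a l))]
  have h5 : ∫ x, (∑ l ∈ G, b l * Φ.reconstruction l x - f x) ^ 2
      ≤ 2 * (∫ x, (∑ l ∈ G, (b l - a l) * Φ.reconstruction l x) ^ 2)
        + 2 * ∫ x, (f x - s x) ^ 2 := by
    have hbam : MemLp (fun x => ∑ l ∈ G, (b l - a l) * Φ.reconstruction l x) 2 volume :=
      memLp_finsetSum _ fun l _ => (h.memLp_reconstruction l).const_mul _
    rw [← integral_const_mul, ← integral_const_mul,
      ← integral_add (hbam.integrable_sq.const_mul 2) (hfs.integrable_sq.const_mul 2)]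
    refine integral_mono hef.integrable_sq
      ((hbam.integrable_sq.const_mul 2).add (hfs.integrable_sq.const_mul 2)) fun x => ?_
    simp only [sub_mul, Finset.sum_sub_distrib, hs]
    nlinarith [sq_nonneg ((∑ l ∈ G, b l * Φ.reconstruction l x
      - ∑ l ∈ G, a l * Φ.reconstruction l x) + (f x - ∑ l ∈ G, a l * Φ.reconstruction l x))]
  have h6 : ∫ x, (∑ l ∈ G, b l * Φ.reconstruction l x - f x) ^ 2
      ≤ 4 * C₁ * ∑ l ∈ G, (b l - Φ.coeff f l) ^ 2 + δ := by
    have h7 : C₁ * ∑ l ∈ G, (b l - a l) ^ 2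
      ≤ C₁ * (2 * ∑ l ∈ G, (b l - Φ.coeff f l) ^ 2 + 2 * (C₂ * ε ^ 2)) := by
      gcongr; linarith
    rw [← hε2, hK]
    linarith
  simp_rw [hest]
  rw [← ofReal_integral_eq_lintegral_ofReal hef.integrable_sq
    (ae_of_all _ fun x => sq_nonneg _)]
  refine (ENNReal.ofReal_le_ofReal h6).trans ?_
  rw [ENNReal.ofReal_add (by positivity) hδ'.le, ENNReal.ofReal_coe_nnreal,
    ENNReal.ofReal_mul (by positivity), ENNReal.ofReal_sum_of_nonneg fun l _ => sq_nonneg _]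
  gcongr
  exact ENNReal.sum_le_tsum G

end IsBiorthogonalBasis

end Generators

/-! ## Interpolation and geometric sums -/

lemma inv_toReal_lt_half {p : ℝ≥0∞} (hp : 2 < p) :
    0 ≤ (p⁻¹).toReal ∧ (p⁻¹).toReal < 1 / 2 := by
  refine ⟨ENNReal.toReal_nonneg, ?_⟩
  have h1 : p⁻¹ < 2⁻¹ := ENNReal.inv_lt_inv.2 hp
  have h2 := (ENNReal.toReal_lt_toReal (h1.trans_le le_top).ne (by simp)).2 h1
  simpa using h2

/-- Interpolation of `ℓ₂` between `ℓ₁` and `ℓ_p`, for `p > 2`. -/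
lemma tsum_sq_le_of_interpolation (b : ℤ → ℝ) {p : ℝ≥0∞} (hp : 2 < p) {S D : ℝ} (hS : 0 ≤ S)
    (hD : 0 ≤ D) (h1 : ∑' k, ENNReal.ofReal |b k| ≤ ENNReal.ofReal S)
    (h2 : eLpNorm b p Measure.count ≤ ENNReal.ofReal D) :
    ∑' k, ENNReal.ofReal (b k ^ 2)
      ≤ ENNReal.ofReal (S ^ (2 - (1 - (p⁻¹).toReal)⁻¹) * D ^ (1 - (p⁻¹).toReal)⁻¹) := by
  have hb : ∀ k, ENNReal.ofReal (b k ^ 2) = ‖b k‖ₑ ^ 2 := fun k => by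
    rw [Real.enorm_eq_ofReal_abs, ← ENNReal.ofReal_pow (abs_nonneg _), sq_abs]
  simp_rw [← Real.enorm_eq_ofReal_abs] at h1
  rcases eq_or_ne p ∞ with rfl | htop
  · simp only [ENNReal.inv_top, ENNReal.toReal_zero, sub_zero, inv_one, Real.rpow_one]
    rw [show (2 : ℝ) - 1 = 1 by norm_num, Real.rpow_one]
    rw [eLpNorm_exponent_top, eLpNormEssSup_eq_iSup (by simp)] at h2
    calc ∑' k, ENNReal.ofReal (b k ^ 2) ≤ ∑' k, ‖b k‖ₑ * ENNReal.ofReal D := by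
          refine ENNReal.tsum_le_tsum fun k => ?_
          rw [hb, sq]
          gcongr
          exact (le_iSup (fun k => ‖b k‖ₑ) k).trans h2
      _ ≤ _ := by
          rw [ENNReal.tsum_mul_right, ENNReal.ofReal_mul hS]
          gcongr
  · set P := p.toReal with hP
    have hP2 : 2 < P := by
      have := (ENNReal.toReal_lt_toReal (by simp) htop).2 hp
      simpa using this
    have hπ : (p⁻¹).toReal = P⁻¹ := ENNReal.toReal_inv p
    rw [hπ]
    set τ := (1 - P⁻¹)⁻¹ with hτ
    have hPi : P⁻¹ < 1 / 2 := by
      rw [inv_lt_comm₀ (by linarith) (by norm_num)]; simpa using hP2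
    have hPi0 : 0 < P⁻¹ := by positivity
    have hτ0 : 0 < τ := by
      have : 0 < 1 - P⁻¹ := by linarith
      positivity
    have hτm : τ * (1 - P⁻¹) = 1 := inv_mul_cancel₀ (by linarith)
    have hτ2 : 0 ≤ 2 - τ := by nlinarith
    have hq : 0 ≤ τ * P⁻¹ := by positivity
    -- Hölder with weights `2 - τ` and `τ / P`, which sum to one because `τ * (1 - P⁻¹) = 1`; the
    -- condition `2 < P` makes `2 - τ` nonnegative.
    have hH := ENNReal.lintegral_mul_norm_pow_le (μ := (Measure.count : Measure ℤ))
      (f := fun k => ‖b k‖ₑ) (g := fun k => ‖b k‖ₑ ^ P) (.of_discrete) (.of_discrete)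
      hτ2 hq (by linarith)
    rw [lintegral_count, lintegral_count] at hH
    have hlhs : ∀ k, ‖b k‖ₑ ^ (2 - τ) * (‖b k‖ₑ ^ P) ^ (τ * P⁻¹) = ENNReal.ofReal (b k ^ 2) := by
      intro k
      rw [hb, ← ENNReal.rpow_mul, ← ENNReal.rpow_add_of_nonneg _ _ hτ2 (by positivity),
        ← ENNReal.rpow_natCast]
      congr 1
      field_simp
      push_cast; ring
    simp_rw [hlhs] at hH
    refine hH.trans ?_
    have hN : (∫⁻ k, ‖b k‖ₑ ^ P ∂(Measure.count : Measure ℤ)) ^ (τ * P⁻¹)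
        = eLpNorm b p Measure.count ^ τ := by
      rw [eLpNorm_eq_lintegral_rpow_enorm_toReal (by rintro rfl; simp at hp) htop,
        ← ENNReal.rpow_mul]
      congr 1
      rw [one_div, mul_comm]
    rw [hN, ENNReal.ofReal_mul (by positivity), ← ENNReal.ofReal_rpow_of_nonneg hS hτ2,
      ← ENNReal.ofReal_rpow_of_nonneg hD hτ0.le]
    gcongr

/-- The increasing and decreasing sequences cross near `2 ^ j = ε ^ (-(1 / (1 + a)))`, where both
equal `ε ^ (a / (1 + a))`; away from there the minimum decays geometrically on both sides. -/
lemma exists_tsum_min_le {a : ℝ} (ha : 0 < a) :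
    ∃ C : ℝ, 0 < C ∧ ∀ ε : ℝ, 0 < ε → ε ≤ 1 →
      ∑' j : ℕ, ENNReal.ofReal (min (2 ^ j * ε) ((2 : ℝ) ^ (-((j : ℝ) * a))))
        ≤ ENNReal.ofReal (C * ε ^ (a / (1 + a))) := by
  set ρ : ℝ := max (1 / 2) ((2 : ℝ) ^ (-a)) with hρ
  have hρ0 : 0 ≤ ρ := le_max_of_le_left (by norm_num)
  have hρ1 : ρ < 1 := max_lt (by norm_num)
    (Real.rpow_lt_one_of_one_lt_of_neg (by norm_num) (by linarith))
  have hs := summable_geometric_natAbs hρ0 hρ1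
  have ht0 : 0 ≤ ∑' z : ℤ, ρ ^ z.natAbs := tsum_nonneg fun z => by positivity
  have h2a : 0 < (2 : ℝ) ^ a := by positivity
  refine ⟨(2 : ℝ) ^ a * ∑' z : ℤ, ρ ^ z.natAbs + 1, by positivity, fun ε hε hε1 => ?_⟩
  have ha1 : 0 < 1 + a := by linarith
  set E := ε ^ (a / (1 + a)) with hE
  have hE0 : 0 < E := by positivity
  set t := ε ^ (-(1 / (1 + a))) with ht
  have ht1 : 1 ≤ t := Real.one_le_rpow_of_pos_of_le_one_of_nonpos hε hε1 (by
    rw [neg_nonpos]; positivity)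
  have hEt : ε * t = E := by
    rw [ht, hE]
    nth_rewrite 1 [← Real.rpow_one ε]
    rw [← Real.rpow_add hε]
    congr 1; field_simp; ring
  have hta : t ^ (-a) = E := by
    rw [ht, hE, ← Real.rpow_mul hε.le]
    congr 1; field_simp
  obtain ⟨J, hJ1, hJ2⟩ := exists_nat_pow_near ht1 (by norm_num : (1 : ℝ) < 2)
  have hterm : ∀ j : ℕ, min (2 ^ j * ε) ((2 : ℝ) ^ (-((j : ℝ) * a)))
      ≤ E * (2 : ℝ) ^ a * ρ ^ ((j : ℤ) - J).natAbs := by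
    intro j
    rcases le_or_gt j J with hj | hj
    · obtain ⟨d, rfl⟩ := Nat.exists_eq_add_of_le hj
      refine (min_le_left _ _).trans ?_
      have e1 : ((j : ℤ) - ((j + d : ℕ) : ℤ)).natAbs = d := by omega
      rw [e1]
      have h1 : (2 : ℝ) ^ j * ε ≤ E * (1 / 2) ^ d := by
        have h3 : (2 : ℝ) ^ j * 2 ^ d ≤ t := by rw [← pow_add]; exact hJ1
        rw [one_div, inv_pow, ← div_eq_mul_inv, le_div_iff₀ (by positivity), ← hEt]
        nlinarith
      have h4 : (1 / 2 : ℝ) ^ d ≤ ρ ^ d := by gcongr; exact le_max_left _ _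
      have h5 : 1 ≤ (2 : ℝ) ^ a := Real.one_le_rpow (by norm_num) ha.le
      calc (2 : ℝ) ^ j * ε ≤ E * (1 / 2) ^ d := h1
        _ ≤ E * ρ ^ d := by gcongr
        _ ≤ E * 2 ^ a * ρ ^ d := by
          gcongr
          exact le_mul_of_one_le_right hE0.le h5
    · obtain ⟨d, rfl⟩ := Nat.exists_eq_add_of_lt hj
      refine (min_le_right _ _).trans ?_
      have e1 : (((J + d + 1 : ℕ) : ℤ) - (J : ℤ)).natAbs = d + 1 := by omega
      rw [e1]
      have h3 : t * 2 ^ d ≤ (2 : ℝ) ^ (J + d + 1) := by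
        have : (2 : ℝ) ^ (J + d + 1) = 2 ^ (J + 1) * 2 ^ d := by rw [← pow_add]; congr 1; ring
        rw [this]; gcongr
      calc (2 : ℝ) ^ (-(((J + d + 1 : ℕ) : ℝ) * a)) = ((2 : ℝ) ^ (J + d + 1)) ^ (-a) := by
            rw [← Real.rpow_natCast, ← Real.rpow_mul (by norm_num)]; congr 1; ring
        _ ≤ (t * 2 ^ d) ^ (-a) :=
            Real.rpow_le_rpow_of_nonpos (by positivity) h3 (by linarith)
        _ = E * (2 : ℝ) ^ a * ((2 : ℝ) ^ (-a)) ^ (d + 1) := by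
            rw [Real.mul_rpow (by positivity) (by positivity), hta, ← Real.rpow_natCast,
              ← Real.rpow_natCast, ← Real.rpow_mul (by norm_num), ← Real.rpow_mul (by norm_num),
              mul_assoc, ← Real.rpow_add (by norm_num)]
            congr 2; push_cast; ring
        _ ≤ _ := by gcongr; exact le_max_right _ _
  calc ∑' j : ℕ, ENNReal.ofReal (min (2 ^ j * ε) ((2 : ℝ) ^ (-((j : ℝ) * a))))
      ≤ ∑' j : ℕ, ENNReal.ofReal (E * (2 : ℝ) ^ a * ρ ^ ((j : ℤ) - J).natAbs) :=
        ENNReal.tsum_le_tsum fun j => ENNReal.ofReal_le_ofReal (hterm j)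
    _ ≤ ∑' z : ℤ, ENNReal.ofReal (E * (2 : ℝ) ^ a * ρ ^ z.natAbs) :=
        ENNReal.tsum_comp_le_tsum_of_injective (f := fun j : ℕ => (j : ℤ) - J)
          (fun x y hxy => by simpa using hxy)
          (fun z : ℤ => ENNReal.ofReal (E * (2 : ℝ) ^ a * ρ ^ z.natAbs))
    _ = ENNReal.ofReal (∑' z : ℤ, E * (2 : ℝ) ^ a * ρ ^ z.natAbs) :=
        (ENNReal.ofReal_tsum_of_nonneg (fun z => by positivity) (hs.mul_left _)).symm
    _ ≤ _ := by
        refine ENNReal.ofReal_le_ofReal ?_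
        rw [tsum_mul_left]
        nlinarith

lemma tsum_indicator_pow_two_le (J : ℕ) (t : ℝ) (ht : 0 ≤ t) :
    ∑' j : ℕ, (if j ≤ J then ENNReal.ofReal (2 ^ j * t) else 0)
      ≤ ENNReal.ofReal (2 * 2 ^ J * t) := by
  rw [tsum_eq_sum (s := Finset.range (J + 1)) (fun j hj => if_neg (by simpa using hj))]
  rw [Finset.sum_congr rfl (g := fun j => ENNReal.ofReal (2 ^ j * t))
    (fun j hj => if_pos (by simpa [Nat.lt_succ_iff] using hj)),
    ← ENNReal.ofReal_sum_of_nonneg fun j _ => by positivity]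
  refine ENNReal.ofReal_le_ofReal ?_
  rw [← Finset.sum_mul]
  gcongr
  rw [geom_sum_eq (by norm_num)]
  rw [pow_succ]
  linarith

lemma tsum_index (F : Index → ℝ≥0∞) :
    ∑' l, F l = ∑' k : ℤ, F (Sum.inl k) + ∑' (j : ℕ) (k : ℤ), F (Sum.inr (j, k)) := by
  rw [Summable.tsum_sum (f := F) ENNReal.summable ENNReal.summable]
  congr 1
  exact ENNReal.tsum_prod (f := fun j k => F (Sum.inr (j, k)))

/-! ### The Besov bound at one level -/

namespace Generators

variable {Φ : Generators}

lemma detailNorm_le {α R : ℝ} {p q : ℝ≥0∞} (hq : 1 ≤ q) {f : ℝ → ℝ}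
    (h : Φ.besovNorm α p q f ≤ ENNReal.ofReal R) (j : ℕ) :
    Φ.detailNorm α p f j ≤ ENNReal.ofReal R := by
  refine le_trans ?_ h
  unfold besovNorm
  refine le_trans ?_ le_add_self
  split_ifs with hq'
  · exact le_iSup (fun j => Φ.detailNorm α p f j) j
  · have hq0 : 0 < q.toReal := ENNReal.toReal_pos (by rintro rfl; simp at hq) hq'
    calc Φ.detailNorm α p f j = (Φ.detailNorm α p f j ^ q.toReal) ^ (q.toReal)⁻¹ := by
          rw [← ENNReal.rpow_mul, mul_inv_cancel₀ hq0.ne', ENNReal.rpow_one]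
      _ ≤ _ := by
          gcongr
          exact ENNReal.le_tsum (f := fun j => Φ.detailNorm α p f j ^ q.toReal) j

lemma eLpNorm_detail_le {α R : ℝ} {p q : ℝ≥0∞} (hq : 1 ≤ q) {f : ℝ → ℝ}
    (h : Φ.besovNorm α p q f ≤ ENNReal.ofReal R) (j : ℕ) :
    eLpNorm (fun k : ℤ => Φ.coeff f (Sum.inr (j, k))) p Measure.count
      ≤ ENNReal.ofReal ((2 : ℝ) ^ (-((j : ℝ) * (α + 1 / 2 - (p⁻¹).toReal))) * R) := by
  have h1 := detailNorm_le hq h j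
  unfold detailNorm at h1
  set x := (j : ℝ) * (α + 1 / 2 - (p⁻¹).toReal)
  set e := eLpNorm (fun k : ℤ => Φ.coeff f (Sum.inr (j, k))) p Measure.count
  calc e = ENNReal.ofReal ((2 : ℝ) ^ (-x)) * (ENNReal.ofReal ((2 : ℝ) ^ x) * e) := by
        rw [← mul_assoc, ← ENNReal.ofReal_mul (by positivity), ← Real.rpow_add (by norm_num)]
        simp
    _ ≤ ENNReal.ofReal ((2 : ℝ) ^ (-x)) * ENNReal.ofReal R := by gcongr
    _ = _ := by rw [ENNReal.ofReal_mul (by positivity)]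

end Generators

/-! ## The intensity measure and the wavelet coefficients -/

/-- The dyadic scale of an index. -/
def Index.scale : Index → ℕ
  | Sum.inl _ => 0
  | Sum.inr jk => jk.1

/-- The location of an index. -/
def Index.shift : Index → ℤ
  | Sum.inl k => k
  | Sum.inr jk => jk.2

/-- The measure with density `f`. -/
def densityMeasure (f : ℝ → ℝ) : Measure ℝ := volume.withDensity fun x => ENNReal.ofReal (f x)

lemma withDensity_const_mul_eq (f : ℝ → ℝ) (n : ℕ) :
    volume.withDensity (fun x => ENNReal.ofReal ((n : ℝ) * f x))
      = ENNReal.ofReal n • densityMeasure f := by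
  rw [densityMeasure, ← withDensity_smul' _ _ ENNReal.ofReal_ne_top]
  congr 1
  ext x
  rw [ENNReal.ofReal_mul (Nat.cast_nonneg n), Pi.smul_apply, smul_eq_mul]

lemma densityMeasure_univ_le {f : ℝ → ℝ} {R' : ℝ} (h : eLpNorm f 1 volume ≤ ENNReal.ofReal R') :
    densityMeasure f Set.univ ≤ ENNReal.ofReal R' := by
  refine le_trans ?_ h
  rw [densityMeasure, withDensity_apply _ MeasurableSet.univ, Measure.restrict_univ,
    eLpNorm_one_eq_lintegral_enorm]
  refine lintegral_mono fun x => ?_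
  rw [Real.enorm_eq_ofReal_abs]
  exact ENNReal.ofReal_le_ofReal (le_abs_self _)

lemma integral_densityMeasure {f : ℝ → ℝ} (hf : AEMeasurable f volume) (h0 : 0 ≤ᵐ[volume] f)
    (g : ℝ → ℝ) : ∫ x, g x ∂(densityMeasure f) = ∫ x, g x * f x := by
  rw [densityMeasure, integral_withDensity_eq_integral_toReal_smul₀ hf.ennreal_ofReal
    (ae_of_all _ fun x => ENNReal.ofReal_lt_top)]
  refine integral_congr_ae ?_
  filter_upwards [h0] with x hx
  rw [ENNReal.toReal_ofReal hx, smul_eq_mul, mul_comm]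

namespace Generators

variable {Φ : Generators} {r : ℝ}

lemma analysis_eq_zero {L B : ℝ} (hφ : IsTame L B father) (hψ : IsTame L B Φ.mother) (l : Index)
    {x : ℝ} (hx : x ∉ cell L l.scale l.shift) : Φ.analysis l x = 0 := by
  rcases l with k | ⟨j, k⟩
  · exact hφ.translate_eq_zero hx
  · exact hψ.dilate_eq_zero hx

lemma abs_analysis_le {L B : ℝ} (hφ : IsTame L B father) (hψ : IsTame L B Φ.mother) (l : Index)
    (x : ℝ) : |Φ.analysis l x| ≤ (2 : ℝ) ^ ((l.scale : ℝ) / 2) * B := by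
  rcases l with k | ⟨j, k⟩
  · simpa [Index.scale, analysis] using (hφ.translate k).bound x
  · exact (hψ.dilate j k).bound x

namespace IsBiorthogonalBasis

lemma exists_simpleFunc (h : Φ.IsBiorthogonalBasis r) (l : Index) :
    ∃ g : SimpleFunc ℝ ℝ, ⇑g = Φ.analysis l := by
  rcases l with k | ⟨j, k⟩
  · exact ⟨isPiecewiseConstant_father.toSimpleFunc.comp (fun x => x - k) (by fun_prop), rfl⟩
  · exact ⟨(h.piecewiseConstant.toSimpleFunc.comp (fun x => 2 ^ j * x - k) (by fun_prop)).map
      (fun y => (2 : ℝ) ^ ((j : ℝ) / 2) * y), rfl⟩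

lemma eLpNorm_analysis_le {L B : ℝ} (hφ : IsTame L B father) (hψ : IsTame L B Φ.mother)
    (l : Index) : eLpNorm (Φ.analysis l) ∞ volume
      ≤ ENNReal.ofReal ((2 : ℝ) ^ ((l.scale : ℝ) / 2) * B) := by
  rw [eLpNorm_exponent_top]
  exact eLpNormEssSup_le_of_ae_bound (ae_of_all _ fun x => abs_analysis_le hφ hψ l x)

/-- An almost everywhere vanishing `φ_λ` could not pair to `1` with its dual. -/
lemma supNorm_pos (h : Φ.IsBiorthogonalBasis r) (l : Index) : 0 < Φ.supNorm l := by
  obtain ⟨L, B, hL, hB, hφ, hψ⟩ := h.exists_tame_analysis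
  refine ENNReal.toReal_pos (fun h0 => ?_)
    ((eLpNorm_analysis_le hφ hψ l).trans_lt ENNReal.ofReal_lt_top).ne
  have h1 : Φ.analysis l =ᵐ[volume] 0 :=
    (eLpNorm_eq_zero_iff (h.memLp_analysis l).1 (by simp)).1 h0
  have h2 := h.biorthogonal l l
  rw [if_pos rfl, integral_congr_ae (g := fun _ => (0 : ℝ))] at h2
  · simp at h2
  · filter_upwards [h1] with x hx
    simp [hx]

lemma supNorm_sq_le (h : Φ.IsBiorthogonalBasis r) {L B : ℝ} (hφ : IsTame L B father)
    (hψ : IsTame L B Φ.mother) (l : Index) : Φ.supNorm l ^ 2 ≤ B ^ 2 * 2 ^ l.scale := by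
  have hB := hφ.nonneg
  have h1 : Φ.supNorm l ≤ (2 : ℝ) ^ ((l.scale : ℝ) / 2) * B := by
    have := ENNReal.toReal_mono ENNReal.ofReal_ne_top (eLpNorm_analysis_le hφ hψ l)
    rwa [ENNReal.toReal_ofReal (by positivity)] at this
  calc Φ.supNorm l ^ 2 ≤ ((2 : ℝ) ^ ((l.scale : ℝ) / 2) * B) ^ 2 :=
        pow_le_pow_left₀ (h.supNorm_pos l).le h1 2
    _ = B ^ 2 * 2 ^ l.scale := by
        rw [mul_pow, ← Real.rpow_natCast _ 2, ← Real.rpow_mul (by norm_num)]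
        rw [← Real.rpow_natCast 2 l.scale]
        push_cast
        rw [div_mul_cancel₀ _ (by norm_num : (2 : ℝ) ≠ 0)]
        ring

lemma ae_abs_le_supNorm (h : Φ.IsBiorthogonalBasis r) (l : Index) :
    ∀ᵐ x ∂volume, |Φ.analysis l x| ≤ Φ.supNorm l := by
  obtain ⟨L, B, hL, hB, hφ, hψ⟩ := h.exists_tame_analysis
  filter_upwards [enorm_ae_le_eLpNormEssSup (Φ.analysis l) volume] with x hx
  rw [← eLpNorm_exponent_top, Real.enorm_eq_ofReal_abs] at hx
  exact (ENNReal.ofReal_le_iff_le_toReal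
    ((eLpNorm_analysis_le hφ hψ l).trans_lt ENNReal.ofReal_lt_top).ne).1 hx

end IsBiorthogonalBasis

lemma overVar_eq (γ : ℝ) {n : ℕ} (hn : 0 < n) (S : Set ℝ) (l : Index) :
    Φ.overVar γ n S l = (pointIntegral S (fun x => Φ.analysis l x ^ 2)
      + √(2 * (γ * Real.log n) * Φ.supNorm l ^ 2 * pointIntegral S (fun x => Φ.analysis l x ^ 2))
      + 3 * (γ * Real.log n) * Φ.supNorm l ^ 2) / (n : ℝ) ^ 2 := by
  have hn' : (0 : ℝ) < n := by exact_mod_cast hn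
  rw [overVar, empVar]
  set W := pointIntegral S (fun x => Φ.analysis l x ^ 2)
  have h1 : 2 * γ * Real.log n * (1 / (n : ℝ) ^ 2 * W) * (Φ.supNorm l ^ 2 / (n : ℝ) ^ 2)
      = (2 * (γ * Real.log n) * Φ.supNorm l ^ 2 * W) / ((n : ℝ) ^ 2) ^ 2 := by field_simp
  rw [h1, Real.sqrt_div' _ (by positivity), Real.sqrt_sq (by positivity)]
  ring

/-- Up to the factor `1 / n`, the statistical threshold is the deviation bound with exponent `γ log
n`. -/
lemma threshold_eq (γ : ℝ) {n : ℕ} (hn : 0 < n) (S : Set ℝ) (l : Index) :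
    Φ.threshold γ n S l = devBound (γ * Real.log n) (Φ.supNorm l)
      (pointIntegral S (fun x => Φ.analysis l x ^ 2)) / n := by
  have hn' : (0 : ℝ) < n := by exact_mod_cast hn
  rw [threshold, overVar_eq γ hn, devBound]
  set Z := pointIntegral S (fun x => Φ.analysis l x ^ 2)
      + √(2 * (γ * Real.log n) * Φ.supNorm l ^ 2 * pointIntegral S (fun x => Φ.analysis l x ^ 2))
      + 3 * (γ * Real.log n) * Φ.supNorm l ^ 2
  have h1 : 2 * γ * (Z / (n : ℝ) ^ 2) * Real.log n = 2 * (γ * Real.log n) * Z / (n : ℝ) ^ 2 := by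
    ring
  rw [h1, Real.sqrt_div' _ (by positivity), Real.sqrt_sq hn'.le]
  field_simp

lemma thrCoeff_eq (γ : ℝ) {n : ℕ} (hn : 0 < n) {j₀ : ℤ} (S : Set ℝ) {l : Index}
    (hl : l.level ≤ j₀) :
    Φ.thrCoeff γ n j₀ S l = hardThreshold (devBound (γ * Real.log n) (Φ.supNorm l)
      (pointIntegral S (fun x => Φ.analysis l x ^ 2))) (pointIntegral S (Φ.analysis l)) / n := by
  have hn' : (0 : ℝ) < n := by exact_mod_cast hn
  rw [thrCoeff, threshold_eq γ hn, empCoeff, hardThreshold]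
  have h1 : |1 / (n : ℝ) * pointIntegral S (Φ.analysis l)|
      = |pointIntegral S (Φ.analysis l)| / n := by
    rw [abs_mul, abs_of_pos (by positivity)]; ring
  rw [h1]
  simp only [div_le_div_iff_of_pos_right hn', hl, and_true]
  split_ifs
  · ring
  · simp

/-! ### The oracle inequality for a wavelet coefficient -/

section Coefficient

variable {Ω : Type*} [MeasurableSpace Ω] {N : Ω → Set ℝ} {P : Measure Ω} {f : ℝ → ℝ}

lemma ae_thrCoeff_eq {μ : Measure ℝ} [IsFiniteMeasure μ] (hN : IsPoissonProcess N μ P)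
    (γ : ℝ) {n : ℕ} (hn : 0 < n) {j₀ : ℤ} {l : Index} (hl : l.level ≤ j₀)
    {g : SimpleFunc ℝ ℝ} (hg : ⇑g = Φ.analysis l) :
    ∀ᵐ ω ∂P, Φ.thrCoeff γ n j₀ (N ω) l = hardThreshold (devBound (γ * Real.log n) (Φ.supNorm l)
      (simpleIntegral N (sqFunc g) ω)) (simpleIntegral N g ω) / n := by
  filter_upwards [hN.ae_finite] with ω hω
  rw [thrCoeff_eq γ hn _ hl, simpleIntegral_eq hω, simpleIntegral_eq hω, hg]
  congr
  ext x
  change _ = g x ^ 2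
  rw [hg]

lemma aemeasurable_thrCoeff (h : Φ.IsBiorthogonalBasis r) {μ : Measure ℝ} [IsFiniteMeasure μ]
    (hN : IsPoissonProcess N μ P) (γ : ℝ) {n : ℕ} (hn : 0 < n) (j₀ : ℤ) (l : Index) :
    AEMeasurable (fun ω => Φ.thrCoeff γ n j₀ (N ω) l) P := by
  by_cases hl : l.level ≤ j₀
  · obtain ⟨g, hg⟩ := h.exists_simpleFunc l
    refine AEMeasurable.congr (Measurable.aemeasurable ?_)
      ((ae_thrCoeff_eq hN γ hn hl hg).mono fun ω hω => hω.symm)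
    have hX := measurable_simpleIntegral hN g
    have hW := measurable_simpleIntegral hN (sqFunc g)
    unfold hardThreshold devBound
    refine Measurable.div_const (Measurable.ite (measurableSet_le ?_ ?_) hX measurable_const) _
    · fun_prop
    · exact continuous_abs.measurable.comp hX
  · have : (fun ω => Φ.thrCoeff γ n j₀ (N ω) l) = fun _ => 0 := by
      ext ω; simp [thrCoeff, hl]
    rw [this]
    exact aemeasurable_const

lemma log_nat_bounds {n : ℕ} (hn : 2 ≤ n) : 2 / 3 ≤ Real.log n ∧ Real.log n ≤ n := by
  have hn' : (2 : ℝ) ≤ n := by exact_mod_cast hn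
  refine ⟨?_, (Real.log_le_sub_one_of_pos (by linarith)).trans (by linarith)⟩
  have h1 := Real.log_two_gt_d9
  have h2 : Real.log 2 ≤ Real.log n := Real.log_le_log (by norm_num) hn'
  linarith

/-- This is `risk_coefficient` for the mean measure `n f dx` and `L = log n`, divided by `n ^ 2`:
the mean `n * β` returns `β ^ 2`, and the mass `n * F` leaves `F / n`. -/
lemma lintegral_thrCoeff_le [IsProbabilityMeasure P] (h : Φ.IsBiorthogonalBasis r) {L B : ℝ}
    (hφ : IsTame L B father)
    (hψ : IsTame L B Φ.mother) (hf : AEMeasurable f volume) (h0 : 0 ≤ᵐ[volume] f)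
    [IsFiniteMeasure (densityMeasure f)] {c γ : ℝ} (hc : 1 ≤ c) (hγ : c < γ) {n : ℕ} (hn : 2 ≤ n)
    (hN : IsPoissonProcess N
      (volume.withDensity (fun x => ENNReal.ofReal ((n : ℝ) * f x))) P)
    {j₀ : ℤ} {l : Index} (hl : l.level ≤ j₀) :
    ∫⁻ ω, ENNReal.ofReal ((Φ.thrCoeff γ n j₀ (N ω) l - Φ.coeff f l) ^ 2) ∂P
      ≤ ENNReal.ofReal (coeffConst c γ) *
        (min (ENNReal.ofReal (Φ.coeff f l ^ 2))
            (ENNReal.ofReal (B ^ 2 * 2 ^ l.scale * (Real.log n / n))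
              * densityMeasure f (cell L l.scale l.shift))
          + ENNReal.ofReal ((n : ℝ) ^ (-c)) * ENNReal.ofReal (Φ.coeff f l ^ 2)
          + ENNReal.ofReal ((n : ℝ) ^ (-c)) *
            (ENNReal.ofReal (B ^ 2 * 2 ^ l.scale * (Real.log n / n))
              * densityMeasure f (cell L l.scale l.shift))) := by
  have hn0 : 0 < n := by omega
  have hn' : (0 : ℝ) < n := by exact_mod_cast hn0
  obtain ⟨hL1, -⟩ := log_nat_bounds hn
  have hL0 : 0 < Real.log n := by linarith
  obtain ⟨g, hg⟩ := h.exists_simpleFunc l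
  have hac : volume.withDensity (fun x => ENNReal.ofReal ((n : ℝ) * f x)) ≪ volume :=
    withDensity_absolutelyContinuous _ _
  have hM := h.supNorm_pos l
  have hQ := h.supNorm_sq_le hφ hψ l
  set M := Φ.supNorm l with hMdef
  set Q := B ^ 2 * 2 ^ l.scale with hQdef
  set I := cell L l.scale l.shift with hI
  set β := Φ.coeff f l with hβ
  have hbound : ∀ᵐ x ∂(volume.withDensity (fun x => ENNReal.ofReal ((n : ℝ) * f x))), |g x| ≤ M := by
    rw [hg]; exact hac.ae_le (h.ae_abs_le_supNorm l)
  have hmu := withDensity_const_mul_eq f n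
  rw [hmu] at hN hbound
  have : IsFiniteMeasure (ENNReal.ofReal n • densityMeasure f) :=
    Measure.smul_finite _ ENNReal.ofReal_ne_top
  have key := risk_coefficient hN g (measurableSet_cell L l.scale l.shift)
    (fun x hx => by rw [hg]; exact analysis_eq_zero hφ hψ l hx) hM hbound hL1 hc hγ
  have hint : ∫ x, g x ∂(ENNReal.ofReal n • densityMeasure f) = n * β := by
    rw [integral_smul_measure, ENNReal.toReal_ofReal hn'.le, smul_eq_mul,
      integral_densityMeasure hf h0, hg]
    rfl
  have hreal : (ENNReal.ofReal n • densityMeasure f).real I = n * (densityMeasure f).real I := by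
    rw [measureReal_ennreal_smul_apply, ENNReal.toReal_ofReal hn'.le]
  set F := (densityMeasure f).real I with hF
  have hF0 : 0 ≤ F := measureReal_nonneg
  have hexp : Real.exp (-(c * Real.log n)) = (n : ℝ) ^ (-c) := by
    rw [Real.rpow_def_of_pos hn']; ring_nf
  rw [hint, hreal, hexp] at key
  set e := (n : ℝ) ^ (-c) with he
  have he0 : 0 < e := by positivity
  have hstep : ∫⁻ ω, ENNReal.ofReal ((Φ.thrCoeff γ n j₀ (N ω) l - β) ^ 2) ∂P
      ≤ ENNReal.ofReal ((1 / (n : ℝ) ^ 2)) * ENNReal.ofReal (coeffConst c γ *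
        (min ((n * β) ^ 2) (M ^ 2 * (n * F) * Real.log n) + e * (n * β) ^ 2
          + e * (M ^ 2 * (n * F) * Real.log n))) := by
    refine le_trans (le_of_eq ?_) (mul_le_mul_right key _)
    rw [← lintegral_const_mul' _ _ ENNReal.ofReal_ne_top]
    refine lintegral_congr_ae ?_
    filter_upwards [ae_thrCoeff_eq hN γ hn0 hl hg] with ω hω
    rw [hω, ← hMdef, ← ENNReal.ofReal_mul (by positivity)]
    congr 1
    field_simp
  refine hstep.trans ?_
  have hA : 0 ≤ coeffConst c γ := by
    unfold coeffConst
    have : 0 < γ := by linarith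
    positivity
  rw [← ENNReal.ofReal_mul (by positivity)]
  have hνF : densityMeasure f I = ENNReal.ofReal F := by
    rw [hF, ofReal_measureReal]
  have hQ0 : 0 ≤ Q := (sq_nonneg M).trans hQ
  rw [hνF, ← ENNReal.ofReal_mul (by positivity), ← ENNReal.ofReal_mul (by positivity),
    ← ENNReal.ofReal_mul (by positivity), ← ENNReal.ofReal_min,
    ← ENNReal.ofReal_add (by positivity) (by positivity),
    ← ENNReal.ofReal_add (by positivity) (by positivity), ← ENNReal.ofReal_mul hA]
  refine ENNReal.ofReal_le_ofReal ?_
  have hmin : 1 / (n : ℝ) ^ 2 * min ((n * β) ^ 2) (M ^ 2 * (n * F) * Real.log n)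
      ≤ min (β ^ 2) (Q * (Real.log n / n) * F) := by
    rw [mul_min_of_nonneg _ _ (by positivity)]
    refine min_le_min (le_of_eq (by field_simp)) ?_
    calc 1 / (n : ℝ) ^ 2 * (M ^ 2 * (n * F) * Real.log n) = M ^ 2 * (Real.log n / n) * F := by
          field_simp
      _ ≤ _ := by gcongr
  have h3 : 1 / (n : ℝ) ^ 2 * (M ^ 2 * (n * F) * Real.log n) ≤ Q * (Real.log n / n) * F := by
    calc 1 / (n : ℝ) ^ 2 * (M ^ 2 * (n * F) * Real.log n) = M ^ 2 * (Real.log n / n) * F := by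
          field_simp
      _ ≤ _ := by gcongr
  have h4 : 1 / (n : ℝ) ^ 2 * (n * β) ^ 2 = β ^ 2 := by field_simp
  calc _ = coeffConst c γ * (1 / (n : ℝ) ^ 2 * min ((n * β) ^ 2) (M ^ 2 * (n * F) * Real.log n)
        + e * (1 / (n : ℝ) ^ 2 * (n * β) ^ 2)
        + e * (1 / (n : ℝ) ^ 2 * (M ^ 2 * (n * F) * Real.log n))) := by ring
    _ ≤ _ := by rw [h4]; gcongr

end Coefficient

/-- The estimator is a finite sum when there are finitely many observed points. -/
lemma exists_finset_thrCoeff {L B : ℝ} (hφ : IsTame L B father) (hψ : IsTame L B Φ.mother)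
    (γ : ℝ) (n : ℕ) (j₀ : ℤ) {S : Set ℝ} (hS : S.Finite) :
    ∃ F : Finset Index, ∀ l ∉ F, Φ.thrCoeff γ n j₀ S l = 0 := by
  classical
  have hfin : ∀ (x : ℝ) (j : ℕ), {k : ℤ | x ∈ cell L j k}.Finite := by
    intro x j
    refine (Set.finite_Icc ⌈2 ^ j * x - L⌉ ⌊2 ^ j * x + L⌋).subset fun k hk => ?_
    have h1 := abs_le.1 (show |2 ^ j * x - k| ≤ L from hk)
    exact ⟨Int.ceil_le.2 (by linarith [h1.2]), Int.le_floor.2 (by linarith [h1.1])⟩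
  have hA : (⋃ x ∈ S, Sum.inl '' {k : ℤ | x ∈ cell L 0 k} : Set Index).Finite :=
    hS.biUnion fun x _ => (hfin x 0).image _
  have hB : (⋃ x ∈ S, ⋃ j ∈ Set.Iic j₀.toNat,
      (fun k : ℤ => (Sum.inr (j, k) : Index)) '' {k : ℤ | x ∈ cell L j k}).Finite :=
    hS.biUnion fun x _ => (Set.finite_Iic _).biUnion fun j _ => (hfin x j).image _
  refine ⟨(hA.union hB).toFinset, fun l hl => ?_⟩
  by_contra hne
  have hne' : l.level ≤ j₀ ∧ Φ.empCoeff n S l ≠ 0 := by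
    unfold thrCoeff at hne
    split_ifs at hne with hc
    · exact ⟨hc.2, hne⟩
    · exact absurd rfl hne
  have hex : ∃ x ∈ S, x ∈ cell L l.scale l.shift := by
    by_contra hno
    push Not at hno
    refine hne'.2 ?_
    have : ∀ x : S, Φ.analysis l x = 0 := fun x => analysis_eq_zero hφ hψ l (hno x x.2)
    simp [empCoeff, pointIntegral, this]
  obtain ⟨x, hxS, hx⟩ := hex
  refine hl ?_
  rw [Set.Finite.mem_toFinset]
  rcases l with k | ⟨j, k⟩
  · exact Or.inl (Set.mem_biUnion hxS ⟨k, hx, rfl⟩)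
  · refine Or.inr (Set.mem_biUnion hxS (Set.mem_biUnion (x := j) ?_ ⟨k, hx, rfl⟩))
    have : (j : ℤ) ≤ j₀ := hne'.1
    change j ≤ j₀.toNat
    omega

/-- The quadratic risk is controlled by the sum of the coefficientwise risks. -/
lemma exists_risk_le_tsum (h : Φ.IsBiorthogonalBasis r) :
    ∃ C : ℝ, 0 < C ∧ ∀ {Ω : Type*} [MeasurableSpace Ω] {P : Measure Ω} {N : Ω → Set ℝ}
      {μ : Measure ℝ} [IsFiniteMeasure μ] {f : ℝ → ℝ}, MemLp f 2 volume →
      IsPoissonProcess N μ P → ∀ (γ : ℝ) (n : ℕ) (j₀ : ℤ), 0 < n →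
      Φ.risk γ n j₀ f N P ≤ ENNReal.ofReal C *
        ∑' l, ∫⁻ ω, ENNReal.ofReal ((Φ.thrCoeff γ n j₀ (N ω) l - Φ.coeff f l) ^ 2) ∂P := by
  obtain ⟨C, hC, hD⟩ := h.exists_distance_bound
  obtain ⟨L, B, hL, hB, hφ, hψ⟩ := h.exists_tame_analysis
  refine ⟨C, hC, ?_⟩
  intro Ω _ P N μ _ f hf hN γ n j₀ hn
  have hmeas : ∀ l, AEMeasurable
      (fun ω => ENNReal.ofReal ((Φ.thrCoeff γ n j₀ (N ω) l - Φ.coeff f l) ^ 2)) P := fun l =>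
    (((aemeasurable_thrCoeff h hN γ hn j₀ l).sub_const _).pow_const 2).ennreal_ofReal
  rw [← lintegral_tsum hmeas, ← lintegral_const_mul' _ _ ENNReal.ofReal_ne_top]
  refine lintegral_mono_ae ?_
  filter_upwards [hN.ae_finite] with ω hω
  obtain ⟨F, hF⟩ := exists_finset_thrCoeff hφ hψ γ n j₀ hω
  refine le_trans (le_of_eq ?_) (hD f hf F (Φ.thrCoeff γ n j₀ (N ω)) hF)
  congr 1
  ext x
  rw [estimator, tsum_eq_sum (s := F) fun l hl => by rw [hF l hl, zero_mul]]

end Generators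

/-! ## Summing the coefficientwise risks -/

lemma abs_integral_mul_le_measure {u f : ℝ → ℝ} {K : ℝ} {I : Set ℝ} (hI : MeasurableSet I)
    (hK : ∀ x, |u x| ≤ K) (h0 : ∀ x ∉ I, u x = 0)
    (hf : AEMeasurable f volume) (hf0 : 0 ≤ᵐ[volume] f) [IsFiniteMeasure (densityMeasure f)] :
    |∫ x, u x * f x| ≤ K * (densityMeasure f).real I := by
  have hK0 : 0 ≤ K := (abs_nonneg _).trans (hK 0)
  rw [← integral_densityMeasure hf hf0]
  have h1 : K * (densityMeasure f).real I = ∫ x, I.indicator (fun _ => K) x ∂(densityMeasure f) := by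
    rw [integral_indicator_const _ hI, smul_eq_mul, mul_comm]
  rw [h1]
  refine abs_integral_le_integral_abs.trans (integral_mono_of_nonneg
    (ae_of_all _ fun x => abs_nonneg _) ((integrable_const K).indicator hI)
    (ae_of_all _ fun x => ?_))
  by_cases hx : x ∈ I
  · simpa [hx] using hK x
  · simp [hx, h0 x hx]

namespace Generators

variable {Φ : Generators} {r : ℝ}

section Level

variable {α R R' : ℝ} {p q : ℝ≥0∞} {f : ℝ → ℝ}

lemma IsIntensityInBall.tsum_measure_cell (hf : Φ.IsIntensityInBall α p q R R' f) {L : ℝ}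
    (hL : 0 ≤ L) (j : ℕ) :
    ∑' k : ℤ, densityMeasure f (cell L j k) ≤ ENNReal.ofReal ((2 * L + 1) * R') := by
  refine (tsum_measure_cell_le _ hL j).trans ?_
  rw [ENNReal.ofReal_mul (by positivity)]
  gcongr
  exact densityMeasure_univ_le hf.norm1_le

lemma IsIntensityInBall.isFiniteMeasure (hf : Φ.IsIntensityInBall α p q R R' f) :
    IsFiniteMeasure (densityMeasure f) :=
  ⟨(densityMeasure_univ_le hf.norm1_le).trans_lt ENNReal.ofReal_lt_top⟩

lemma IsIntensityInBall.tsum_abs_coeff_le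
    (hf : Φ.IsIntensityInBall α p q R R' f) {L B : ℝ} (hL : 0 ≤ L) (hφ : IsTame L B father)
    (hψ : IsTame L B Φ.mother) (j : ℕ) :
    ∑' k : ℤ, ENNReal.ofReal |Φ.coeff f (Sum.inr (j, k))|
      ≤ ENNReal.ofReal ((2 : ℝ) ^ ((j : ℝ) / 2) * (B * ((2 * L + 1) * R'))) := by
  have := hf.isFiniteMeasure
  have hB := hφ.nonneg
  calc ∑' k : ℤ, ENNReal.ofReal |Φ.coeff f (Sum.inr (j, k))|
      ≤ ∑' k : ℤ, ENNReal.ofReal ((2 : ℝ) ^ ((j : ℝ) / 2) * B) * densityMeasure f (cell L j k) := by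
        refine ENNReal.tsum_le_tsum fun k => ?_
        rw [← ofReal_measureReal, ← ENNReal.ofReal_mul (by positivity)]
        refine ENNReal.ofReal_le_ofReal ?_
        exact abs_integral_mul_le_measure (measurableSet_cell L j k) (hψ.dilate j k).bound
          (fun x hx => hψ.dilate_eq_zero hx) hf.memL1.1.aemeasurable hf.nonneg
    _ ≤ ENNReal.ofReal ((2 : ℝ) ^ ((j : ℝ) / 2) * B) * ENNReal.ofReal ((2 * L + 1) * R') := by
        rw [ENNReal.tsum_mul_left]
        gcongr
        exact hf.tsum_measure_cell hL j
    _ = _ := by rw [← ENNReal.ofReal_mul (by positivity), mul_assoc]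

/-- The `ℓ₂` size of a resolution level, by interpolation between the `L₁` and Besov bounds. -/
lemma IsIntensityInBall.tsum_coeff_sq_le
    (hf : Φ.IsIntensityInBall α p q R R' f) (hp : 2 < p) (hq : 1 ≤ q) (hR : 0 ≤ R) (hR' : 0 ≤ R')
    {L B : ℝ} (hL : 0 ≤ L)
    (hφ : IsTame L B father) (hψ : IsTame L B Φ.mother) (j : ℕ) :
    ∑' k : ℤ, ENNReal.ofReal (Φ.coeff f (Sum.inr (j, k)) ^ 2)
      ≤ ENNReal.ofReal ((B * ((2 * L + 1) * R')) ^ (2 - (1 - (p⁻¹).toReal)⁻¹)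
          * R ^ (1 - (p⁻¹).toReal)⁻¹
          * (2 : ℝ) ^ (-((j : ℝ) * (α * (1 - (p⁻¹).toReal)⁻¹)))) := by
  have hB := hφ.nonneg
  refine (tsum_sq_le_of_interpolation _ hp (by positivity) (by positivity)
    (hf.tsum_abs_coeff_le hL hφ hψ j) (eLpNorm_detail_le hq hf.besov_le j)).trans
    (le_of_eq ?_)
  obtain ⟨h0, h1⟩ := inv_toReal_lt_half hp
  set π := (p⁻¹).toReal
  set τ := (1 - π)⁻¹ with hτ
  have hτm : τ * (1 - π) = 1 := inv_mul_cancel₀ (by linarith)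
  congr 1
  rw [Real.mul_rpow (by positivity) (by positivity), Real.mul_rpow (by positivity) hR,
    ← Real.rpow_mul (by norm_num), ← Real.rpow_mul (by norm_num)]
  have : (2 : ℝ) ^ ((j : ℝ) / 2 * (2 - τ)) * (2 : ℝ) ^ (-((j : ℝ) * (α + 1 / 2 - π)) * τ)
      = (2 : ℝ) ^ (-((j : ℝ) * (α * τ))) := by
    rw [← Real.rpow_add (by norm_num)]
    congr 1
    -- All exponents other than `α * τ` cancel because `τ * (1 - π) = 1`.
    linear_combination (-(j : ℝ)) * hτm
  rw [← this]
  ring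

lemma IsIntensityInBall.tsum_coeff_sq_total {C : ℝ} (hC : 0 ≤ C)
    (hB : ∀ f : ℝ → ℝ, MemLp f 2 volume → ∀ F : Finset Index,
      ∑ l ∈ F, Φ.coeff f l ^ 2 ≤ C * ∫ x, f x ^ 2)
    (hf : Φ.IsIntensityInBall α p q R R' f) (hR' : 0 ≤ R') :
    ∑' l, ENNReal.ofReal (Φ.coeff f l ^ 2) ≤ ENNReal.ofReal (C * R' ^ 2) := by
  rw [ENNReal.tsum_eq_iSup_sum]
  refine iSup_le fun F => ?_
  rw [← ENNReal.ofReal_sum_of_nonneg fun l _ => sq_nonneg _]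
  refine ENNReal.ofReal_le_ofReal ((hB f hf.memL2 F).trans ?_)
  gcongr
  exact integral_sq_le hf.memL2 hR' hf.norm2_le

end Level

end Generators

/-- The four contributions to the risk are of the order of the minimax rate. -/
lemma rate_bounds {n : ℕ} (hn : 2 ≤ n) {c s : ℝ} (hc : 1 ≤ c) (hs1 : s ≤ 1) {j₀ : ℤ}
    (h1 : (2 : ℝ) ^ j₀ ≤ (n : ℝ) ^ c * Real.log n ^ (-c))
    (h2 : (n : ℝ) ^ c * Real.log n ^ (-c) < (2 : ℝ) ^ (j₀ + 1)) :
    0 < Real.log n / n ∧ Real.log n / n ≤ 1 ∧ 0 ≤ j₀ ∧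
    Real.log n / n ≤ (Real.log n / n) ^ s ∧
    (n : ℝ) ^ (-c) ≤ 1 ∧
    (n : ℝ) ^ (-c) ≤ 2 * (Real.log n / n) ^ s ∧
    (n : ℝ) ^ (-c) * 2 ^ j₀.toNat ≤ 2 ^ c ∧
    ∀ j : ℕ, j₀ < j → 1 ≤ 2 ^ j * (Real.log n / n) := by
  obtain ⟨hL1, hL2⟩ := Generators.log_nat_bounds hn
  have hn' : (2 : ℝ) ≤ n := by exact_mod_cast hn
  set L := Real.log n
  have hL0 : 0 < L := by linarith
  have hn0 : (0 : ℝ) < n := by linarith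
  set ε := L / n with hε
  have hε0 : 0 < ε := by positivity
  have hε1 : ε ≤ 1 := by rw [hε, div_le_one hn0]; exact hL2
  have hinv : (n : ℝ) ^ c * L ^ (-c) = (ε⁻¹) ^ c := by
    rw [hε, inv_div, Real.div_rpow hn0.le hL0.le, Real.rpow_neg hL0.le]; rfl
  have hεi : 1 ≤ ε⁻¹ := (one_le_inv₀ hε0).2 hε1
  -- This use of `c ≥ 1` puts the crossover `2 ^ j * ε ≥ 1` no later than level `j₀ + 1`.
  have hge : ε⁻¹ ≤ (n : ℝ) ^ c * L ^ (-c) := by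
    rw [hinv]
    calc ε⁻¹ = (ε⁻¹) ^ (1 : ℝ) := (Real.rpow_one _).symm
      _ ≤ _ := Real.rpow_le_rpow_of_exponent_le hεi hc
  have hj0 : 0 ≤ j₀ := by
    by_contra hneg
    have h3 : j₀ + 1 ≤ 0 := by omega
    have h4 : (2 : ℝ) ^ (j₀ + 1) ≤ 1 := zpow_le_one_of_nonpos₀ (by norm_num) h3
    linarith
  have hεs : ε ≤ ε ^ s := by
    calc ε = ε ^ (1 : ℝ) := (Real.rpow_one _).symm
      _ ≤ _ := Real.rpow_le_rpow_of_exponent_ge hε0 hε1 hs1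
  have hnc : (n : ℝ) ^ (-c) ≤ (n : ℝ)⁻¹ := by
    rw [← Real.rpow_neg_one]
    exact Real.rpow_le_rpow_of_exponent_le (by linarith) (by linarith)
  have hni : (n : ℝ)⁻¹ ≤ 2 * ε := by
    rw [hε, inv_eq_one_div, ← mul_div_assoc]
    gcongr; linarith
  refine ⟨hε0, hε1, hj0, hεs, hnc.trans (inv_le_one_of_one_le₀ (by linarith)), by linarith, ?_, ?_⟩
  · have hp : (2 : ℝ) ^ j₀.toNat = (2 : ℝ) ^ j₀ := by
      rw [← zpow_natCast, Int.toNat_of_nonneg hj0]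
    rw [hp]
    calc (n : ℝ) ^ (-c) * (2 : ℝ) ^ j₀ ≤ (n : ℝ) ^ (-c) * ((n : ℝ) ^ c * L ^ (-c)) := by gcongr
      _ = L ^ (-c) := by
        rw [← mul_assoc, ← Real.rpow_add hn0]; simp
      _ = (L⁻¹) ^ c := by rw [Real.rpow_neg hL0.le, Real.inv_rpow hL0.le]
      _ ≤ 2 ^ c := by
        refine Real.rpow_le_rpow (by positivity) ?_ (by linarith)
        rw [inv_le_comm₀ hL0 (by norm_num)]; linarith
  · intro j hj
    have h3 : (2 : ℝ) ^ (j₀ + 1) ≤ 2 ^ j := by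
      rw [← zpow_natCast]
      exact zpow_le_zpow_right₀ (by norm_num) (by omega)
    have h4 : ε⁻¹ ≤ 2 ^ j := by linarith
    rw [inv_le_iff_one_le_mul₀ hε0] at h4
    linarith

/-- Summation of coefficientwise risk bounds over the levels `j ≤ J`, where the risk is a minimum
of bias and variance up to remainders, and over the levels `j > J`, where it is the bias. -/
lemma tsum_risk_le {G b : Index → ℝ≥0∞} {w : ℕ → ℤ → ℝ≥0∞} {X m : ℕ → ℝ≥0∞}
    {a e V cm : ℝ≥0∞} {J : ℕ} (hw : ∀ j, ∑' k, w j k ≤ V)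
    (hinl : ∀ k, G (Sum.inl k) ≤ a * (min (b (Sum.inl k)) (X 0 * w 0 k) + e * b (Sum.inl k)
      + e * (X 0 * w 0 k)))
    (hle : ∀ j ≤ J, ∀ k, G (Sum.inr (j, k)) ≤ a * (min (b (Sum.inr (j, k))) (X j * w j k)
      + e * b (Sum.inr (j, k)) + e * (X j * w j k)))
    (hgt : ∀ j, J < j → ∀ k, G (Sum.inr (j, k)) ≤ b (Sum.inr (j, k)))
    (hmin : ∀ j, min (∑' k, b (Sum.inr (j, k))) (X j * V) ≤ cm * m j)
    (htail : ∀ j, J < j → ∑' k, b (Sum.inr (j, k)) ≤ cm * m j) :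
    ∑' l, G l ≤ a * (X 0 * V) + a * (e * (X 0 * V)) + a * e * ∑' l, b l
      + (a + 1) * cm * ∑' j, m j + a * e * V * ∑' j, (if j ≤ J then X j else 0) := by
  have hXw : ∀ j, ∑' k, X j * w j k ≤ X j * V := fun j => by
    rw [ENNReal.tsum_mul_left]; gcongr; exact hw j
  -- The coarse level needs no approximation argument: its variance term is already of order `ε`.
  have h1 : ∑' k : ℤ, G (Sum.inl k)
      ≤ a * (X 0 * V) + a * e * ∑' k : ℤ, b (Sum.inl k) + a * (e * (X 0 * V)) := by
    calc ∑' k : ℤ, G (Sum.inl k)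
        ≤ ∑' k : ℤ, a * (X 0 * w 0 k + e * b (Sum.inl k) + e * (X 0 * w 0 k)) := by
          refine ENNReal.tsum_le_tsum fun k => (hinl k).trans ?_
          gcongr
          exact min_le_right _ _
      _ = a * (∑' k, X 0 * w 0 k + e * ∑' k, b (Sum.inl k) + e * ∑' k, X 0 * w 0 k) := by
          simp only [ENNReal.tsum_mul_left, ENNReal.tsum_add]
      _ ≤ a * (X 0 * V + e * ∑' k, b (Sum.inl k) + e * (X 0 * V)) := by
          gcongr <;> exact hXw 0
      _ = _ := by ring
  have h2 : ∀ j, ∑' k : ℤ, G (Sum.inr (j, k)) ≤ (a + 1) * cm * m j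
      + a * e * ∑' k : ℤ, b (Sum.inr (j, k)) + a * e * V * (if j ≤ J then X j else 0) := by
    intro j
    by_cases hj : j ≤ J
    · rw [if_pos hj]
      have hm : ∑' k : ℤ, min (b (Sum.inr (j, k))) (X j * w j k) ≤ cm * m j := by
        refine le_trans (le_min ?_ ?_) (hmin j)
        · exact ENNReal.tsum_le_tsum fun k => min_le_left _ _
        · exact (ENNReal.tsum_le_tsum fun k => min_le_right _ _).trans (hXw j)
      calc ∑' k : ℤ, G (Sum.inr (j, k))
          ≤ ∑' k : ℤ, a * (min (b (Sum.inr (j, k))) (X j * w j k)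
              + e * b (Sum.inr (j, k)) + e * (X j * w j k)) :=
            ENNReal.tsum_le_tsum fun k => hle j hj k
        _ = a * (∑' k, min (b (Sum.inr (j, k))) (X j * w j k) + e * ∑' k, b (Sum.inr (j, k))
              + e * ∑' k, X j * w j k) := by
            rw [ENNReal.tsum_mul_left, ENNReal.tsum_add, ENNReal.tsum_add, ENNReal.tsum_mul_left,
              ENNReal.tsum_mul_left]
        _ ≤ a * (cm * m j + e * ∑' k, b (Sum.inr (j, k)) + e * (X j * V)) := by
            gcongr; exact hXw j
        _ = a * cm * m j + a * e * ∑' k : ℤ, b (Sum.inr (j, k)) + a * e * V * X j := by ring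
        _ ≤ _ := by
            gcongr
            exact le_self_add
    · rw [if_neg hj, mul_zero, add_zero]
      have hj' : J < j := not_le.1 hj
      calc ∑' k : ℤ, G (Sum.inr (j, k)) ≤ ∑' k : ℤ, b (Sum.inr (j, k)) :=
            ENNReal.tsum_le_tsum fun k => hgt j hj' k
        _ ≤ 1 * cm * m j := by rw [one_mul]; exact htail j hj'
        _ ≤ (a + 1) * cm * m j := by gcongr; exact le_add_self
        _ ≤ _ := le_self_add
  rw [tsum_index G, tsum_index b]
  calc ∑' k : ℤ, G (Sum.inl k) + ∑' (j : ℕ) (k : ℤ), G (Sum.inr (j, k))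
      ≤ (a * (X 0 * V) + a * e * ∑' k : ℤ, b (Sum.inl k) + a * (e * (X 0 * V)))
        + ∑' j, ((a + 1) * cm * m j + a * e * ∑' k : ℤ, b (Sum.inr (j, k))
          + a * e * V * (if j ≤ J then X j else 0)) :=
        add_le_add h1 (ENNReal.tsum_le_tsum h2)
    _ = _ := by
        rw [ENNReal.tsum_add, ENNReal.tsum_add, ENNReal.tsum_mul_left, ENNReal.tsum_mul_left,
          ENNReal.tsum_mul_left]
        ring

end PoissonWavelet

end

/-! ### Assembly of the rate -/

theorem theorem4 (Φ : PoissonWavelet.Generators) (r : ℝ) (hΦ : Φ.IsBiorthogonalBasis r)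
    (R R' : ℝ) (hR : 0 < R) (hR' : 0 < R') (p : ℝ≥0∞) (hp : 2 < p)
    (α : ℝ) (hα : 0 < α) (hαr : α < r + 1)
    (c : ℝ) (hc : 1 ≤ c) (γ : ℝ) (hγ : c < γ) :
    ∃ C : ℝ, 0 < C ∧
      ∀ q : ℝ≥0∞, 1 ≤ q →
      ∀ n : ℕ, 2 ≤ n →
      ∀ j₀ : ℤ, (2 : ℝ) ^ j₀ ≤ (n : ℝ) ^ c * Real.log n ^ (-c) →
        (n : ℝ) ^ c * Real.log n ^ (-c) < (2 : ℝ) ^ (j₀ + 1) →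
      ∀ f : ℝ → ℝ, Φ.IsIntensityInBall α p q R R' f →
      ∀ (Ω : Type*) [MeasurableSpace Ω] (P : Measure Ω) [IsProbabilityMeasure P]
        (N : Ω → Set ℝ),
        PoissonWavelet.IsPoissonProcess N
          (volume.withDensity (fun x => ENNReal.ofReal ((n : ℝ) * f x))) P →
        Φ.risk γ n j₀ f N P ≤
          ENNReal.ofReal (C * (Real.log n / n) ^ (α / (α + 1 - (p⁻¹).toReal))) := by
  obtain ⟨L, B, hL, hB, hφ, hψ⟩ := hΦ.exists_tame_analysis
  obtain ⟨CD, hCD, hrisk⟩ := PoissonWavelet.Generators.exists_risk_le_tsum hΦ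
  obtain ⟨CB, hCB, hbessel⟩ := hΦ.exists_bessel hΦ.nonneg
  obtain ⟨hπ0, hπ1⟩ := PoissonWavelet.inv_toReal_lt_half hp
  set π := (p⁻¹).toReal
  set τ := (1 - π)⁻¹ with hτ
  have hπ2 : 0 < 1 - π := by linarith
  have hτ0 : 0 < τ := by positivity
  set a := α * τ with ha
  have ha0 : 0 < a := by positivity
  obtain ⟨CS, hCS, hmin⟩ := PoissonWavelet.exists_tsum_min_le ha0
  set s := α / (α + 1 - π) with hs
  have hden : 0 < α + 1 - π := by linarith
  have hs1 : s ≤ 1 := by rw [hs, div_le_one hden]; linarith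
  -- The exponent produced by balancing bias and variance is the one in the rate.
  have hsa : a / (1 + a) = s := by
    rw [ha, hs, hτ]; field_simp; ring
  rw [hsa] at hmin
  set A := PoissonWavelet.coeffConst c γ with hA
  have hA0 : 0 ≤ A := by
    rw [hA]; unfold PoissonWavelet.coeffConst
    have : 0 < γ := by linarith
    positivity
  set V := (2 * L + 1) * R' with hV
  have hV0 : 0 < V := by positivity
  set CI := (B * V) ^ (2 - τ) * R ^ τ with hCI
  have hCI0 : 0 ≤ CI := by positivity
  set Cm := max CI (B ^ 2 * V) with hCm
  have hCm0 : 0 ≤ Cm := le_max_of_le_left hCI0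
  -- One summand for each term of `tsum_risk_le`: coarse variance, its remainder, the bias
  -- remainder, the balanced main sum, and the variance remainder up to `j₀`.
  set K := A * (B ^ 2 * V) + A * (B ^ 2 * V) + A * (2 * (CB * R' ^ 2)) + (A + 1) * Cm * CS
    + A * V * (2 * B ^ 2 * 2 ^ c) with hK
  have hK0 : 0 ≤ K := by positivity
  refine ⟨CD * K + 1, by positivity, ?_⟩
  intro q hq n hn j₀ hj1 hj2 f hf Ω _ P _ N hN
  obtain ⟨hε0, hε1, hj0, hεs, he1, hes, heJ, hbig⟩ := PoissonWavelet.rate_bounds hn hc hs1 hj1 hj2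
  set ε := Real.log n / n with hε
  set e := (n : ℝ) ^ (-c) with he
  have he0 : 0 ≤ e := by positivity
  have hεs0 : 0 ≤ ε ^ s := by positivity
  have hfin := hf.isFiniteMeasure
  have hfinN : IsFiniteMeasure (volume.withDensity (fun x => ENNReal.ofReal ((n : ℝ) * f x))) := by
    rw [PoissonWavelet.withDensity_const_mul_eq]
    exact Measure.smul_finite _ ENNReal.ofReal_ne_top
  have hlevel := fun j => hf.tsum_coeff_sq_le hp hq hR.le hR'.le (by linarith : 0 ≤ L) hφ hψ j
  have hG := fun (l : PoissonWavelet.Index) (hl : l.level ≤ j₀) =>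
    PoissonWavelet.Generators.lintegral_thrCoeff_le hΦ hφ hψ hf.memL1.1.aemeasurable hf.nonneg hc hγ hn hN hl
  have hX0 : ∀ j : ℕ, 0 ≤ B ^ 2 * 2 ^ j * ε := fun j => by positivity
  have hsum := PoissonWavelet.tsum_risk_le
    (G := fun l => ∫⁻ ω, ENNReal.ofReal ((Φ.thrCoeff γ n j₀ (N ω) l - Φ.coeff f l) ^ 2) ∂P)
    (b := fun l => ENNReal.ofReal (Φ.coeff f l ^ 2))
    (w := fun j k => PoissonWavelet.densityMeasure f (PoissonWavelet.cell L j k))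
    (X := fun j => ENNReal.ofReal (B ^ 2 * 2 ^ j * ε))
    (m := fun j => ENNReal.ofReal (min (2 ^ j * ε) ((2 : ℝ) ^ (-((j : ℝ) * a)))))
    (a := ENNReal.ofReal A) (e := ENNReal.ofReal e) (V := ENNReal.ofReal V)
    (cm := ENNReal.ofReal Cm) (J := j₀.toNat)
    (fun j => hf.tsum_measure_cell (by linarith) j)
    (fun k => hG (Sum.inl k) (by change (-1 : ℤ) ≤ j₀; omega))
    (fun j hj k => hG (Sum.inr (j, k)) (by change (j : ℤ) ≤ j₀; omega))
    (fun j hj k => by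
      have hnot : ¬ (PoissonWavelet.Index.level (Sum.inr (j, k)) ≤ j₀) := by
        change ¬ ((j : ℤ) ≤ j₀); omega
      simp [PoissonWavelet.Generators.thrCoeff, hnot])
    (fun j => by
      rw [← ENNReal.ofReal_mul (hX0 j), ← ENNReal.ofReal_mul hCm0]
      refine (min_le_min_right _ (hlevel j)).trans ?_
      rw [← ENNReal.ofReal_min]
      refine ENNReal.ofReal_le_ofReal ?_
      rw [mul_min_of_nonneg _ _ hCm0, min_comm]
      refine min_le_min ?_ ?_
      · calc B ^ 2 * 2 ^ j * ε * V = (B ^ 2 * V) * (2 ^ j * ε) := by ring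
          _ ≤ _ := by gcongr; exact le_max_right _ _
      · gcongr; exact le_max_left _ _)
    (fun j hj => by
      rw [← ENNReal.ofReal_mul hCm0]
      refine (hlevel j).trans (ENNReal.ofReal_le_ofReal ?_)
      have h1 : (2 : ℝ) ^ (-((j : ℝ) * a)) ≤ 1 :=
        Real.rpow_le_one_of_one_le_of_nonpos (by norm_num) (by
          rw [neg_nonpos]; positivity)
      -- Above `j₀` the variance scale exceeds `1`, so the untouched bias is the smaller term.
      rw [min_eq_right (h1.trans (hbig j (by omega)))]
      gcongr; exact le_max_left _ _)
  have htot := hf.tsum_coeff_sq_total hCB.le hbessel hR'.le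
  have hfinal : ∑' l, ∫⁻ ω, ENNReal.ofReal ((Φ.thrCoeff γ n j₀ (N ω) l - Φ.coeff f l) ^ 2) ∂P
      ≤ ENNReal.ofReal (K * ε ^ s) := by
    refine hsum.trans ?_
    have hJ : ∑' j, (if j ≤ j₀.toNat then ENNReal.ofReal (B ^ 2 * 2 ^ j * ε) else 0)
        ≤ ENNReal.ofReal (2 * 2 ^ j₀.toNat * (B ^ 2 * ε)) := by
      refine le_trans (le_of_eq ?_) (PoissonWavelet.tsum_indicator_pow_two_le j₀.toNat (B ^ 2 * ε) (by positivity))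
      congr! 4 with j
      ring
    have q1 : ENNReal.ofReal A * (ENNReal.ofReal (B ^ 2 * 2 ^ 0 * ε) * ENNReal.ofReal V)
        ≤ ENNReal.ofReal (A * (B ^ 2 * V) * ε ^ s) := by
      rw [← ENNReal.ofReal_mul (hX0 0), ← ENNReal.ofReal_mul hA0]
      refine ENNReal.ofReal_le_ofReal ?_
      calc A * (B ^ 2 * 2 ^ 0 * ε * V) = A * (B ^ 2 * V) * ε := by ring
        _ ≤ _ := by gcongr
    have q2 : ENNReal.ofReal A * (ENNReal.ofReal e
        * (ENNReal.ofReal (B ^ 2 * 2 ^ 0 * ε) * ENNReal.ofReal V))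
        ≤ ENNReal.ofReal (A * (B ^ 2 * V) * ε ^ s) := by
      refine le_trans ?_ q1
      refine mul_le_mul_right ?_ _
      exact mul_le_of_le_one_left zero_le (by simpa using ENNReal.ofReal_le_ofReal he1)
    have q3 : ENNReal.ofReal A * ENNReal.ofReal e * ∑' l, ENNReal.ofReal (Φ.coeff f l ^ 2)
        ≤ ENNReal.ofReal (A * (2 * (CB * R' ^ 2)) * ε ^ s) := by
      calc _ ≤ ENNReal.ofReal A * ENNReal.ofReal e * ENNReal.ofReal (CB * R' ^ 2) := by gcongr
        _ = ENNReal.ofReal (A * e * (CB * R' ^ 2)) := by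
          rw [← ENNReal.ofReal_mul hA0, ← ENNReal.ofReal_mul (by positivity)]
        _ ≤ _ := by
          refine ENNReal.ofReal_le_ofReal ?_
          calc A * e * (CB * R' ^ 2) ≤ A * (2 * ε ^ s) * (CB * R' ^ 2) := by gcongr
            _ = _ := by ring
    have q4 : (ENNReal.ofReal A + 1) * ENNReal.ofReal Cm
        * ∑' j : ℕ, ENNReal.ofReal (min (2 ^ j * ε) ((2 : ℝ) ^ (-((j : ℝ) * a))))
        ≤ ENNReal.ofReal ((A + 1) * Cm * CS * ε ^ s) := by
      rw [← ENNReal.ofReal_one, ← ENNReal.ofReal_add hA0 zero_le_one,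
        mul_assoc _ CS, ENNReal.ofReal_mul (by positivity),
        ENNReal.ofReal_mul (p := A + 1) (by positivity)]
      exact mul_le_mul_right (hmin ε hε0 hε1) _
    have q5 : ENNReal.ofReal A * ENNReal.ofReal e * ENNReal.ofReal V
        * ∑' j, (if j ≤ j₀.toNat then ENNReal.ofReal (B ^ 2 * 2 ^ j * ε) else 0)
        ≤ ENNReal.ofReal (A * V * (2 * B ^ 2 * 2 ^ c) * ε ^ s) := by
      calc _ ≤ ENNReal.ofReal A * ENNReal.ofReal e * ENNReal.ofReal V
            * ENNReal.ofReal (2 * 2 ^ j₀.toNat * (B ^ 2 * ε)) := by gcongr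
        _ = ENNReal.ofReal (A * e * V * (2 * 2 ^ j₀.toNat * (B ^ 2 * ε))) := by
          rw [← ENNReal.ofReal_mul hA0, ← ENNReal.ofReal_mul (by positivity),
            ← ENNReal.ofReal_mul (by positivity)]
        _ ≤ _ := by
          refine ENNReal.ofReal_le_ofReal ?_
          calc A * e * V * (2 * 2 ^ j₀.toNat * (B ^ 2 * ε))
              = A * V * (2 * B ^ 2 * (e * 2 ^ j₀.toNat)) * ε := by ring
            _ ≤ A * V * (2 * B ^ 2 * 2 ^ c) * ε ^ s := by gcongr
    refine (add_le_add (add_le_add (add_le_add (add_le_add q1 q2) q3) q4) q5).trans ?_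
    rw [← ENNReal.ofReal_add (by positivity) (by positivity),
      ← ENNReal.ofReal_add (by positivity) (by positivity),
      ← ENNReal.ofReal_add (by positivity) (by positivity),
      ← ENNReal.ofReal_add (by positivity) (by positivity)]
    refine ENNReal.ofReal_le_ofReal (le_of_eq ?_)
    rw [hK]; ring
  refine (hrisk hf.memL2 hN γ n j₀ (by omega)).trans ?_
  refine (mul_le_mul_right hfinal _).trans ?_
  rw [← ENNReal.ofReal_mul hCD.le]
  refine ENNReal.ofReal_le_ofReal ?_
  nlinarith
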